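/- Let $\mathcal H$ be a complex Hilbert space, let $\mathcal X\subseteq\mathcal H$ be a dense, continuously embedded Hilbert space, and let $\mathcal X^*\supseteq\mathcal H$ be its space of bounded conjugate-linear functionals, with $\langle\cdot,\cdot\rangle$ extending the scalar product of $\mathcal H$. Let $H$ be a self-adjoint operator in $\mathcal H$ with spectral family $E$, absolutely continuous projection $P_{ac}$ and resolvent $R(z)=(H-z)^{-1}$. Let $J\subseteq\mathbb R$ be open with $P_{ac}E(J)=E(J)$, and suppose that for $\lambda\in J$ there is $A(\lambda)\in B(\mathcal X,\mathcal X^*)$ with $$\langle A(\lambda)f,g\rangle=\frac{d}{d\lambda}\big(E(-\infty,\lambda)P_{ac}f,g\big)_{\mathcal H},\qquad f,g\in\mathcal X,$$ such that, for some $\alpha\in(0,1]$, $A$ is $\alpha$-Hölder continuous in the norm of $B(\mathcal X,\mathcal X^*)$ on every compact subset of $J$. Let $\mathcal X^*_H\subseteq\mathcal X^*$ be a dense, continuously embedded Hilbert space such that $R(z)\mathcal X\subseteq\mathcal X^*_H$ whenever $\operatorname{Im}z\ne0$, and such that for every $\lambda\in J$ the norms $\|R(\lambda\pm i\varepsilon)\|_{B(\mathcal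 X,\mathcal X^*_H)}$ stay bounded as $\varepsilon\downarrow0$. Then the limits $R^\pm(\lambda)=\lim_{\varepsilon\downarrow0}R(\lambda\pm i\varepsilon)$, $\lambda\in J$, exist in the norm of $B(\mathcal X,\mathcal X^*)$ and lie in $B(\mathcal X,\mathcal X^*_H)$. Let $V:\mathcal X^*_H\to\mathcal X$ be a symmetric short-range perturbation: $V$ is linear and compact; $\mathcal D=D(H)\cap\mathcal X^*_H$ is dense in $\mathcal H$ and $V|_{\mathcal D}$ is symmetric in $\mathcal H$; and for some $z$ with $\operatorname{Im}z\ne0$ there is a linear subspace $\mathcal D_z\subseteq\mathcal D$ such that $(H-z)\mathcal D_z$ is contained and dense in $\mathcal X$. Assume that the operators $I+VR^\pm(\lambda)$, $\lambda\in J$, are invertible in $\mathcal X$ with $\sup_{\lambda\in J}\|[I+VR^\pm(\lambda)]^{-1}\|_{B(\mathcal X,\mathcal X)}<\infty$. Then $(H+V)|_{\mathcal D}$ is essentially self-adjoint. Denote its closure by $\widetilde H$ and the spectral family of $\widetilde H$ by $\widetilde E$. For every $m\in\mathbb N$ there is a constant $C>0$ with the following property. Let $\sigma,\widetilde\sigma$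 be real-valued and continuous on $J$, let $\mathcal N,\widetilde{\mathcal N}\subseteq J$ be finite, and let the real-valued functions $a\in C^1(J\setminus\mathcal N)$ and $\widetilde a\in C^1(J\setminus\widetilde{\mathcal N})$ satisfy $a'>0$ on $J\setminus\mathcal N$ and $\widetilde a'>0$ on $J\setminus\widetilde{\mathcal N}$. Suppose that $\widetilde a$ takes each of its values at most $m$ times on $J\setminus\widetilde{\mathcal N}$ (if $J\setminus\widetilde{\mathcal N}$ has at most $m$ connected components, this holds automatically), and that $$\frac{|\sigma(\lambda)|^2}{a'(\lambda)}\ \ge\ \frac{|\widetilde\sigma(\lambda)|^2}{\widetilde a'(\lambda)},\qquad \lambda\in J\setminus(\mathcal N\cup\widetilde{\mathcal N}).$$ If, for some $C_0>0$, $$\|\sigma(H)e^{ita(H)}E(J)\varphi\|_{L^2(\mathbb R_t,\mathcal X^*)}\le C_0\|\varphi\|_{\mathcal H}\qquad\text{for all }\varphi\in\mathcal H,$$ then $$\|\widetilde\sigma(\widetilde H)e^{it\widetilde a(\widetilde H)}\widetilde E(J)\varphi\|_{L^2(\mathbb R_t,\mathcal X^*)}\le C\,C_0\|\varphi\|_{\mathcal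 H}\qquad\text{for all }\varphi\in\mathcal H.$$ Here each estimate means that the map $\varphi\mapsto\sigma(H)e^{ita(H)}E(J)\varphi$ (resp. with tildes), defined by the spectral calculus on the dense domain of $\sigma(H)E(J)$, extends to a bounded operator $\mathcal H\to L^2(\mathbb R_t,\mathcal X^*)$ with norm at most $C_0$ (resp. $CC_0$). -/

import Mathlib

open MeasureTheory Filter Topology Set
open scoped ENNReal

/-! ### Projection-valued measures and the spectral measure of a self-adjoint operator -/

/-- A projection-valued measure on the Borel sets of `ℝ`, acting on the Hilbert space `𝓗`
(with the value `0` on non-measurable sets). -/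
structure PVM (𝓗 : Type*) [NormedAddCommGroup 𝓗] [InnerProductSpace ℂ 𝓗] [CompleteSpace 𝓗] where
  /-- the projection attached to a set -/
  proj : Set ℝ → (𝓗 →L[ℂ] 𝓗)
  isStarProjection : ∀ B, MeasurableSet B → IsStarProjection (proj B)
  proj_univ : proj Set.univ = 1
  proj_inter : ∀ A B, MeasurableSet A → MeasurableSet B → proj (A ∩ B) = proj A * proj B
  hasSum_iUnion : ∀ B : ℕ → Set ℝ, (∀ n, MeasurableSet (B n)) →
    Pairwise (fun m n => Disjoint (B m) (B n)) →
      ∀ φ : 𝓗, HasSum (fun n => proj (B n) φ) (proj (⋃ n, B n) φ)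
  not_measurable : ∀ B, ¬ MeasurableSet B → proj B = 0

namespace PVM

section
variable {𝓗 : Type*} [NormedAddCommGroup 𝓗] [InnerProductSpace ℂ 𝓗] [CompleteSpace 𝓗]

theorem inner_proj (E : PVM 𝓗) {B : Set ℝ} (hB : MeasurableSet B) (φ : 𝓗) :
    inner ℂ φ (E.proj B φ) = ((‖E.proj B φ‖ ^ 2 : ℝ) : ℂ) := by
  have h := E.isStarProjection B hB
  have h1 : E.proj B (E.proj B φ) = E.proj B φ :=
    congrArg (fun T : 𝓗 →L[ℂ] 𝓗 => T φ) h.isIdempotentElem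
  have h2 := h.isSelfAdjoint.isSymmetric φ (E.proj B φ)
  simp only [ContinuousLinearMap.coe_coe] at h2
  rw [h1] at h2
  rw [← h2, inner_self_eq_norm_sq_to_K]
  push_cast
  rfl

theorem hasSum_norm_sq (E : PVM 𝓗) (φ : 𝓗) (B : ℕ → Set ℝ) (hB : ∀ n, MeasurableSet (B n))
    (hd : Pairwise (fun m n => Disjoint (B m) (B n))) :
    HasSum (fun n => ‖E.proj (B n) φ‖ ^ 2) (‖E.proj (⋃ n, B n) φ‖ ^ 2) := by
  have h := (E.hasSum_iUnion B hB hd φ).mapL (innerSL ℂ φ)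
  simp only [innerSL_apply_apply] at h
  rw [E.inner_proj (MeasurableSet.iUnion hB)] at h
  simp_rw [fun n => E.inner_proj (hB n) φ] at h
  exact_mod_cast h

theorem proj_empty (E : PVM 𝓗) : E.proj ∅ = 0 := by
  ext φ
  have h := (E.hasSum_norm_sq φ (fun _ => ∅) (fun _ => MeasurableSet.empty)
    (fun _ _ _ => by simp)).summable.tendsto_atTop_zero
  have h0 := tendsto_nhds_unique tendsto_const_nhds h
  simpa using h0

/-- The scalar spectral measure `μ_φ(B) = (E(B)φ, φ) = ‖E(B)φ‖²`. -/
noncomputable def scalarMeasure (E : PVM 𝓗) (φ : 𝓗) : Measure ℝ :=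
  Measure.ofMeasurable (fun B _ => ENNReal.ofReal (‖E.proj B φ‖ ^ 2))
    (by simp [E.proj_empty])
    (by
      intro B hB hd
      have h := E.hasSum_norm_sq φ B hB hd
      rw [← h.tsum_eq, ENNReal.ofReal_tsum_of_nonneg (fun n => by positivity) h.summable])

theorem scalarMeasure_apply (E : PVM 𝓗) (φ : 𝓗) {B : Set ℝ} (hB : MeasurableSet B) :
    E.scalarMeasure φ B = ENNReal.ofReal (‖E.proj B φ‖ ^ 2) :=
  Measure.ofMeasurable_apply B hB

/-- The integral `∫ s dE φ = ∑ c • E(s = c) φ` of a simple function. -/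
noncomputable def simpleIntegral (E : PVM 𝓗) (s : SimpleFunc ℝ ℂ) (φ : 𝓗) : 𝓗 :=
  ∑ c ∈ s.range, c • E.proj (s ⁻¹' {c}) φ

/-- `u = ∫ f dE φ`: the vector `u` is the limit of `∫ sₙ dE φ` for simple functions `sₙ → f` in
`L²(μ_φ)`.  Such a `u` exists exactly if `f ∈ L²(μ_φ)`, and it is then unique. -/
def HasIntegral (E : PVM 𝓗) (f : ℝ → ℂ) (φ u : 𝓗) : Prop :=
  MemLp f 2 (E.scalarMeasure φ) ∧
    ∃ s : ℕ → SimpleFunc ℝ ℂ,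
      Tendsto (fun n => eLpNorm (fun x => f x - s n x) 2 (E.scalarMeasure φ)) atTop (𝓝 0) ∧
      Tendsto (fun n => E.simpleIntegral (s n) φ) atTop (𝓝 u)

/-- The vector `∫ f dE φ`, for `φ` with `f ∈ L²(μ_φ)`. -/
noncomputable def integral (E : PVM 𝓗) (f : ℝ → ℂ) (φ : 𝓗) : 𝓗 :=
  Classical.epsilon (E.HasIntegral f φ)

/-- The absolutely continuous subspace: all `φ` with `μ_φ` absolutely continuous with respect to
Lebesgue measure. -/
noncomputable def acSubspace (E : PVM 𝓗) : Submodule ℂ 𝓗 where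
  carrier := {φ | E.scalarMeasure φ ≪ volume}
  zero_mem' := by
    refine Measure.AbsolutelyContinuous.mk fun B hB _ => ?_
    simp [E.scalarMeasure_apply 0 hB]
  add_mem' := by
    intro φ ψ hφ hψ
    refine Measure.AbsolutelyContinuous.mk fun B hB h0 => ?_
    have h1 := hφ h0
    have h2 := hψ h0
    rw [E.scalarMeasure_apply _ hB, ENNReal.ofReal_eq_zero] at h1 h2 ⊢
    have h1' : ‖E.proj B φ‖ = 0 := by nlinarith [norm_nonneg (E.proj B φ)]
    have h2' : ‖E.proj B ψ‖ = 0 := by nlinarith [norm_nonneg (E.proj B ψ)]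
    rw [norm_eq_zero] at h1' h2'
    simp [h1', h2']
  smul_mem' := by
    intro c φ hφ
    refine Measure.AbsolutelyContinuous.mk fun B hB h0 => ?_
    have h1 := hφ h0
    rw [E.scalarMeasure_apply _ hB, ENNReal.ofReal_eq_zero] at h1 ⊢
    have h1' : ‖E.proj B φ‖ = 0 := by nlinarith [norm_nonneg (E.proj B φ)]
    rw [norm_eq_zero] at h1'
    simp [h1']

/-- The orthogonal projection `P_ac` onto the absolutely continuous subspace (which is closed, so
that taking its closure changes nothing). -/
noncomputable def acProj (E : PVM 𝓗) : 𝓗 →L[ℂ] 𝓗 :=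
  E.acSubspace.topologicalClosure.starProjection

open scoped Classical in
/-- The projection-valued measure concentrated at the point `0`. -/
noncomputable instance : Inhabited (PVM 𝓗) where
  default :=
    { proj := fun B => if MeasurableSet B ∧ (0 : ℝ) ∈ B then 1 else 0
      isStarProjection := by
        intro B hB
        by_cases h : (0 : ℝ) ∈ B
        · simp [h, hB]
        · simp [h]
      proj_univ := by simp
      proj_inter := by
        intro A B hA hB
        by_cases h : (0 : ℝ) ∈ A <;> by_cases h' : (0 : ℝ) ∈ B <;>
          simp [h, h', hA, hB, hA.inter hB]
      hasSum_iUnion := by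
        intro B hB hd φ
        by_cases h : ∃ n, (0 : ℝ) ∈ B n
        · obtain ⟨n, hn⟩ := h
          have hU : (0 : ℝ) ∈ ⋃ n, B n := Set.mem_iUnion.2 ⟨n, hn⟩
          have key : ∀ m, m ≠ n → (0 : ℝ) ∉ B m := fun m hm h0 =>
            Set.disjoint_left.1 (hd hm) h0 hn
          have := hasSum_single (f := fun m =>
            (if MeasurableSet (B m) ∧ (0 : ℝ) ∈ B m then (1 : 𝓗 →L[ℂ] 𝓗) else 0) φ) n
            (fun m hm => by simp [key m hm])
          simpa [hn, hB n, hU, MeasurableSet.iUnion hB] using this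
        · push Not at h
          have hU : (0 : ℝ) ∉ ⋃ n, B n := by simpa using h
          simp only [h, hU, and_false, if_false]
          simp
      not_measurable := by
        intro B hB
        simp [hB] }

end

end PVM

/-- `E` is the spectral measure of `H`: `H = ∫ x dE(x)`, as an equality of unbounded operators. -/
def IsSpectralMeasure {𝓗 : Type*} [NormedAddCommGroup 𝓗] [InnerProductSpace ℂ 𝓗]
    [CompleteSpace 𝓗] (H : 𝓗 →ₗ.[ℂ] 𝓗) (E : PVM 𝓗) : Prop :=
  ∀ φ u : 𝓗, (φ, u) ∈ H.graph ↔ E.HasIntegral (fun x => (x : ℂ)) φ u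

/-- The spectral measure of a self-adjoint operator `H`; by the spectral theorem there is exactly
one. -/
noncomputable def spectralMeasure {𝓗 : Type*} [NormedAddCommGroup 𝓗] [InnerProductSpace ℂ 𝓗]
    [CompleteSpace 𝓗] (H : 𝓗 →ₗ.[ℂ] 𝓗) : PVM 𝓗 :=
  Classical.epsilon (IsSpectralMeasure H)

/-- The resolvent `R(z) = (H - z)⁻¹`, for `z` in the resolvent set of `H`: the bounded operator
with `R(z) f = u` exactly if `u ∈ D(H)` and `H u = f + z u`. -/
noncomputable def resolventOp {𝓗 : Type*} [NormedAddCommGroup 𝓗] [InnerProductSpace ℂ 𝓗]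
    (H : 𝓗 →ₗ.[ℂ] 𝓗) (z : ℂ) : 𝓗 →L[ℂ] 𝓗 :=
  Classical.epsilon fun R : 𝓗 →L[ℂ] 𝓗 => ∀ f u : 𝓗, R f = u ↔ (u, f + z • u) ∈ H.graph

/-! ### The triple `X ⊆ 𝓗 ⊆ X*` and the spectral density

The subspace `X ⊆ 𝓗` is given by its inclusion `ι`, and `X*` is the space of bounded
conjugate-linear functionals on `X`, so that the pairing of `X*` and `X` extends the scalar product
of `𝓗`, which is linear in its first entry in the usual notation `(f, g)`, that is, `inner ℂ g f`.
-/

/-- The dual space `X*` of bounded conjugate-linear functionals, with the operator norm. -/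
abbrev AntiDual (X : Type*) [NormedAddCommGroup X] [InnerProductSpace ℂ X] : Type _ :=
  X →L⋆[ℂ] ℂ

section
variable {𝓗 : Type*} [NormedAddCommGroup 𝓗] [InnerProductSpace ℂ 𝓗]
variable {X : Type*} [NormedAddCommGroup X] [InnerProductSpace ℂ X]
variable {Y : Type*} [NormedAddCommGroup Y] [InnerProductSpace ℂ Y]

/-- The canonical inclusion `𝓗 ⊆ X*`, `u ↦ (g ↦ (u, g))`. -/
noncomputable def toAntiDual (ι : X →L[ℂ] 𝓗) : 𝓗 →L[ℂ] AntiDual X :=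
  ((ContinuousLinearMap.compSL X 𝓗 ℂ (RingHom.id ℂ) (starRingEnd ℂ)).flip ι) ∘L innerSLFlip ℂ

/-- A bounded operator on `𝓗`, viewed as an operator from `X` to `X*`. -/
noncomputable def asXDual (ι : X →L[ℂ] 𝓗) (T : 𝓗 →L[ℂ] 𝓗) : X →L[ℂ] AntiDual X :=
  toAntiDual ι ∘L T ∘L ι

/-- `A(x)` is the weak derivative of `E(-∞, x) P_ac` in `B(X, X*)`, for `x ∈ J`. -/
def IsSpectralDensity [CompleteSpace 𝓗] (ι : X →L[ℂ] 𝓗) (E : PVM 𝓗) (J : Set ℝ)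
    (A : ℝ → X →L[ℂ] AntiDual X) : Prop :=
  ∀ x ∈ J, ∀ f g : X,
    HasDerivAt (fun y : ℝ => inner ℂ (ι g) (E.proj (Iio y) (E.acProj (ι f)))) (A x f g) x

/-- `H` is purely absolutely continuous over `J`, and its spectral density exists in `B(X, X*)` and
is (locally) Hölder continuous on `J` in the operator norm. -/
def HasHolderSpectralDensity [CompleteSpace 𝓗] (ι : X →L[ℂ] 𝓗) (H : 𝓗 →ₗ.[ℂ] 𝓗) (J : Set ℝ) : Prop :=
  (spectralMeasure H).acProj * (spectralMeasure H).proj J = (spectralMeasure H).proj J ∧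
  ∃ A : ℝ → X →L[ℂ] AntiDual X, IsSpectralDensity ι (spectralMeasure H) J A ∧
    ∃ α : ℝ, 0 < α ∧ α ≤ 1 ∧ ∀ K ⊆ J, IsCompact K →
      ∃ c : ℝ, ∀ x ∈ K, ∀ y ∈ K, ‖A x - A y‖ ≤ c * |x - y| ^ α

/-! ### The space `X*_H` and the perturbation `V`

The subspace `X*_H ⊆ X*` is a space `Y` with an inclusion `j`.  For `u ∈ 𝓗`, the equation
`j y = toAntiDual ι u` says that `u` belongs to `X*_H` and is there the element `y`. -/

/-- The space `X*_H` is adapted to `H` over `J`: the resolvent maps `X` into `X*_H`, with bounds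
that do not blow up as the spectral parameter approaches a point of `J` vertically. -/
structure IsAdapted (ι : X →L[ℂ] 𝓗) (j : Y →L[ℂ] AntiDual X) (H : 𝓗 →ₗ.[ℂ] 𝓗)
    (J : Set ℝ) : Prop where
  maps_into : ∀ z : ℂ, z.im ≠ 0 → ∀ f : X, ∃ y : Y, j y = toAntiDual ι (resolventOp H z (ι f))
  locally_bounded : ∀ x ∈ J, ∃ M : ℝ, ∃ δ > 0, ∀ ε : ℝ, 0 < |ε| → |ε| < δ →
    ∀ (f : X) (y : Y), j y = toAntiDual ι (resolventOp H (x + ε * Complex.I) (ι f)) →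
      ‖y‖ ≤ M * ‖f‖

/-- The linear subspace `D(H) ∩ X*_H` of `𝓗`. -/
noncomputable def interDomain (ι : X →L[ℂ] 𝓗) (j : Y →L[ℂ] AntiDual X) (H : 𝓗 →ₗ.[ℂ] 𝓗) : Submodule ℂ 𝓗 :=
  H.domain ⊓ (LinearMap.range j.toLinearMap).comap (toAntiDual ι).toLinearMap

/-- `V : X*_H → X` is a symmetric short-range perturbation of `H`. -/
structure IsShortRange (ι : X →L[ℂ] 𝓗) (j : Y →L[ℂ] AntiDual X) (H : 𝓗 →ₗ.[ℂ] 𝓗)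
    (V : Y →L[ℂ] X) : Prop where
  compact : IsCompactOperator V
  dense : Dense (interDomain ι j H : Set 𝓗)
  symmetric : ∀ u ∈ interDomain ι j H, ∀ v ∈ interDomain ι j H, ∀ y w : Y,
    j y = toAntiDual ι u → j w = toAntiDual ι v →
      inner ℂ (ι (V y)) v = inner ℂ u (ι (V w))
  exists_dense_image : ∃ z : ℂ, z.im ≠ 0 ∧ ∃ D : Submodule ℂ 𝓗, D ≤ interDomain ι j H ∧
    (∀ u ∈ D, ∃ f : X, (u, ι f + z • u) ∈ H.graph) ∧
    Dense {f : X | ∃ u ∈ D, (u, ι f + z • u) ∈ H.graph}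

/-- The graph of `H + V` on `D(H) ∩ X*_H`. -/
noncomputable def perturbedGraph (ι : X →L[ℂ] 𝓗) (j : Y →L[ℂ] AntiDual X) (H : 𝓗 →ₗ.[ℂ] 𝓗)
    (V : Y →L[ℂ] X) : Submodule ℂ (𝓗 × 𝓗) where
  carrier := {p | ∃ y : Y, j y = toAntiDual ι p.1 ∧ (p.1, p.2 - ι (V y)) ∈ H.graph}
  zero_mem' := ⟨0, by simp, by simp⟩
  add_mem' := by
    rintro p q ⟨y, hy, hp⟩ ⟨w, hw, hq⟩
    refine ⟨y + w, by simp [hy, hw], ?_⟩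
    have h := H.graph.add_mem hp hq
    convert h using 1
    ext
    · rfl
    · simp
      abel
  smul_mem' := by
    rintro c p ⟨y, hy, hp⟩
    refine ⟨c • y, by simp [hy], ?_⟩
    have h := H.graph.smul_mem c hp
    convert h using 1
    ext
    · rfl
    · simp [smul_sub]

/-- The operator `H + V`: the closure of its restriction to `D(H) ∩ X*_H`. -/
noncomputable def perturbed (ι : X →L[ℂ] 𝓗) (j : Y →L[ℂ] AntiDual X) (H : 𝓗 →ₗ.[ℂ] 𝓗)
    (V : Y →L[ℂ] X) : 𝓗 →ₗ.[ℂ] 𝓗 :=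
  (perturbedGraph ι j H V).topologicalClosure.toLinearPMap

/-- `W : X → X*_H` is the limiting value `R⁺(x)` (for `s = 1`) or `R⁻(x)` (for `s = -1`) of the
resolvent: `R(x ± iε) → W` as `ε ↓ 0` in the operator norm of `B(X, X*)`. -/
def IsLimitResolvent (ι : X →L[ℂ] 𝓗) (j : Y →L[ℂ] AntiDual X) (H : 𝓗 →ₗ.[ℂ] 𝓗)
    (s x : ℝ) (W : X →L[ℂ] Y) : Prop :=
  Tendsto (fun ε : ℝ => asXDual ι (resolventOp H (x + s * ε * Complex.I))) (𝓝[>] 0) (𝓝 (j ∘L W))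

/-- The operators `I + V R^±(x)`, `x ∈ J`, are invertible in `X`, and their inverses are bounded
uniformly in `x ∈ J`. -/
def UniformlyInvertible (ι : X →L[ℂ] 𝓗) (j : Y →L[ℂ] AntiDual X) (H : 𝓗 →ₗ.[ℂ] 𝓗)
    (V : Y →L[ℂ] X) (J : Set ℝ) : Prop :=
  ∃ M : ℝ, ∀ x ∈ J, ∀ s : ℝ, s = 1 ∨ s = -1 → ∀ W : X →L[ℂ] Y, IsLimitResolvent ι j H s x W →
    IsUnit (1 + V ∘L W) ∧ ‖Ring.inverse (1 + V ∘L W)‖ ≤ M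

/-! ### Smoothing estimates -/

/-- The conditions on the pair `σ, a`: `σ` is continuous on `J`, and off the finite set `N ⊆ J`
the function `a` is continuously differentiable with positive derivative. -/
structure IsAdmissiblePair (J : Set ℝ) (N : Finset ℝ) (σ a : ℝ → ℝ) : Prop where
  subset : (N : Set ℝ) ⊆ J
  continuousOn : ContinuousOn σ J
  contDiffOn : ContDiffOn ℝ 1 a (J \ N)
  deriv_pos : ∀ x ∈ J \ N, 0 < deriv a x

/-- The vector `σ(H) e^{ita(H)} E(J) φ`. -/
noncomputable def evolution [CompleteSpace 𝓗] (H : 𝓗 →ₗ.[ℂ] 𝓗) (J : Set ℝ) (σ a : ℝ → ℝ) (t : ℝ) (φ : 𝓗) : 𝓗 :=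
  (spectralMeasure H).integral
    (J.indicator fun x => (σ x : ℂ) * Complex.exp (Complex.I * t * a x)) φ

/-- The estimate `‖σ(H) e^{ita(H)} E(J) φ‖_{L²(ℝ_t, X*)} ≤ C ‖φ‖` for all `φ ∈ 𝓗`.  As `σ(H) E(J)`
may be unbounded, this says that the map `φ ↦ σ(H) e^{ita(H)} E(J) φ`, given on the domain of
`σ(H) E(J)` by the spectral calculus, extends to a bounded operator from `𝓗` to `L²(ℝ_t, X*)`, of
norm at most `C`. -/
def SmoothingEstimate [CompleteSpace 𝓗] (ι : X →L[ℂ] 𝓗) (H : 𝓗 →ₗ.[ℂ] 𝓗) (J : Set ℝ) (σ a : ℝ → ℝ)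
    (C : ℝ) : Prop :=
  ∃ S : 𝓗 →L[ℂ] Lp (AntiDual X) 2 (volume : Measure ℝ),
    (∀ φ : 𝓗, MemLp (J.indicator σ) 2 ((spectralMeasure H).scalarMeasure φ) →
      S φ =ᵐ[volume] fun t : ℝ => toAntiDual ι (evolution H J σ a t φ)) ∧
    ∀ φ : 𝓗, ‖S φ‖ ≤ C * ‖φ‖

end

/-! ### Extending a functional calculus from an algebra of functions to `L²` functions -/

/-! The estimate for H and the one for H̃ are compared through the spectral density A of H: up to
constants, smoothing amounts to a pointwise bound σ²‖A‖ ≤ c a'.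

From the estimate to the density. Apply the estimate to E([x₀, x₀ + r))f with r small. For |t| up to
about 1/(a'(x₀)r) the phase t·a hardly varies on the interval, so the pairing of the evolved vector
with f shows no cancellation. Integrating its square over this time window gives σ²‖A‖ ≤ 64 C₀² a'
(`norm_density_le_of_smoothing`). The comparison hypothesis turns this into σ̃²‖A‖ ≤ 64 C₀² ã'.

Across the perturbation. On X the perturbed resolvent is R(z)(I + VR(z))⁻¹; the Fredholm alternative
and the symmetry of V make the inverse exist off the real axis. Hence H + V - z has dense range for
all nonreal z, and the closure is self-adjoint (`isSelfAdjoint_perturbed`). Hölder continuity of A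
gives R^±(x) = B ± iπA(x) in the norm of B(X, X*) (`exists_tendsto_asXDual_resolvent`). The bounds
in X*_H and the compactness of V improve this to norm convergence of VR(x + iε) in B(X). So ε‖R̃(x +
iε)f‖² is asymptotically at most 2πM²‖A(x)‖‖f‖², where M bounds the inverses. The spectral measure
of an interval of radius ε is at most 2ε²‖R̃(x + iε)f‖², and differentiation of measures yields
dμ̃_f ≤ 2πM²‖A(x)‖‖f‖² dx on J (`scalarMeasure_perturbed_le`). A spectral density of H̃ is never
constructed; this domination is enough.

Back to an estimate. Suppose σ̃² dμ̃_f ≤ κ‖f‖² ã' dx, and round ã down to multiples of 1/n. The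
evolution becomes a trigonometric sum of terms e^{itk/n}w_k, orthogonal over a period 2πn. By
duality ‖w_k‖² in X* is at most κ(∫ã')‖Ẽ(G_k)φ‖², the integral being over the cell G_k, and the area
formula bounds that integral by m/n because ã has multiplicity at most m. The factors n and 1/n
cancel, the projections sum by Bessel, and Fatou's lemma removes the rounding
(`smoothingEstimate_of_bound`).

All this presupposes the L² functional calculus and the spectral theorem, which are established
first: the spectral measure and the resolvent are defined by choice and have no properties until
existence is known. -/

theorem memLp_two_add_measure {α : Type*} [MeasurableSpace α] {μ ν : Measure α} {f : α → ℂ}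
    (hμ : MemLp f 2 μ) (hν : MemLp f 2 ν) : MemLp f 2 (μ + ν) := by
  rw [memLp_two_iff_integrable_sq_norm (hμ.1.add_measure hν.1)]
  exact ((memLp_two_iff_integrable_sq_norm hμ.1).1 hμ).add_measure
    ((memLp_two_iff_integrable_sq_norm hν.1).1 hν)

/-- An algebra `𝒜` of bounded functions on `α`, acting on the Hilbert space `𝓗` in such a way that
`‖a(H) φ‖` is the `L²` norm of `a` for a finite measure attached to `φ`. -/
structure SpectralCalculus (𝓗 : Type*) [NormedAddCommGroup 𝓗] [InnerProductSpace ℂ 𝓗]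
    (α : Type*) [MeasurableSpace α] (𝒜 : Type*) [Ring 𝒜] [Algebra ℂ 𝒜] where
  /-- the function on `α` given by an element of the algebra -/
  val : 𝒜 →ₐ[ℂ] (α → ℂ)
  /-- the operator on `𝓗` given by an element of the algebra -/
  op : 𝒜 →ₐ[ℂ] (𝓗 →L[ℂ] 𝓗)
  /-- complex conjugation -/
  conj : 𝒜 → 𝒜
  val_conj : ∀ a x, val (conj a) x = starRingEnd ℂ (val a x)
  inner_op : ∀ a φ ψ, inner ℂ ψ (op a φ) = inner ℂ (op (conj a) ψ) φ
  /-- the measure attached to a vector -/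
  meas : 𝓗 → Measure α
  isFiniteMeasure : ∀ φ, IsFiniteMeasure (meas φ)
  measurable : ∀ a, Measurable (val a)
  bounded : ∀ a, ∃ C : ℝ, ∀ x, ‖val a x‖ ≤ C
  eLpNorm_val : ∀ a φ, eLpNorm (val a) 2 (meas φ) = ‖op a φ‖ₑ
  exists_approx : ∀ (ν : Measure α) [IsFiniteMeasure ν] (f : α → ℂ), MemLp f 2 ν →
    ∀ ε : ℝ≥0∞, ε ≠ 0 → ∃ a, eLpNorm (fun x => f x - val a x) 2 ν ≤ ε

namespace SpectralCalculus

variable {𝓗 : Type*} [NormedAddCommGroup 𝓗] [InnerProductSpace ℂ 𝓗]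
  {α : Type*} [MeasurableSpace α] {𝒜 : Type*} [Ring 𝒜] [Algebra ℂ 𝒜]

attribute [instance] SpectralCalculus.isFiniteMeasure

/-- `u` is the value at `φ` of the operator given by the function `f`. -/
def Has (F : SpectralCalculus 𝓗 α 𝒜) (f : α → ℂ) (φ u : 𝓗) : Prop :=
  MemLp f 2 (F.meas φ) ∧
    ∃ s : ℕ → 𝒜,
      Tendsto (fun n => eLpNorm (fun x => f x - F.val (s n) x) 2 (F.meas φ)) atTop (𝓝 0) ∧
      Tendsto (fun n => F.op (s n) φ) atTop (𝓝 u)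

variable (F : SpectralCalculus 𝓗 α 𝒜)

/-- The measure is arbitrary so that one sequence can serve several vectors: with ν a sum of the
measures attached to them, linearity in the vector and the adjoint relation pass to the limit
together. -/
theorem exists_seq (ν : Measure α) [IsFiniteMeasure ν] {f : α → ℂ} (hf : MemLp f 2 ν) :
    ∃ s : ℕ → 𝒜, Tendsto (fun n => eLpNorm (fun x => f x - F.val (s n) x) 2 ν) atTop (𝓝 0) := by
  have h : ∀ n : ℕ, ∃ a, eLpNorm (fun x => f x - F.val a x) 2 ν ≤ ((n : ℝ≥0∞) + 1)⁻¹ := fun n =>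
    F.exists_approx ν f hf _ (ENNReal.inv_ne_zero.2 (by finiteness))
  choose s hs using h
  refine ⟨s, tendsto_of_tendsto_of_tendsto_of_le_of_le tendsto_const_nhds ?_
    (fun _ => zero_le) hs⟩
  have := (tendsto_add_atTop_iff_nat (f := fun n : ℕ => ((n : ℝ≥0∞))⁻¹) 1).2
    ENNReal.tendsto_inv_nat_nhds_zero
  simpa using this

theorem tendsto_eLpNorm_of_le {μ ν : Measure α} (h : μ ≤ ν) {f : ℕ → α → ℂ}
    (hf : Tendsto (fun n => eLpNorm (f n) 2 ν) atTop (𝓝 0)) :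
    Tendsto (fun n => eLpNorm (f n) 2 μ) atTop (𝓝 0) :=
  tendsto_of_tendsto_of_tendsto_of_le_of_le tendsto_const_nhds hf
    (fun _ => zero_le) (fun _ => eLpNorm_mono_measure _ h)

variable {F} {f g : α → ℂ} {φ ψ u v w : 𝓗}

theorem aestronglyMeasurable_val (a : 𝒜) (ν : Measure α) : AEStronglyMeasurable (F.val a) ν :=
  (F.measurable a).aestronglyMeasurable

theorem memLp_val (a : 𝒜) (ν : Measure α) [IsFiniteMeasure ν] : MemLp (F.val a) 2 ν := by
  obtain ⟨C, hC⟩ := F.bounded a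
  exact MemLp.of_bound (aestronglyMeasurable_val a ν) C (ae_of_all _ hC)

theorem enorm_op_sub_le (hf : MemLp f 2 (F.meas φ)) (a b : 𝒜) :
    ‖F.op a φ - F.op b φ‖ₑ ≤ eLpNorm (fun x => f x - F.val a x) 2 (F.meas φ) +
      eLpNorm (fun x => f x - F.val b x) 2 (F.meas φ) := by
  have h1 : ‖F.op a φ - F.op b φ‖ₑ = eLpNorm (F.val (a - b)) 2 (F.meas φ) := by
    rw [F.eLpNorm_val, map_sub]; rfl
  have h2 : F.val (a - b) = (fun x => f x - F.val b x) - (fun x => f x - F.val a x) := by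
    ext x; simp
  rw [h1, h2, add_comm]
  refine eLpNorm_sub_le ?_ ?_ (by norm_num)
  · exact hf.1.sub (aestronglyMeasurable_val _ _)
  · exact hf.1.sub (aestronglyMeasurable_val _ _)

theorem Has.tendsto (h : F.Has f φ u) {s : ℕ → 𝒜}
    (hs : Tendsto (fun n => eLpNorm (fun x => f x - F.val (s n) x) 2 (F.meas φ)) atTop (𝓝 0)) :
    Tendsto (fun n => F.op (s n) φ) atTop (𝓝 u) := by
  obtain ⟨hf, r, hr, hu⟩ := h
  have h0 : Tendsto (fun n => F.op (s n) φ - F.op (r n) φ) atTop (𝓝 0) := by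
    rw [tendsto_zero_iff_enorm_tendsto_zero]
    refine tendsto_of_tendsto_of_tendsto_of_le_of_le tendsto_const_nhds
      (by simpa using hs.add hr) (fun _ => zero_le) (fun n => enorm_op_sub_le hf _ _)
  simpa using h0.add hu

theorem Has.unique (h : F.Has f φ u) (h' : F.Has f φ v) : u = v := by
  obtain ⟨hf, r, hr, hu⟩ := h
  exact tendsto_nhds_unique hu (h'.tendsto hr)

theorem exists_has [CompleteSpace 𝓗] (hf : MemLp f 2 (F.meas φ)) : ∃ u, F.Has f φ u := by
  obtain ⟨s, hs⟩ := F.exists_seq (F.meas φ) hf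
  have hc : CauchySeq (fun n => F.op (s n) φ) := by
    rw [EMetric.cauchySeq_iff]
    intro ε hε
    -- The errors are only bounded by ≤, so thirds rather than halves leave room for a strict
    -- inequality; ε = ⊤ is treated apart because cancelling it from a product fails.
    have := (ENNReal.tendsto_nhds_zero.1 hs) (ε / 3)
      (ENNReal.div_pos hε.ne' (by norm_num))
    rw [eventually_atTop] at this
    obtain ⟨N, hN⟩ := this
    by_cases htop : ε = ⊤
    · exact ⟨0, fun m _ n _ => by rw [htop]; exact edist_lt_top _ _⟩
    refine ⟨N, fun m hm n hn => ?_⟩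
    rw [edist_eq_enorm_sub]
    refine (enorm_op_sub_le hf _ _).trans_lt ((add_le_add (hN m hm) (hN n hn)).trans_lt ?_)
    rw [← ENNReal.add_div, ENNReal.div_lt_iff (by norm_num) (by norm_num)]
    rw [← two_mul, mul_comm]
    exact (ENNReal.mul_lt_mul_iff_right hε.ne' htop).2 (by norm_num)
  obtain ⟨u, hu⟩ := cauchySeq_tendsto_of_complete hc
  exact ⟨u, hf, s, hs, hu⟩

theorem has_val (a : 𝒜) (φ : 𝓗) : F.Has (F.val a) φ (F.op a φ) :=
  ⟨memLp_val a _, fun _ => a, by simp, tendsto_const_nhds⟩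

theorem Has.enorm_eq (h : F.Has f φ u) : ‖u‖ₑ = eLpNorm f 2 (F.meas φ) := by
  obtain ⟨hf, r, hr, hu⟩ := h
  have h1 : Tendsto (fun n => eLpNorm (F.val (r n)) 2 (F.meas φ)) atTop (𝓝 ‖u‖ₑ) := by
    simp_rw [F.eLpNorm_val]
    exact (continuous_enorm.tendsto u).comp hu
  refine tendsto_nhds_unique h1 ?_
  refine tendsto_of_tendsto_of_tendsto_of_le_of_le
    (g := fun n => eLpNorm f 2 (F.meas φ) - eLpNorm (fun x => f x - F.val (r n) x) 2 (F.meas φ))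
    (h := fun n => eLpNorm f 2 (F.meas φ) + eLpNorm (fun x => f x - F.val (r n) x) 2 (F.meas φ))
    ?_ ?_ ?_ ?_
  · simpa using ENNReal.Tendsto.sub (tendsto_const_nhds (x := eLpNorm f 2 (F.meas φ))) hr
      (Or.inr (by simp))
  · simpa using (tendsto_const_nhds (x := eLpNorm f 2 (F.meas φ))).add hr
  · intro n
    simp only
    rw [tsub_le_iff_right]
    have : f = F.val (r n) + (fun x => f x - F.val (r n) x) := by ext x; simp
    conv_lhs => rw [this]
    exact eLpNorm_add_le (aestronglyMeasurable_val _ _)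
      (hf.1.sub (aestronglyMeasurable_val _ _)) (by norm_num)
  · intro n
    simp only
    have : F.val (r n) = f - (fun x => f x - F.val (r n) x) := by ext x; simp
    conv_lhs => rw [this]
    exact eLpNorm_sub_le hf.1 (hf.1.sub (aestronglyMeasurable_val _ _)) (by norm_num)

theorem Has.add (h : F.Has f φ u) (h' : F.Has g φ v) : F.Has (f + g) φ (u + v) := by
  obtain ⟨hf, r, hr, hu⟩ := h
  obtain ⟨hg, s, hs, hv⟩ := h'
  refine ⟨hf.add hg, fun n => r n + s n, ?_, by simpa using hu.add hv⟩
  refine tendsto_of_tendsto_of_tendsto_of_le_of_le tendsto_const_nhds (by simpa using hr.add hs)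
    (fun _ => zero_le) fun n => ?_
  have : (fun x => (f + g) x - F.val (r n + s n) x) =
      (fun x => f x - F.val (r n) x) + (fun x => g x - F.val (s n) x) := by
    ext x; simp; ring
  simp only [this]
  exact eLpNorm_add_le (hf.1.sub (aestronglyMeasurable_val _ _))
    (hg.1.sub (aestronglyMeasurable_val _ _)) (by norm_num)

theorem Has.const_smul (h : F.Has f φ u) (c : ℂ) : F.Has (c • f) φ (c • u) := by
  obtain ⟨hf, r, hr, hu⟩ := h
  refine ⟨hf.const_smul c, fun n => c • r n, ?_, by simpa using hu.const_smul c⟩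
  have : ∀ n, (fun x => (c • f) x - F.val (c • r n) x) = c • (fun x => f x - F.val (r n) x) := by
    intro n; ext x; simp; ring
  simp_rw [this, eLpNorm_const_smul]
  simpa using ENNReal.Tendsto.const_mul hr (Or.inr (by simp : ‖c‖ₑ ≠ ⊤))

theorem Has.sub (h : F.Has f φ u) (h' : F.Has g φ v) : F.Has (f - g) φ (u - v) := by
  have := h.add (h'.const_smul (-1))
  simpa [sub_eq_add_neg] using this

theorem Has.congr (h : F.Has f φ u) (hfg : f =ᵐ[F.meas φ] g) : F.Has g φ u := by
  obtain ⟨hf, r, hr, hu⟩ := h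
  refine ⟨(memLp_congr_ae hfg).1 hf, r, ?_, hu⟩
  have : ∀ n, eLpNorm (fun x => g x - F.val (r n) x) 2 (F.meas φ) =
      eLpNorm (fun x => f x - F.val (r n) x) 2 (F.meas φ) := fun n =>
    eLpNorm_congr_ae (by filter_upwards [hfg] with x hx; rw [hx])
  simpa only [this] using hr

theorem Has.enorm_sub (h : F.Has f φ u) (h' : F.Has g φ v) :
    ‖u - v‖ₑ = eLpNorm (fun x => f x - g x) 2 (F.meas φ) :=
  (h.sub h').enorm_eq

theorem tendsto_of_has {ι : Type*} {l : Filter ι} {k : ι → α → ℂ} {y : ι → 𝓗}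
    (h : F.Has f φ u) (hk : ∀ i, F.Has (k i) φ (y i))
    (hl : Tendsto (fun i => eLpNorm (fun x => k i x - f x) 2 (F.meas φ)) l (𝓝 0)) :
    Tendsto y l (𝓝 u) := by
  rw [← tendsto_sub_nhds_zero_iff, tendsto_zero_iff_enorm_tendsto_zero]
  simpa only [(hk _).enorm_sub h] using hl

/-- Membership of f for the sum is a hypothesis, because the structure contains no inequality
between the measures of φ, ψ and φ + ψ. For a projection-valued measure it follows from
`memLp_add_vec`. -/
theorem Has.add_vec (h : F.Has f φ u) (h' : F.Has f ψ v) (hf : MemLp f 2 (F.meas (φ + ψ))) :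
    F.Has f (φ + ψ) (u + v) := by
  have hs := F.exists_seq (F.meas φ + F.meas ψ + F.meas (φ + ψ)) (f := f)
    (memLp_two_add_measure (memLp_two_add_measure h.1 h'.1) hf)
  obtain ⟨s, hs⟩ := hs
  have h1 := h.tendsto (s := s) (tendsto_eLpNorm_of_le
    ((Measure.le_add_right le_rfl).trans (Measure.le_add_right le_rfl)) hs)
  have h2 := h'.tendsto (s := s) (tendsto_eLpNorm_of_le
    ((Measure.le_add_left le_rfl).trans (Measure.le_add_right le_rfl)) hs)
  refine ⟨hf, s, tendsto_eLpNorm_of_le (Measure.le_add_left le_rfl) hs, ?_⟩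
  simpa using h1.add h2

theorem Has.smul_vec (h : F.Has f φ u) (c : ℂ) (hf : MemLp f 2 (F.meas (c • φ))) :
    F.Has f (c • φ) (c • u) := by
  obtain ⟨s, hs⟩ := F.exists_seq (F.meas φ + F.meas (c • φ)) (f := f) (memLp_two_add_measure h.1 hf)
  have h1 := h.tendsto (s := s) (tendsto_eLpNorm_of_le (Measure.le_add_right le_rfl) hs)
  refine ⟨hf, s, tendsto_eLpNorm_of_le (Measure.le_add_left le_rfl) hs, ?_⟩
  simpa using h1.const_smul c

theorem Has.inner_eq (h : F.Has f φ u) (h' : F.Has (fun x => starRingEnd ℂ (f x)) ψ v) :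
    inner ℂ ψ u = inner ℂ v φ := by
  have hf : MemLp f 2 (F.meas ψ) := by
    convert h'.1.star using 1
    ext x; simp
  obtain ⟨s, hs⟩ := F.exists_seq (F.meas φ + F.meas ψ) (f := f) (memLp_two_add_measure h.1 hf)
  have h1 := h.tendsto (s := s) (tendsto_eLpNorm_of_le (Measure.le_add_right le_rfl) hs)
  have h2 := h'.tendsto (s := fun n => F.conj (s n)) (by
    refine (tendsto_eLpNorm_of_le (μ := F.meas ψ) (Measure.le_add_left le_rfl) hs).congr
      fun n => ?_
    refine eLpNorm_congr_norm_ae (ae_of_all _ fun x => ?_)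
    simp only [F.val_conj, ← map_sub, RCLike.norm_conj])
  have e1 : Tendsto (fun n => inner ℂ ψ (F.op (s n) φ)) atTop (𝓝 (inner ℂ ψ u)) :=
    tendsto_const_nhds.inner h1
  have e2 : Tendsto (fun n => inner ℂ (F.op (F.conj (s n)) ψ) φ) atTop (𝓝 (inner ℂ v φ)) :=
    h2.inner tendsto_const_nhds
  simp_rw [F.inner_op] at e1
  exact tendsto_nhds_unique e1 e2

theorem tendsto_eLpNorm_mul {ι : Type*} {l : Filter ι} {ν : Measure α} {b : α → ℂ} {C : ℝ}
    (hC : ∀ x, ‖b x‖ ≤ C) {k : ι → α → ℂ}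
    (hk : Tendsto (fun i => eLpNorm (k i) 2 ν) l (𝓝 0)) :
    Tendsto (fun i => eLpNorm (fun x => b x * k i x) 2 ν) l (𝓝 0) := by
  refine tendsto_of_tendsto_of_tendsto_of_le_of_le tendsto_const_nhds
    (h := fun i => ENNReal.ofReal C * eLpNorm (k i) 2 ν) ?_ (fun _ => zero_le) fun i => ?_
  · simpa using ENNReal.Tendsto.const_mul hk (Or.inr ENNReal.ofReal_ne_top)
  · refine eLpNorm_le_mul_eLpNorm_of_ae_le_mul (ae_of_all _ fun x => ?_) 2
    rw [norm_mul]
    exact mul_le_mul_of_nonneg_right (hC x) (norm_nonneg _)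

theorem Has.op (h : F.Has f φ u) (a : 𝒜) : F.Has (fun x => F.val a x * f x) φ (F.op a u) := by
  obtain ⟨hf, r, hr, hu⟩ := h
  obtain ⟨C, hC⟩ := F.bounded a
  refine ⟨?_, fun n => a * r n, ?_, ?_⟩
  · exact hf.of_le_mul (c := C) ((aestronglyMeasurable_val a _).mul hf.1)
      (ae_of_all _ fun x => by
        rw [norm_mul]; exact mul_le_mul_of_nonneg_right (hC x) (norm_nonneg _))
  · refine (tendsto_eLpNorm_mul hC hr).congr fun n => ?_
    congr 1
    ext x
    simp
    ring
  · have := ((F.op a).continuous.tendsto u).comp hu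
    refine this.congr fun n => ?_
    simp

/-- Multiplicativity for bounded f. Approximate g simultaneously for φ and for u = f(H)φ;
multiplying by f preserves the convergence for φ. -/
theorem Has.comp_of_bounded (h : F.Has f φ u) (h' : F.Has g u w) {C : ℝ} (hC : ∀ x, ‖f x‖ ≤ C)
    (hg : MemLp g 2 (F.meas φ)) : F.Has (fun x => g x * f x) φ w := by
  obtain ⟨s, hs⟩ := F.exists_seq (F.meas φ + F.meas u) (f := g) (memLp_two_add_measure hg h'.1)
  have h1 := h'.tendsto (s := s) (tendsto_eLpNorm_of_le (Measure.le_add_left le_rfl) hs)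
  have h2 : MemLp (fun x => g x * f x) 2 (F.meas φ) :=
    hg.of_le_mul (c := C) (hg.1.mul h.1.1) (ae_of_all _ fun x => by
        rw [norm_mul, mul_comm]; exact mul_le_mul_of_nonneg_right (hC x) (norm_nonneg _))
  have h3 : ∀ n, F.Has (fun x => F.val (s n) x * f x) φ (F.op (s n) u) := fun n => h.op (s n)
  refine ⟨h2, ?_⟩
  have h4 : Tendsto (fun n => eLpNorm (fun x => g x * f x - F.val (s n) x * f x) 2 (F.meas φ))
      atTop (𝓝 0) := by
    have := tendsto_eLpNorm_mul hC
      (tendsto_eLpNorm_of_le (μ := F.meas φ) (Measure.le_add_right le_rfl) hs)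
    refine this.congr fun n => ?_
    congr 1
    ext x
    ring
  choose h5 r hr hr' using h3
  -- Diagonal choice: the n-th product is itself only a limit of algebra elements, and one of them
  -- within 1/(n + 1) in both senses is selected.
  have h6 : ∀ n : ℕ, ∃ m, eLpNorm (fun x => F.val (s n) x * f x - F.val (r n m) x) 2 (F.meas φ)
      ≤ ((n : ℝ≥0∞) + 1)⁻¹ ∧ ‖F.op (r n m) φ - F.op (s n) u‖ ≤ 1 / ((n : ℝ) + 1) := by
    intro n
    have e1 := (ENNReal.tendsto_nhds_zero.1 (hr n)) (((n : ℝ≥0∞) + 1)⁻¹)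
      (ENNReal.inv_pos.2 (by finiteness))
    have e2 := (tendsto_iff_norm_sub_tendsto_zero.1 (hr' n)).eventually
      (ge_mem_nhds (show (0 : ℝ) < 1 / ((n : ℝ) + 1) by positivity))
    exact (e1.and e2).exists
  choose m hm hm' using h6
  refine ⟨fun n => r n (m n), ?_, ?_⟩
  · have h7 : Tendsto (fun n : ℕ => ((n : ℝ≥0∞) + 1)⁻¹) atTop (𝓝 0) := by
      have := (tendsto_add_atTop_iff_nat (f := fun n : ℕ => ((n : ℝ≥0∞))⁻¹) 1).2
        ENNReal.tendsto_inv_nat_nhds_zero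
      simpa using this
    refine tendsto_of_tendsto_of_tendsto_of_le_of_le tendsto_const_nhds
      (by simpa using h4.add h7) (fun _ => zero_le) fun n => ?_
    have e : (fun x => g x * f x - F.val (r n (m n)) x) =
      (fun x => g x * f x - F.val (s n) x * f x) +
        (fun x => F.val (s n) x * f x - F.val (r n (m n)) x) := by ext x; simp
    simp only [e]
    refine (eLpNorm_add_le (h2.1.sub (h5 n).1)
      ((h5 n).1.sub (aestronglyMeasurable_val _ _)) (by norm_num)).trans ?_
    exact add_le_add le_rfl (hm n)
  · have h8 : Tendsto (fun n => F.op (r n (m n)) φ - F.op (s n) u) atTop (𝓝 0) :=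
      squeeze_zero_norm hm' tendsto_one_div_add_atTop_nhds_zero_nat
    simpa using h8.add h1

end SpectralCalculus

/-! ### The functional calculus of a projection-valued measure -/

theorem eLpNorm_two_sq {α E : Type*} [MeasurableSpace α] [NormedAddCommGroup E] (f : α → E)
    (μ : Measure α) : eLpNorm f 2 μ ^ 2 = ∫⁻ x, ‖f x‖ₑ ^ 2 ∂μ := by
  have := eLpNorm_nnreal_pow_eq_lintegral (f := f) (μ := μ) (p := 2) (by norm_num)
  simpa using this

namespace PVM

variable {𝓗 : Type*} [NormedAddCommGroup 𝓗] [InnerProductSpace ℂ 𝓗] [CompleteSpace 𝓗]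
  (E : PVM 𝓗)

theorem proj_union {A B : Set ℝ} (hA : MeasurableSet A) (hB : MeasurableSet B)
    (hd : Disjoint A B) : E.proj (A ∪ B) = E.proj A + E.proj B := by
  ext φ
  have hm : ∀ n : ℕ, MeasurableSet (if n = 0 then A else if n = 1 then B else (∅ : Set ℝ)) := by
    intro n; split_ifs <;> simp [hA, hB]
  have h := E.hasSum_iUnion (fun n => if n = 0 then A else if n = 1 then B else ∅) hm (by
    intro m n hmn
    split_ifs <;> simp_all [hd.symm]) φ
  have hU : (⋃ n : ℕ, if n = 0 then A else if n = 1 then B else (∅ : Set ℝ)) = A ∪ B := by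
    ext x
    simp only [mem_iUnion, mem_union]
    constructor
    · rintro ⟨n, hn⟩
      split_ifs at hn <;> simp_all
    · rintro (hx | hx)
      · exact ⟨0, by simpa using hx⟩
      · exact ⟨1, by simpa using hx⟩
  rw [hU] at h
  have h2 := hasSum_sum_of_ne_finset_zero (L := .unconditional ℕ)
    (f := fun n : ℕ => E.proj (if n = 0 then A else if n = 1 then B else ∅) φ)
    (s := Finset.range 2) (by
      intro n hn
      have h0 : n ≠ 0 := by rintro rfl; simp at hn
      have h1 : n ≠ 1 := by rintro rfl; simp at hn
      simp [h0, h1, E.proj_empty])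
  rw [h.unique h2]
  simp [Finset.sum_range_succ]

/-- The operator `∫ s dE` for a simple function `s`. -/
noncomputable def simpleOp (s : SimpleFunc ℝ ℂ) : 𝓗 →L[ℂ] 𝓗 :=
  ∑ c ∈ s.range, c • E.proj (s ⁻¹' {c})

theorem simpleOp_apply (s : SimpleFunc ℝ ℂ) (φ : 𝓗) : E.simpleOp s φ = E.simpleIntegral s φ := by
  simp [simpleOp, simpleIntegral]

/-- The map `B ↦ (c ↦ c • E(B))`. -/
noncomputable def projSMul (B : Set ℝ) : ℂ →L[ℝ] (𝓗 →L[ℂ] 𝓗) :=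
  ((1 : ℂ →L[ℂ] ℂ).smulRight (E.proj B)).restrictScalars ℝ

/-- The zero measure is a placeholder that makes all finiteness conditions trivial, so that the
general theory of additive set functions gives linearity of the integral of simple functions. -/
theorem finMeasAdditive_projSMul : FinMeasAdditive (0 : Measure ℝ) E.projSMul := by
  intro A B hA hB _ _ hd
  ext c φ
  simp [projSMul, E.proj_union hA hB hd]

theorem simpleOp_eq (s : SimpleFunc ℝ ℂ) :
    E.simpleOp s = SimpleFunc.setToSimpleFunc E.projSMul s := by
  simp [simpleOp, SimpleFunc.setToSimpleFunc, projSMul]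

theorem simpleOp_add (s t : SimpleFunc ℝ ℂ) : E.simpleOp (s + t) = E.simpleOp s + E.simpleOp t := by
  simp only [simpleOp_eq]
  exact SimpleFunc.setToSimpleFunc_add _ E.finMeasAdditive_projSMul (by simp) (by simp)

theorem simpleOp_smul (c : ℂ) (s : SimpleFunc ℝ ℂ) : E.simpleOp (c • s) = c • E.simpleOp s := by
  simp only [simpleOp_eq]
  exact SimpleFunc.setToSimpleFunc_smul _ E.finMeasAdditive_projSMul
    (by intro c s x; ext; simp [projSMul, mul_smul]) c (by simp)

theorem simpleOp_mul (s t : SimpleFunc ℝ ℂ) : E.simpleOp (s * t) = E.simpleOp s * E.simpleOp t := by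
  have h1 : E.simpleOp (s * t) = ∑ p ∈ (s.pair t).range,
      (p.1 * p.2) • E.proj ((s.pair t) ⁻¹' {p}) := by
    rw [SimpleFunc.mul_eq_map₂, simpleOp_eq,
      SimpleFunc.map_setToSimpleFunc _ E.finMeasAdditive_projSMul (by simp) (by simp)]
    simp [projSMul]
  -- Pairs of values that are not attained jointly have an empty common fibre and add nothing, so
  -- the sum may run over the full product of the ranges.
  have h2 : ∑ p ∈ (s.pair t).range, (p.1 * p.2) • E.proj ((s.pair t) ⁻¹' {p}) =
      ∑ p ∈ s.range ×ˢ t.range, (p.1 * p.2) • E.proj ((s.pair t) ⁻¹' {p}) := by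
    refine Finset.sum_subset ?_ ?_
    · intro p hp
      obtain ⟨x, rfl⟩ := SimpleFunc.mem_range.1 hp
      exact Finset.mem_product.2 ⟨SimpleFunc.mem_range_self _ _, SimpleFunc.mem_range_self _ _⟩
    · intro p _ hp
      rw [(SimpleFunc.preimage_eq_empty_iff _ _).2 hp, E.proj_empty, smul_zero]
  rw [h1, h2, Finset.sum_product, simpleOp, simpleOp, Finset.sum_mul_sum]
  refine Finset.sum_congr rfl fun c _ => Finset.sum_congr rfl fun d _ => ?_
  have : (s.pair t) ⁻¹' {(c, d)} = s ⁻¹' {c} ∩ t ⁻¹' {d} := SimpleFunc.pair_preimage_singleton _ _ _ _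
  rw [this, E.proj_inter _ _ (s.measurableSet_fiber c) (t.measurableSet_fiber d)]
  simp [smul_smul, mul_comm]

theorem simpleOp_indicator {B : Set ℝ} (hB : MeasurableSet B) (c : ℂ) :
    E.simpleOp ((SimpleFunc.const ℝ c).restrict B) = c • E.proj B := by
  classical
  by_cases hc : c = 0
  · subst hc
    have : (SimpleFunc.const ℝ (0 : ℂ)).restrict B = (0 : ℂ) • 0 := by
      ext x; simp [SimpleFunc.restrict_apply _ hB]
    rw [this, simpleOp_smul]; simp
  have hsub : ((SimpleFunc.const ℝ c).restrict B).range ⊆ {c, 0} := by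
    intro d hd
    obtain ⟨x, rfl⟩ := SimpleFunc.mem_range.1 hd
    by_cases hx : x ∈ B <;> simp [SimpleFunc.restrict_apply _ hB, hx]
  rw [simpleOp, Finset.sum_subset hsub]
  · rw [Finset.sum_pair hc]
    have : ((SimpleFunc.const ℝ c).restrict B) ⁻¹' {c} = B := by
      ext x
      by_cases hx : x ∈ B
      · simp [SimpleFunc.restrict_apply _ hB, hx]
      · simp [SimpleFunc.restrict_apply _ hB, hx, Ne.symm hc]
    simp [this]
  · intro d _ hd
    rw [(SimpleFunc.preimage_eq_empty_iff _ _).2 hd, E.proj_empty, smul_zero]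

theorem simpleOp_one : E.simpleOp 1 = 1 := by
  have : (1 : SimpleFunc ℝ ℂ) = (SimpleFunc.const ℝ (1 : ℂ)).restrict univ := by
    ext x; simp
  rw [this, E.simpleOp_indicator MeasurableSet.univ, E.proj_univ, one_smul]

theorem inner_proj_left {B : Set ℝ} (hB : MeasurableSet B) (φ ψ : 𝓗) :
    inner ℂ (E.proj B ψ) φ = inner ℂ ψ (E.proj B φ) :=
  (E.isStarProjection B hB).isSelfAdjoint.isSymmetric ψ φ

theorem proj_proj {A B : Set ℝ} (hA : MeasurableSet A) (hB : MeasurableSet B) (φ : 𝓗) :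
    E.proj A (E.proj B φ) = E.proj (A ∩ B) φ := by
  rw [E.proj_inter A B hA hB]; rfl

theorem inner_simpleOp (s : SimpleFunc ℝ ℂ) (φ ψ : 𝓗) :
    inner ℂ ψ (E.simpleOp s φ) = inner ℂ (E.simpleOp (s.map (starRingEnd ℂ)) ψ) φ := by
  rw [simpleOp_eq, simpleOp_eq,
    SimpleFunc.map_setToSimpleFunc _ E.finMeasAdditive_projSMul (by simp) (by simp),
    SimpleFunc.setToSimpleFunc]
  simp only [projSMul, sum_apply, inner_sum, sum_inner]
  refine Finset.sum_congr rfl fun c _ => ?_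
  simp [inner_smul_left, inner_smul_right, E.inner_proj_left (s.measurableSet_fiber c)]

/-- Pythagoras: distinct fibres are disjoint, so their spectral projections have orthogonal ranges
and the cross terms vanish. -/
theorem enorm_simpleOp (s : SimpleFunc ℝ ℂ) (φ : 𝓗) :
    ‖E.simpleOp s φ‖ₑ ^ 2 = ∫⁻ x, ‖s x‖ₑ ^ 2 ∂(E.scalarMeasure φ) := by
  have h1 : ∫⁻ x, ‖s x‖ₑ ^ 2 ∂(E.scalarMeasure φ) =
      ∑ c ∈ s.range, ‖c‖ₑ ^ 2 * E.scalarMeasure φ (s ⁻¹' {c}) := by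
    rw [← SimpleFunc.map_lintegral, ← SimpleFunc.lintegral_eq_lintegral]
    rfl
  have h2 : ‖E.simpleOp s φ‖ ^ 2 = ∑ c ∈ s.range, ‖c‖ ^ 2 * ‖E.proj (s ⁻¹' {c}) φ‖ ^ 2 := by
    have e : ((‖E.simpleOp s φ‖ ^ 2 : ℝ) : ℂ) =
        inner ℂ (E.simpleOp s φ) (E.simpleOp s φ) := by
      rw [inner_self_eq_norm_sq_to_K]; push_cast; rfl
    have : ((‖E.simpleOp s φ‖ ^ 2 : ℝ) : ℂ) =
        ((∑ c ∈ s.range, ‖c‖ ^ 2 * ‖E.proj (s ⁻¹' {c}) φ‖ ^ 2 : ℝ) : ℂ) := by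
      rw [e]
      simp only [simpleOp, sum_apply, inner_sum, sum_inner, smul_apply,
        inner_smul_left, inner_smul_right]
      push_cast
      refine Finset.sum_congr rfl fun c hc => ?_
      rw [Finset.sum_eq_single c]
      · rw [inner_self_eq_norm_sq_to_K, ← mul_assoc, RCLike.mul_conj]; rfl
      · intro d _ hdc
        rw [E.inner_proj_left (s.measurableSet_fiber _),
          E.proj_proj (s.measurableSet_fiber _) (s.measurableSet_fiber _)]
        have : s ⁻¹' {d} ∩ s ⁻¹' {c} = ∅ := by
          ext x; simp only [mem_inter_iff, mem_preimage, mem_singleton_iff, mem_empty_iff_false,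
            iff_false]
          rintro ⟨h, h'⟩; exact hdc (h.symm.trans h')
        simp [this, E.proj_empty]
      · intro h; exact absurd hc h
    exact_mod_cast this
  rw [h1, ← ofReal_norm, ← ENNReal.ofReal_pow (norm_nonneg _), h2,
    ENNReal.ofReal_sum_of_nonneg (fun _ _ => by positivity)]
  refine Finset.sum_congr rfl fun c _ => ?_
  rw [E.scalarMeasure_apply φ (s.measurableSet_fiber c), ENNReal.ofReal_mul (by positivity),
    ← ofReal_norm, ENNReal.ofReal_pow (norm_nonneg _)]

instance isFiniteMeasure_scalarMeasure (φ : 𝓗) : IsFiniteMeasure (E.scalarMeasure φ) :=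
  ⟨by rw [E.scalarMeasure_apply φ MeasurableSet.univ]; exact ENNReal.ofReal_lt_top⟩

/-- The calculus of simple functions of a projection-valued measure. -/
noncomputable def calculus : SpectralCalculus 𝓗 ℝ (SimpleFunc ℝ ℂ) where
  val := AlgHom.ofLinearMap
    { toFun := fun s => s
      map_add' := fun _ _ => rfl
      map_smul' := fun _ _ => rfl } rfl (fun _ _ => rfl)
  op := AlgHom.ofLinearMap
    { toFun := E.simpleOp
      map_add' := E.simpleOp_add
      map_smul' := E.simpleOp_smul } E.simpleOp_one E.simpleOp_mul
  conj s := s.map (starRingEnd ℂ)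
  val_conj _ _ := rfl
  inner_op := E.inner_simpleOp
  meas := E.scalarMeasure
  isFiniteMeasure := E.isFiniteMeasure_scalarMeasure
  measurable s := s.measurable
  bounded s := by
    obtain ⟨C, hC⟩ := s.exists_forall_norm_le
    exact ⟨C, hC⟩
  eLpNorm_val s φ := by
    have h := E.enorm_simpleOp s φ
    rw [← eLpNorm_two_sq] at h
    exact ((ENNReal.pow_right_strictMono two_ne_zero).injective h).symm
  exists_approx ν _ f hf ε hε := by
    obtain ⟨g, hg, _⟩ := hf.exists_simpleFunc_eLpNorm_sub_lt (by norm_num) hε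
    exact ⟨g, hg.le⟩

variable {E} {f g : ℝ → ℂ} {φ ψ u v w : 𝓗}

theorem hasIntegral_iff : E.HasIntegral f φ u ↔ E.calculus.Has f φ u := by
  have : ∀ s : SimpleFunc ℝ ℂ, E.calculus.op s φ = E.simpleIntegral s φ :=
    fun s => E.simpleOp_apply s φ
  simp only [HasIntegral, SpectralCalculus.Has, this]
  rfl

theorem hasIntegral_integral (hf : MemLp f 2 (E.scalarMeasure φ)) :
    E.HasIntegral f φ (E.integral f φ) := by
  have : ∃ u, E.HasIntegral f φ u := by
    simp only [hasIntegral_iff]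
    exact SpectralCalculus.exists_has (F := E.calculus) hf
  exact Classical.epsilon_spec this

namespace HasIntegral

theorem unique (h : E.HasIntegral f φ u) (h' : E.HasIntegral f φ v) : u = v :=
  (hasIntegral_iff.1 h).unique (hasIntegral_iff.1 h')

theorem integral_eq (h : E.HasIntegral f φ u) : E.integral f φ = u :=
  (hasIntegral_integral h.1).unique h

theorem add (h : E.HasIntegral f φ u) (h' : E.HasIntegral g φ v) :
    E.HasIntegral (f + g) φ (u + v) :=
  hasIntegral_iff.2 ((hasIntegral_iff.1 h).add (hasIntegral_iff.1 h'))

theorem sub (h : E.HasIntegral f φ u) (h' : E.HasIntegral g φ v) :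
    E.HasIntegral (f - g) φ (u - v) :=
  hasIntegral_iff.2 ((hasIntegral_iff.1 h).sub (hasIntegral_iff.1 h'))

theorem const_smul (h : E.HasIntegral f φ u) (c : ℂ) : E.HasIntegral (c • f) φ (c • u) :=
  hasIntegral_iff.2 ((hasIntegral_iff.1 h).const_smul c)

theorem congr (h : E.HasIntegral f φ u) (hfg : f =ᵐ[E.scalarMeasure φ] g) :
    E.HasIntegral g φ u :=
  hasIntegral_iff.2 ((hasIntegral_iff.1 h).congr hfg)

theorem enorm_eq (h : E.HasIntegral f φ u) : ‖u‖ₑ = eLpNorm f 2 (E.scalarMeasure φ) :=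
  (hasIntegral_iff.1 h).enorm_eq

theorem enorm_sq (h : E.HasIntegral f φ u) :
    ‖u‖ₑ ^ 2 = ∫⁻ x, ‖f x‖ₑ ^ 2 ∂(E.scalarMeasure φ) := by
  rw [h.enorm_eq, eLpNorm_two_sq]

theorem inner_eq (h : E.HasIntegral f φ u)
    (h' : E.HasIntegral (fun x => starRingEnd ℂ (f x)) ψ v) : inner ℂ ψ u = inner ℂ v φ :=
  (hasIntegral_iff.1 h).inner_eq (hasIntegral_iff.1 h')

theorem of_simpleFunc (s : SimpleFunc ℝ ℂ) (φ : 𝓗) : E.HasIntegral s φ (E.simpleOp s φ) :=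
  hasIntegral_iff.2 (SpectralCalculus.has_val (F := E.calculus) s φ)

theorem simpleFunc_mul (h : E.HasIntegral f φ u) (s : SimpleFunc ℝ ℂ) :
    E.HasIntegral (fun x => s x * f x) φ (E.simpleOp s u) :=
  hasIntegral_iff.2 ((hasIntegral_iff.1 h).op s)

theorem indicator_one {B : Set ℝ} (hB : MeasurableSet B) (φ : 𝓗) :
    E.HasIntegral (B.indicator fun _ => 1) φ (E.proj B φ) := by
  have h := of_simpleFunc (E := E) ((SimpleFunc.const ℝ (1 : ℂ)).restrict B) φ
  rw [E.simpleOp_indicator hB, one_smul, SimpleFunc.coe_restrict _ hB] at h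
  exact h

theorem indicator (h : E.HasIntegral f φ u) {B : Set ℝ} (hB : MeasurableSet B) :
    E.HasIntegral (B.indicator f) φ (E.proj B u) := by
  have h := h.simpleFunc_mul ((SimpleFunc.const ℝ (1 : ℂ)).restrict B)
  rw [E.simpleOp_indicator hB, one_smul, SimpleFunc.coe_restrict _ hB] at h
  convert h using 1
  ext x
  by_cases hx : x ∈ B <;> simp [hx]

theorem one (φ : 𝓗) : E.HasIntegral (fun _ => 1) φ φ := by
  have := indicator_one (E := E) MeasurableSet.univ φ
  simpa [E.proj_univ] using this

theorem const (c : ℂ) (φ : 𝓗) : E.HasIntegral (fun _ => c) φ (c • φ) := by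
  convert (one (E := E) φ).const_smul c using 1
  ext x; simp

theorem scalarMeasure_eq (h : E.HasIntegral f φ u) :
    E.scalarMeasure u = (E.scalarMeasure φ).withDensity (fun x => ‖f x‖ₑ ^ 2) := by
  ext B hB
  rw [withDensity_apply _ hB, E.scalarMeasure_apply _ hB, ENNReal.ofReal_pow (norm_nonneg _),
    ofReal_norm, (h.indicator hB).enorm_sq, ← lintegral_indicator hB]
  refine lintegral_congr fun x => ?_
  by_cases hx : x ∈ B <;> simp [hx]

theorem eLpNorm_mul (h : E.HasIntegral f φ u) (hg : AEStronglyMeasurable g (E.scalarMeasure u)) :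
    eLpNorm g 2 (E.scalarMeasure u) = eLpNorm (fun x => g x * f x) 2 (E.scalarMeasure φ) := by
  refine (ENNReal.pow_right_strictMono two_ne_zero).injective ?_
  simp only [eLpNorm_two_sq]
  rw [h.scalarMeasure_eq] at hg ⊢
  rw [lintegral_withDensity_eq_lintegral_mul₀' (h.1.1.enorm.pow_const 2) (hg.enorm.pow_const 2)]
  refine lintegral_congr fun x => ?_
  simp [enorm_mul, mul_pow, mul_comm]

/-- Composition for possibly unbounded functions. As μ_u has density |f|² with respect to μ_φ,
convergence s_n → g in L²(μ_u) is the same as s_n f → g f in L²(μ_φ). -/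
theorem comp (h : E.HasIntegral f φ u) (h' : E.HasIntegral g u w)
    (hg : AEStronglyMeasurable g (E.scalarMeasure φ)) :
    E.HasIntegral (fun x => g x * f x) φ w := by
  have hm : MemLp (fun x => g x * f x) 2 (E.scalarMeasure φ) :=
    ⟨hg.mul h.1.1, by rw [← h.eLpNorm_mul h'.1.1]; exact h'.1.2⟩
  obtain ⟨z, hz⟩ : ∃ z, E.HasIntegral (fun x => g x * f x) φ z := ⟨_, hasIntegral_integral hm⟩
  obtain ⟨hgu, s, hs, hs'⟩ := h'
  have : Tendsto (fun n => E.simpleOp (s n) u) atTop (𝓝 z) := by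
    refine SpectralCalculus.tendsto_of_has (F := E.calculus) (hasIntegral_iff.1 hz)
      (fun n => hasIntegral_iff.1 (h.simpleFunc_mul (s n))) ?_
    refine hs.congr fun n => ?_
    have e := h.eLpNorm_mul (g := fun x => g x - s n x)
      (hgu.1.sub (s n).measurable.aestronglyMeasurable)
    refine e.trans ?_
    refine eLpNorm_congr_norm_ae (ae_of_all _ fun x => ?_)
    rw [← norm_neg]; congr 1; ring
  simp_rw [E.simpleOp_apply] at this
  rwa [tendsto_nhds_unique hs' this]

/-- The domain half of the product rule: square integrability of g f for φ already places u in the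
domain of the integral of g. -/
theorem comp_of_mul (h : E.HasIntegral f φ u) (h' : E.HasIntegral (fun x => g x * f x) φ w)
    (hg : AEStronglyMeasurable g (E.scalarMeasure φ)) : E.HasIntegral g u w := by
  have hac : E.scalarMeasure u ≪ E.scalarMeasure φ := by
    rw [h.scalarMeasure_eq]; exact withDensity_absolutelyContinuous _ _
  have hg' := hg.mono_ac hac
  have : MemLp g 2 (E.scalarMeasure u) := ⟨hg', by rw [h.eLpNorm_mul hg']; exact h'.1.2⟩
  have h2 := hasIntegral_integral this
  rwa [(h.comp h2 hg).unique h'] at h2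

end HasIntegral

theorem tendsto_of_hasIntegral {ι : Type*} {l : Filter ι} {k : ι → ℝ → ℂ} {y : ι → 𝓗}
    (h : E.HasIntegral f φ u) (hk : ∀ i, E.HasIntegral (k i) φ (y i))
    (hl : Tendsto (fun i => eLpNorm (fun x => k i x - f x) 2 (E.scalarMeasure φ)) l (𝓝 0)) :
    Tendsto y l (𝓝 u) :=
  SpectralCalculus.tendsto_of_has (F := E.calculus) (hasIntegral_iff.1 h)
    (fun i => hasIntegral_iff.1 (hk i)) hl

variable (E)

theorem scalarMeasure_add_le (φ ψ : 𝓗) :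
    E.scalarMeasure (φ + ψ) ≤ (2 : ℝ≥0∞) • (E.scalarMeasure φ + E.scalarMeasure ψ) := by
  refine Measure.le_iff.2 fun B hB => ?_
  simp only [Measure.smul_apply, Measure.add_apply, E.scalarMeasure_apply _ hB, smul_eq_mul]
  rw [← ENNReal.ofReal_add (by positivity) (by positivity),
    show (2 : ℝ≥0∞) = ENNReal.ofReal 2 by simp, ← ENNReal.ofReal_mul (by norm_num)]
  refine ENNReal.ofReal_le_ofReal ?_
  rw [map_add]
  nlinarith [norm_add_le (E.proj B φ) (E.proj B ψ), sq_nonneg (‖E.proj B φ‖ - ‖E.proj B ψ‖),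
    norm_nonneg (E.proj B φ + E.proj B ψ), norm_nonneg (E.proj B φ), norm_nonneg (E.proj B ψ)]

theorem scalarMeasure_smul (c : ℂ) (φ : 𝓗) :
    E.scalarMeasure (c • φ) = (‖c‖ₑ ^ 2) • E.scalarMeasure φ := by
  ext B hB
  simp only [Measure.smul_apply, E.scalarMeasure_apply _ hB, smul_eq_mul, map_smul, norm_smul,
    mul_pow]
  rw [ENNReal.ofReal_mul (by positivity), ENNReal.ofReal_pow (norm_nonneg c), ofReal_norm]

variable {E}

theorem memLp_add_vec (h : MemLp f 2 (E.scalarMeasure φ)) (h' : MemLp f 2 (E.scalarMeasure ψ)) :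
    MemLp f 2 (E.scalarMeasure (φ + ψ)) :=
  ((memLp_two_add_measure h h').smul_measure (by norm_num)).mono_measure
    (E.scalarMeasure_add_le φ ψ)

theorem memLp_smul_vec (h : MemLp f 2 (E.scalarMeasure φ)) (c : ℂ) :
    MemLp f 2 (E.scalarMeasure (c • φ)) := by
  rw [E.scalarMeasure_smul]
  exact h.smul_measure (by finiteness)

theorem HasIntegral.add_vec (h : E.HasIntegral f φ u) (h' : E.HasIntegral f ψ v) :
    E.HasIntegral f (φ + ψ) (u + v) :=
  hasIntegral_iff.2 ((hasIntegral_iff.1 h).add_vec (hasIntegral_iff.1 h')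
    (memLp_add_vec h.1 h'.1))

theorem HasIntegral.smul_vec (h : E.HasIntegral f φ u) (c : ℂ) :
    E.HasIntegral f (c • φ) (c • u) :=
  hasIntegral_iff.2 ((hasIntegral_iff.1 h).smul_vec c (memLp_smul_vec h.1 c))

theorem scalarMeasure_univ (φ : 𝓗) : E.scalarMeasure φ univ = ‖φ‖ₑ ^ 2 := by
  rw [E.scalarMeasure_apply _ MeasurableSet.univ, E.proj_univ, ENNReal.ofReal_pow (norm_nonneg _),
    ofReal_norm]
  rfl

theorem scalarMeasure_apply' (φ : 𝓗) {B : Set ℝ} (hB : MeasurableSet B) :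
    E.scalarMeasure φ B = ‖E.proj B φ‖ₑ ^ 2 := by
  rw [E.scalarMeasure_apply _ hB, ENNReal.ofReal_pow (norm_nonneg _), ofReal_norm]

theorem HasIntegral.enorm_le (h : E.HasIntegral f φ u) {C : ℝ} (hC : ∀ x, ‖f x‖ ≤ C) :
    ‖u‖ ≤ C * ‖φ‖ := by
  have hC0 : 0 ≤ C := (norm_nonneg _).trans (hC 0)
  have h1 : ‖u‖ₑ ^ 2 ≤ ENNReal.ofReal C ^ 2 * ‖φ‖ₑ ^ 2 := by
    rw [h.enorm_sq, ← scalarMeasure_univ (E := E), ← lintegral_const]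
    refine lintegral_mono fun x => ?_
    rw [← ofReal_norm]
    gcongr
    exact hC x
  rw [← mul_pow] at h1
  have h2 := (ENNReal.pow_le_pow_left_iff two_ne_zero).1 h1
  rw [← ofReal_norm, ← ofReal_norm, ← ENNReal.ofReal_mul hC0] at h2
  exact (ENNReal.ofReal_le_ofReal_iff (by positivity)).1 h2

theorem memLp_of_bound (hf : Measurable f) {C : ℝ} (hC : ∀ x, ‖f x‖ ≤ C) (φ : 𝓗) :
    MemLp f 2 (E.scalarMeasure φ) :=
  MemLp.of_bound hf.aestronglyMeasurable C (ae_of_all _ hC)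

/-- The bounded operator `∫ f dE` of a bounded measurable function `f`. -/
noncomputable def boundedOp (E : PVM 𝓗) (f : ℝ → ℂ) (hf : Measurable f) (C : ℝ)
    (hC : ∀ x, ‖f x‖ ≤ C) : 𝓗 →L[ℂ] 𝓗 :=
  LinearMap.mkContinuous
    { toFun := E.integral f
      map_add' := fun φ ψ => ((hasIntegral_integral (memLp_of_bound hf hC φ)).add_vec
        (hasIntegral_integral (memLp_of_bound hf hC ψ))).integral_eq
      map_smul' := fun c φ => ((hasIntegral_integral (memLp_of_bound hf hC φ)).smul_vec
        c).integral_eq } C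
    fun φ => (hasIntegral_integral (memLp_of_bound hf hC φ)).enorm_le hC

theorem hasIntegral_boundedOp (E : PVM 𝓗) {f : ℝ → ℂ} (hf : Measurable f) {C : ℝ}
    (hC : ∀ x, ‖f x‖ ≤ C) (φ : 𝓗) : E.HasIntegral f φ (E.boundedOp f hf C hC φ) :=
  hasIntegral_integral (memLp_of_bound hf hC φ)

theorem inner_hasIntegral (h : E.HasIntegral f φ u) :
    inner ℂ φ u = ∫ x, f x ∂(E.scalarMeasure φ) := by
  obtain ⟨hf, s, hs, hs'⟩ := h
  have e1 : ∀ t : SimpleFunc ℝ ℂ, inner ℂ φ (E.simpleIntegral t φ) =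
      ∫ x, t x ∂(E.scalarMeasure φ) := by
    intro t
    rw [← SimpleFunc.integral_eq_integral _ ((SpectralCalculus.memLp_val (F := E.calculus) t
      (E.scalarMeasure φ)).integrable (by norm_num)), SimpleFunc.integral_eq, simpleIntegral,
      inner_sum]
    refine Finset.sum_congr rfl fun c _ => ?_
    rw [inner_smul_right, E.inner_proj (t.measurableSet_fiber c), Measure.real,
      E.scalarMeasure_apply _ (t.measurableSet_fiber c), ENNReal.toReal_ofReal (by positivity)]
    simp [mul_comm]
  have e2 : Tendsto (fun n => ∫ x, s n x ∂(E.scalarMeasure φ)) atTop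
      (𝓝 (∫ x, f x ∂(E.scalarMeasure φ))) := by
    have hi : Integrable f (E.scalarMeasure φ) := hf.integrable (by norm_num)
    refine tendsto_integral_of_L1 f hi.1
      (Eventually.of_forall fun n => (SpectralCalculus.memLp_val (F := E.calculus) (s n)
        (E.scalarMeasure φ)).integrable (by norm_num)) ?_
    -- On a finite measure space L² convergence implies L¹ convergence, which is what convergence of
    -- the integrals needs.
    have h1 : ∀ n, ∫⁻ x, ‖s n x - f x‖ₑ ∂(E.scalarMeasure φ) ≤
        eLpNorm (fun x => f x - s n x) 2 (E.scalarMeasure φ) *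
          (E.scalarMeasure φ univ) ^ (1 / 1 - 1 / (2 : ℝ)) := by
      intro n
      have := eLpNorm_le_eLpNorm_mul_rpow_measure_univ (μ := E.scalarMeasure φ)
        (f := fun x => f x - s n x) (p := 1) (q := 2) (by norm_num)
        (hf.1.sub (s n).measurable.aestronglyMeasurable)
      rw [eLpNorm_one_eq_lintegral_enorm] at this
      simp only [ENNReal.toReal_one, ENNReal.toReal_ofNat] at this
      refine le_trans (le_of_eq (lintegral_congr fun x => ?_)) this
      rw [← enorm_neg, neg_sub]
    refine tendsto_of_tendsto_of_tendsto_of_le_of_le tendsto_const_nhds ?_ (fun _ => zero_le) h1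
    have := ENNReal.Tendsto.mul_const (b := (E.scalarMeasure φ univ) ^ (1 / 1 - 1 / (2 : ℝ))) hs
      (Or.inr (ENNReal.rpow_ne_top_of_nonneg (by norm_num) (measure_ne_top _ _)))
    simpa using this
  have e3 : Tendsto (fun n => inner ℂ φ (E.simpleIntegral (s n) φ)) atTop (𝓝 (inner ℂ φ u)) :=
    tendsto_const_nhds.inner hs'
  simp_rw [e1] at e3
  exact tendsto_nhds_unique e3 e2

end PVM

/-! ### Closed symmetric graphs -/

section
variable {𝓗 : Type*} [NormedAddCommGroup 𝓗] [InnerProductSpace ℂ 𝓗]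

/-- A linear subspace of `𝓗 × 𝓗` that is symmetric as a relation. -/
def IsSymmGraph (G : Submodule ℂ (𝓗 × 𝓗)) : Prop :=
  ∀ p ∈ G, ∀ q ∈ G, inner ℂ p.2 q.1 = inner ℂ p.1 q.2

variable {G : Submodule ℂ (𝓗 × 𝓗)} {z : ℂ}

theorem IsSymmGraph.topologicalClosure (hG : IsSymmGraph G) :
    IsSymmGraph G.topologicalClosure := by
  have h1 : ∀ q ∈ G, ∀ p ∈ closure (G : Set (𝓗 × 𝓗)), inner ℂ p.2 q.1 = inner ℂ p.1 q.2 := by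
    intro q hq p hp
    have hc : IsClosed {p : 𝓗 × 𝓗 | inner ℂ p.2 q.1 = inner ℂ p.1 q.2} :=
      isClosed_eq (by fun_prop) (by fun_prop)
    exact closure_minimal (fun p hp => hG p hp q hq) hc hp
  intro p hp q hq
  have hc : IsClosed {q : 𝓗 × 𝓗 | inner ℂ p.2 q.1 = inner ℂ p.1 q.2} :=
    isClosed_eq (by fun_prop) (by fun_prop)
  exact closure_minimal (fun q hq => h1 q hq p hp) hc hq

/-- Symmetry makes the inner product of u with f + zu real, so the imaginary part of the inner
product of u with f is -Im z ‖u‖²; Cauchy–Schwarz finishes. -/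
theorem IsSymmGraph.norm_le (hG : IsSymmGraph G) {u f : 𝓗} (h : (u, f + z • u) ∈ G) :
    |z.im| * ‖u‖ ≤ ‖f‖ := by
  have h1 := hG _ h _ h
  simp only [inner_add_left, inner_add_right, inner_smul_left, inner_smul_right] at h1
  have h2 : inner ℂ f u = starRingEnd ℂ (inner ℂ u f) := (inner_conj_symm f u).symm
  have h3 : (inner ℂ u u : ℂ) = ((‖u‖ ^ 2 : ℝ) : ℂ) := by
    rw [inner_self_eq_norm_sq_to_K]; push_cast; rfl
  rw [h2, h3] at h1
  have h4 := congrArg Complex.im h1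
  simp only [Complex.add_im, Complex.conj_im, Complex.mul_im, Complex.conj_re, Complex.ofReal_im,
    Complex.ofReal_re, mul_zero, zero_add] at h4
  have h5 : |(inner ℂ u f).im| ≤ ‖u‖ * ‖f‖ :=
    (Complex.abs_im_le_norm _).trans (norm_inner_le_norm u f)
  have h6 : (inner ℂ u f).im = - (z.im * ‖u‖ ^ 2) := by linarith
  rw [h6, abs_neg, abs_mul, abs_of_nonneg (sq_nonneg ‖u‖)] at h5
  rcases eq_or_lt_of_le (norm_nonneg u) with h0 | h0
  · rw [← h0]; simp
  · nlinarith

theorem IsSymmGraph.eq_zero (hG : IsSymmGraph G) (hz : z.im ≠ 0) {u : 𝓗} (h : (u, z • u) ∈ G) :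
    u = 0 := by
  have := hG.norm_le (f := 0) (z := z) (u := u) (by simpa using h)
  rw [norm_zero] at this
  have h1 : 0 < |z.im| := abs_pos.2 hz
  have h2 : ‖u‖ ≤ 0 := by
    by_contra hc
    push Not at hc
    nlinarith
  exact norm_le_zero_iff.1 h2

theorem IsSymmGraph.unique (hG : IsSymmGraph G) (hz : z.im ≠ 0) {u v f : 𝓗}
    (h : (u, f + z • u) ∈ G) (h' : (v, f + z • v) ∈ G) : u = v := by
  have := G.sub_mem h h'
  rw [← sub_eq_zero]
  refine hG.eq_zero hz ?_
  convert this using 1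
  ext
  · rfl
  · simp [smul_sub]

/-- The lower bound `norm_le` turns convergence of right-hand sides into convergence of solutions,
so for a closed graph the range is closed; being dense, it is everything. The same bound gives
uniqueness and continuity. -/
theorem IsSymmGraph.exists_resolvent [CompleteSpace 𝓗] (hG : IsSymmGraph G)
    (hc : IsClosed (G : Set (𝓗 × 𝓗))) (hz : z.im ≠ 0)
    (hd : Dense {f : 𝓗 | ∃ u, (u, f + z • u) ∈ G}) :
    ∃ R : 𝓗 →L[ℂ] 𝓗, ∀ f u : 𝓗, R f = u ↔ (u, f + z • u) ∈ G := by
  have hz' : 0 < |z.im| := abs_pos.2 hz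
  have hall : ∀ f : 𝓗, ∃ u, (u, f + z • u) ∈ G := by
    intro f
    obtain ⟨s, hs, hsf⟩ := mem_closure_iff_seq_limit.1 (hd f)
    choose u hu using hs
    have hcau : CauchySeq u := by
      rw [Metric.cauchySeq_iff']
      intro ε hε
      obtain ⟨N, hN⟩ := Metric.cauchySeq_iff'.1 hsf.cauchySeq (|z.im| * ε) (by positivity)
      refine ⟨N, fun n hn => ?_⟩
      have h1 : (u n - u N, (s n - s N) + z • (u n - u N)) ∈ G := by
        convert G.sub_mem (hu n) (hu N) using 1
        ext
        · rfl
        · simp [smul_sub]; abel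
      have h2 := hG.norm_le h1
      have h3 := hN n hn
      rw [dist_eq_norm] at h3 ⊢
      exact lt_of_mul_lt_mul_left (h2.trans_lt h3) hz'.le
    obtain ⟨w, hw⟩ := cauchySeq_tendsto_of_complete hcau
    refine ⟨w, ?_⟩
    have h4 : Tendsto (fun n => (u n, s n + z • u n)) atTop (𝓝 (w, f + z • w)) :=
      hw.prodMk_nhds (hsf.add (hw.const_smul z))
    exact hc.mem_of_tendsto h4 (Eventually.of_forall hu)
  choose r hr using hall
  have key : ∀ f u, (u, f + z • u) ∈ G → r f = u := fun f u h => hG.unique hz (hr f) h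
  refine ⟨LinearMap.mkContinuous
    { toFun := r
      map_add' := fun f g => key _ _ (by
        convert G.add_mem (hr f) (hr g) using 1
        ext
        · rfl
        · simp; abel)
      map_smul' := fun c f => key _ _ (by
        convert G.smul_mem c (hr f) using 1
        ext
        · rfl
        · simp [smul_smul, mul_comm]) } (|z.im|⁻¹) ?_, ?_⟩
  · intro f
    have := hG.norm_le (hr f)
    simp only [LinearMap.coe_mk, AddHom.coe_mk]
    rw [inv_mul_eq_div, le_div_iff₀ hz']
    linarith
  · intro f u
    simp only [LinearMap.mkContinuous_apply, LinearMap.coe_mk, AddHom.coe_mk]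
    exact ⟨fun h => h ▸ hr f, key f u⟩

/-- Symmetry makes any v with (0, v) in the graph orthogonal to the domain; density of the domain
then forces v = 0, so the relation is single-valued. -/
theorem IsSymmGraph.graph_toLinearPMap (hG : IsSymmGraph G)
    (hd : Dense {u : 𝓗 | ∃ v, (u, v) ∈ G}) : G.toLinearPMap.graph = G := by
  refine Submodule.toLinearPMap_graph_eq _ fun p hp h0 => ?_
  refine hd.eq_zero_of_inner_left ℂ fun u hu => ?_
  obtain ⟨v, hv⟩ := hu
  rw [hG p hp _ hv, h0, inner_zero_left]

theorem IsSymmGraph.isSelfAdjoint [CompleteSpace 𝓗] (hG : IsSymmGraph G)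
    (hc : IsClosed (G : Set (𝓗 × 𝓗))) (hd : Dense {u : 𝓗 | ∃ v, (u, v) ∈ G})
    (hr : ∀ z : ℂ, z.im ≠ 0 → Dense {f : 𝓗 | ∃ u, (u, f + z • u) ∈ G}) :
    IsSelfAdjoint G.toLinearPMap := by
  have hgr := hG.graph_toLinearPMap hd
  have hdom : Dense (G.toLinearPMap.domain : Set 𝓗) := by
    convert hd using 1
    ext u
    rw [SetLike.mem_coe, LinearPMap.mem_domain_iff, hgr]
    rfl
  rw [LinearPMap.isSelfAdjoint_def]
  refine LinearPMap.eq_of_eq_graph ?_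
  rw [LinearPMap.adjoint_graph_eq_graph_adjoint hdom, hgr]
  refine le_antisymm ?_ ?_
  · rintro ⟨x, y⟩ hxy
    rw [Submodule.mem_adjoint_iff] at hxy
    obtain ⟨R, hR⟩ := hG.exists_resolvent hc (z := Complex.I) (by simp) (hr _ (by simp))
    have hu := (hR (y - Complex.I • x) _).1 rfl
    set u := R (y - Complex.I • x)
    -- Given (x, y) in the adjoint graph, u solves the same equation at i inside G. The difference x
    -- - u is orthogonal to the range at -i, which is dense.
    have hxu : x - u = 0 := by
      refine (hr (-Complex.I) (by simp)).eq_zero_of_inner_right ℂ ?_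
      rintro f ⟨a, ha⟩
      have h1 := hxy _ _ ha
      have h2 := hG _ ha _ hu
      simp only [inner_add_left, inner_add_right, inner_sub_right, inner_smul_left,
        inner_smul_right, map_neg, Complex.conj_I] at h1 h2 ⊢
      linear_combination h1 - h2
    rw [sub_eq_zero] at hxu
    rw [← hxu] at hu
    simpa using hu
  · rintro p hp
    rw [Submodule.mem_adjoint_iff]
    intro a b hab
    rw [sub_eq_zero]
    exact hG _ hab _ hp

theorem IsSelfAdjoint.isSymmGraph [CompleteSpace 𝓗] {H : 𝓗 →ₗ.[ℂ] 𝓗} (hH : IsSelfAdjoint H) :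
    IsSymmGraph H.graph := by
  intro p hp q hq
  have h := LinearPMap.adjoint_graph_eq_graph_adjoint hH.dense_domain
  rw [LinearPMap.isSelfAdjoint_def.1 hH] at h
  rw [h, Submodule.mem_adjoint_iff] at hq
  exact sub_eq_zero.1 (hq _ _ hp)

theorem IsSelfAdjoint.exists_resolvent [CompleteSpace 𝓗] {H : 𝓗 →ₗ.[ℂ] 𝓗} (hH : IsSelfAdjoint H)
    {z : ℂ} (hz : z.im ≠ 0) :
    ∃ R : 𝓗 →L[ℂ] 𝓗, ∀ f u : 𝓗, R f = u ↔ (u, f + z • u) ∈ H.graph := by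
  refine hH.isSymmGraph.exists_resolvent hH.isClosed hz ?_
  let S : Submodule ℂ 𝓗 := LinearMap.range
    ((LinearMap.snd ℂ 𝓗 𝓗 - z • LinearMap.fst ℂ 𝓗 𝓗) ∘ₗ H.graph.subtype)
  have hS : {f : 𝓗 | ∃ u, (u, f + z • u) ∈ H.graph} = (S : Set 𝓗) := by
    ext f
    constructor
    · rintro ⟨u, hu⟩
      exact ⟨⟨_, hu⟩, by simp⟩
    · rintro ⟨⟨p, hp⟩, rfl⟩
      exact ⟨p.1, by simpa using hp⟩
  rw [hS, Submodule.dense_iff_topologicalClosure_eq_top, Submodule.topologicalClosure_eq_top_iff,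
    Submodule.eq_bot_iff]
  intro f hf
  rw [Submodule.mem_orthogonal] at hf
  -- A vector orthogonal to the range of H - z is an eigenvector of H* = H for the nonreal number
  -- z̄, hence zero.
  refine hH.isSymmGraph.eq_zero (z := starRingEnd ℂ z) (by simpa using hz) ?_
  have h := LinearPMap.adjoint_graph_eq_graph_adjoint hH.dense_domain
  rw [LinearPMap.isSelfAdjoint_def.1 hH] at h
  rw [h, Submodule.mem_adjoint_iff]
  intro a b hab
  have := hf (b - z • a) ⟨⟨(a, b), hab⟩, by simp⟩
  simpa [inner_sub_left, inner_smul_left, inner_smul_right] using this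

theorem resolventOp_eq_iff [CompleteSpace 𝓗] {H : 𝓗 →ₗ.[ℂ] 𝓗} (hH : IsSelfAdjoint H)
    {z : ℂ} (hz : z.im ≠ 0) (f u : 𝓗) :
    resolventOp H z f = u ↔ (u, f + z • u) ∈ H.graph :=
  Classical.epsilon_spec (hH.exists_resolvent hz) f u

end

/-! ### The projection-valued measure of a calculus -/

namespace SpectralCalculus

variable {𝓗 : Type*} [NormedAddCommGroup 𝓗] [InnerProductSpace ℂ 𝓗] [CompleteSpace 𝓗]
  {α : Type*} [MeasurableSpace α] {𝒜 : Type*} [Ring 𝒜] [Algebra ℂ 𝒜]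
  {F : SpectralCalculus 𝓗 α 𝒜}

omit [MeasurableSpace α] in
theorem norm_indicator_one_le (B : Set α) (x : α) : ‖B.indicator (fun _ => (1 : ℂ)) x‖ ≤ 1 := by
  by_cases hx : x ∈ B <;> simp [hx]

theorem memLp_indicator_one {B : Set α} (hB : MeasurableSet B) (ν : Measure α) [IsFiniteMeasure ν] :
    MemLp (B.indicator fun _ => (1 : ℂ)) 2 ν :=
  MemLp.of_bound (measurable_const.indicator hB).aestronglyMeasurable 1
    (ae_of_all _ (norm_indicator_one_le B))

omit [CompleteSpace 𝓗] in
theorem has_one (φ : 𝓗) : F.Has (fun _ => 1) φ φ := by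
  have := has_val (F := F) 1 φ
  rw [map_one, map_one] at this
  exact this

theorem exists_indicatorOp (F : SpectralCalculus 𝓗 α 𝒜) {B : Set α} (hB : MeasurableSet B) :
    ∃ P : 𝓗 →L[ℂ] 𝓗, ∀ φ, F.Has (B.indicator fun _ => 1) φ (P φ) := by
  have h : ∀ φ, ∃ u, F.Has (B.indicator fun _ => 1) φ u :=
    fun φ => exists_has (memLp_indicator_one hB _)
  choose P hP using h
  refine ⟨LinearMap.mkContinuous
    { toFun := P
      map_add' := fun φ ψ =>
        (hP (φ + ψ)).unique ((hP φ).add_vec (hP ψ) (memLp_indicator_one hB _))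
      map_smul' := fun c φ =>
        (hP (c • φ)).unique ((hP φ).smul_vec c (memLp_indicator_one hB _)) } 1 ?_, hP⟩
  intro φ
  rw [one_mul]
  have h1 : ‖P φ‖ₑ ≤ ‖φ‖ₑ := by
    rw [(hP φ).enorm_eq, (has_one (F := F) φ).enorm_eq]
    refine eLpNorm_mono fun x => ?_
    simpa using norm_indicator_one_le B x
  exact enorm_le_iff_norm_le.1 h1

omit [CompleteSpace 𝓗] in
theorem indicator_measure (F : SpectralCalculus 𝓗 α 𝒜) {B : Set α} (hB : MeasurableSet B)
    {φ u : 𝓗} (h : F.Has (B.indicator fun _ => 1) φ u) : ‖u‖ₑ ^ 2 = F.meas φ B := by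
  rw [h.enorm_eq, eLpNorm_two_sq, ← lintegral_indicator_one hB]
  refine lintegral_congr fun x => ?_
  by_cases hx : x ∈ B <;> simp [hx]

omit [CompleteSpace 𝓗] in
theorem has_finset_sum {ι : Type*} (s : Finset ι) {f : ι → α → ℂ} {u : ι → 𝓗} {φ : 𝓗}
    (h : ∀ i ∈ s, F.Has (f i) φ (u i)) : F.Has (∑ i ∈ s, f i) φ (∑ i ∈ s, u i) := by
  classical
  induction s using Finset.induction_on with
  | empty =>
    have := (has_one (F := F) φ).const_smul 0
    rw [zero_smul, zero_smul] at this
    simpa using this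
  | insert i s hi ih =>
    rw [Finset.sum_insert hi, Finset.sum_insert hi]
    exact (h i (Finset.mem_insert_self _ _)).add
      (ih fun k hk => h k (Finset.mem_insert_of_mem hk))

omit [CompleteSpace 𝓗] in
-- The squared L² distance between a partial sum of the indicators and the indicator of the union is
-- the measure of the remaining sets, the tail of a convergent series.
theorem hasSum_indicator {B : ℕ → Set α} (hB : ∀ n, MeasurableSet (B n))
    (hd : Pairwise fun m n => Disjoint (B m) (B n)) {φ v : 𝓗} {u : ℕ → 𝓗}
    (hu : ∀ n, F.Has ((B n).indicator fun _ => 1) φ (u n))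
    (hv : F.Has ((⋃ n, B n).indicator fun _ => 1) φ v) : HasSum u v := by
  have hs : ∀ s : Finset ℕ, F.Has (∑ n ∈ s, (B n).indicator fun _ => 1) φ (∑ n ∈ s, u n) :=
    fun s => has_finset_sum s fun n _ => hu n
  refine tendsto_of_has hv hs ?_
  have hval : ∀ (s : Finset ℕ) (x : α),
      ‖(∑ n ∈ s, (B n).indicator (fun _ => (1 : ℂ))) x - (⋃ n, B n).indicator (fun _ => 1) x‖ₑ ^ 2
        = (⋃ n : {n // n ∉ s}, B n).indicator 1 x := by
    intro s x
    have hx0 : ∀ n m, x ∈ B n → x ∈ B m → n = m := by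
      intro n m hn hm
      by_contra hne
      exact disjoint_left.1 (hd hne) hn hm
    rw [Finset.sum_apply]
    by_cases hx : ∃ n, x ∈ B n
    · obtain ⟨n, hn⟩ := hx
      have h1 : x ∈ ⋃ n, B n := mem_iUnion.2 ⟨n, hn⟩
      rw [indicator_of_mem h1]
      by_cases hns : n ∈ s
      · rw [Finset.sum_eq_single_of_mem n hns, indicator_of_mem hn, indicator_of_notMem]
        · simp
        · rw [mem_iUnion]
          rintro ⟨⟨m, hm⟩, hxm⟩
          exact hm (hx0 n m hn hxm ▸ hns)
        · intro m _ hmn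
          exact indicator_of_notMem (fun hm => hmn (hx0 m n hm hn)) _
      · rw [Finset.sum_eq_zero, indicator_of_mem]
        · simp
        · exact mem_iUnion.2 ⟨⟨n, hns⟩, hn⟩
        · intro m hm
          exact indicator_of_notMem (fun hxm => hns (hx0 m n hxm hn ▸ hm)) _
    · push Not at hx
      rw [indicator_of_notMem, indicator_of_notMem, Finset.sum_eq_zero]
      · simp
      · intro n _; exact indicator_of_notMem (hx n) _
      · rw [mem_iUnion]; rintro ⟨n, hn⟩; exact hx _ hn
      · rw [mem_iUnion]; rintro ⟨n, hn⟩; exact hx _ hn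
  have hsq : ∀ s : Finset ℕ, eLpNorm (fun x => (∑ n ∈ s, (B n).indicator (fun _ => (1 : ℂ))) x -
      (⋃ n, B n).indicator (fun _ => 1) x) 2 (F.meas φ) ≤
        (∑' n : {n // n ∉ s}, F.meas φ (B n)) ^ ((2 : ℝ)⁻¹) := by
    intro s
    rw [ENNReal.le_rpow_inv_iff (by norm_num), ENNReal.rpow_two, eLpNorm_two_sq,
      lintegral_congr (hval s),
      lintegral_indicator_one (MeasurableSet.iUnion fun n : {n // n ∉ s} => hB n)]
    exact measure_iUnion_le _
  have ht : Tendsto (fun s : Finset ℕ => ∑' n : {n // n ∉ s}, F.meas φ (B n)) atTop (𝓝 0) := by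
    refine ENNReal.tendsto_tsum_compl_atTop_zero (f := fun n => F.meas φ (B n)) ?_
    rw [← measure_iUnion (fun m n hmn => hd hmn) hB]
    exact measure_ne_top _ _
  have ht' := ((ENNReal.continuous_rpow_const (y := (2 : ℝ)⁻¹)).tendsto 0).comp ht
  rw [ENNReal.zero_rpow_of_pos (by norm_num)] at ht'
  exact tendsto_of_tendsto_of_tendsto_of_le_of_le tendsto_const_nhds ht' (fun _ => zero_le) hsq

open scoped Classical in
/-- The projection-valued measure given by a calculus and a real-valued measurable function. -/
noncomputable def toPVM (F : SpectralCalculus 𝓗 α 𝒜) (c : α → ℝ) (hc : Measurable c) : PVM 𝓗 where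
  proj B := if hB : MeasurableSet B then (F.exists_indicatorOp (hc hB)).choose else 0
  isStarProjection B hB := by
    rw [dif_pos hB]
    have hP := (F.exists_indicatorOp (hc hB)).choose_spec
    set P := (F.exists_indicatorOp (hc hB)).choose
    have hreal : ∀ x, starRingEnd ℂ ((c ⁻¹' B).indicator (fun _ => (1 : ℂ)) x) =
        (c ⁻¹' B).indicator (fun _ => 1) x := by
      intro x; by_cases hx : x ∈ c ⁻¹' B <;> simp [hx]
    refine ⟨?_, ?_⟩
    · ext φ
      have h1 := (hP φ).comp_of_bounded (hP (P φ)) (norm_indicator_one_le _)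
        (memLp_indicator_one (hc hB) _)
      refine h1.unique ?_
      convert hP φ using 1
      ext x; by_cases hx : x ∈ c ⁻¹' B <;> simp [hx]
    · rw [ContinuousLinearMap.isSelfAdjoint_iff_isSymmetric]
      intro φ ψ
      have h2 : F.Has (fun x => starRingEnd ℂ ((c ⁻¹' B).indicator (fun _ => (1 : ℂ)) x)) φ
          (P φ) := by
        simp_rw [hreal]; exact hP φ
      exact ((hP ψ).inner_eq h2).symm
  proj_univ := by
    rw [dif_pos MeasurableSet.univ]
    have hP := (F.exists_indicatorOp (hc MeasurableSet.univ)).choose_spec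
    ext φ
    refine (hP φ).unique ?_
    simpa using has_one (F := F) φ
  proj_inter A B hA hB := by
    rw [dif_pos hA, dif_pos hB, dif_pos (hA.inter hB)]
    have hPA := (F.exists_indicatorOp (hc hA)).choose_spec
    have hPB := (F.exists_indicatorOp (hc hB)).choose_spec
    have hPAB := (F.exists_indicatorOp (hc (hA.inter hB))).choose_spec
    ext φ
    refine (hPAB φ).unique ?_
    have h1 := (hPB φ).comp_of_bounded (hPA _) (norm_indicator_one_le _)
        (memLp_indicator_one (hc hA) _)
    refine h1.congr (Eventually.of_forall fun x => ?_)
    by_cases hx : x ∈ c ⁻¹' A <;> by_cases hx' : x ∈ c ⁻¹' B <;> simp_all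
  hasSum_iUnion B hB hd φ := by
    simp only [hB, MeasurableSet.iUnion hB, dif_pos]
    have hP := fun n => (F.exists_indicatorOp (hc (hB n))).choose_spec
    have hPU := (F.exists_indicatorOp (hc (MeasurableSet.iUnion hB))).choose_spec
    refine hasSum_indicator (F := F) (B := fun n => c ⁻¹' B n) (fun n => hc (hB n))
      (fun m n hmn => (hd hmn).preimage c) (fun n => hP n φ) ?_
    rw [← preimage_iUnion]
    exact hPU φ
  not_measurable B hB := by rw [dif_neg hB]

variable {c : α → ℝ} {hc : Measurable c}

theorem has_toPVM_proj {B : Set ℝ} (hB : MeasurableSet B) (φ : 𝓗) :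
    F.Has ((c ⁻¹' B).indicator fun _ => 1) φ ((F.toPVM c hc).proj B φ) := by
  have h := (F.exists_indicatorOp (hc hB)).choose_spec φ
  have e : (F.toPVM c hc).proj B = (F.exists_indicatorOp (hc hB)).choose := dif_pos hB
  rwa [e]

theorem scalarMeasure_toPVM (φ : 𝓗) :
    (F.toPVM c hc).scalarMeasure φ = (F.meas φ).map c := by
  ext B hB
  rw [PVM.scalarMeasure_apply' _ hB, Measure.map_apply hc hB,
    F.indicator_measure (hc hB) (has_toPVM_proj hB φ)]

/-- Change of variables under c: the spectral measure of `toPVM` is the image measure, so integrals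
over ℝ pull back to the original calculus. -/
theorem has_of_toPVM {f : ℝ → ℂ} {φ u : 𝓗} (h : (F.toPVM c hc).HasIntegral f φ u) :
    F.Has (f ∘ c) φ u := by
  have hs : ∀ s : SimpleFunc ℝ ℂ, F.Has (s ∘ c) φ ((F.toPVM c hc).simpleIntegral s φ) := by
    intro s
    have h1 := has_finset_sum (F := F) (φ := φ) s.range
      (f := fun d => d • ((c ⁻¹' (s ⁻¹' {d})).indicator fun _ => 1))
      (u := fun d => d • (F.toPVM c hc).proj (s ⁻¹' {d}) φ)
      fun d _ => (has_toPVM_proj (s.measurableSet_fiber d) φ).const_smul d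
    refine h1.congr (Eventually.of_forall fun x => ?_)
    rw [Finset.sum_apply, Finset.sum_eq_single (s (c x))]
    · simp
    · intro d _ hd
      simp [indicator_of_notMem, Ne.symm hd]
    · intro hx; exact absurd (SimpleFunc.mem_range_self s (c x)) hx
  obtain ⟨hf, s, h1, h2⟩ := h
  rw [scalarMeasure_toPVM] at hf h1
  have hf' : MemLp (f ∘ c) 2 (F.meas φ) := hf.comp_of_map hc.aemeasurable
  obtain ⟨v, hv⟩ := exists_has hf'
  have h3 : Tendsto (fun n => (F.toPVM c hc).simpleIntegral (s n) φ) atTop (𝓝 v) := by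
    refine tendsto_of_has hv (fun n => hs (s n)) (h1.congr fun n => ?_)
    refine (eLpNorm_map_measure (g := fun x => f x - s n x)
      (hf.1.sub (s n).measurable.aestronglyMeasurable) hc.aemeasurable).trans ?_
    refine eLpNorm_congr_norm_ae (ae_of_all _ fun x => ?_)
    rw [← norm_neg]; simp
  rwa [tendsto_nhds_unique h2 h3]

end SpectralCalculus

/-! ### The spectral theorem -/

section
variable {𝓗 : Type*} [NormedAddCommGroup 𝓗] [InnerProductSpace ℂ 𝓗] [CompleteSpace 𝓗]
  (R : 𝓗 →L[ℂ] 𝓗) [hR : IsStarNormal R]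

theorem inner_cfcHom (g : C(spectrum ℂ R, ℂ)) (φ ψ : 𝓗) :
    inner ℂ ψ (cfcHom hR g φ) = inner ℂ (cfcHom hR (star g) ψ) φ := by
  rw [map_star, ContinuousLinearMap.star_eq_adjoint, ContinuousLinearMap.adjoint_inner_left]

theorem norm_cfcHom_sq (g : C(spectrum ℂ R, ℂ)) (φ : 𝓗) :
    ‖cfcHom hR g φ‖ ^ 2 = (inner ℂ φ (cfcHom hR (star g * g) φ)).re := by
  rw [map_mul]
  change _ = (inner ℂ φ (cfcHom hR (star g) (cfcHom hR g φ))).re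
  rw [inner_cfcHom, star_star,
    inner_self_eq_norm_sq_to_K]
  norm_cast

/-- The functional `g ↦ (g(R) φ, φ)` on real-valued continuous functions. -/
noncomputable def cfcFunctional (φ : 𝓗) :
    CompactlySupportedContinuousMap (spectrum ℂ R) ℝ →ₚ[ℝ] ℝ :=
  PositiveLinearMap.mk₀
    { toFun := fun g => (inner ℂ φ (cfcHom hR
        ((ContinuousMap.mk ((↑) : ℝ → ℂ) Complex.continuous_ofReal).comp g.toContinuousMap) φ)).re
      map_add' := fun f g => by
        rw [← Complex.add_re, ← inner_add_right, ← add_apply, ← map_add]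
        congr 4
        ext x; simp
      map_smul' := fun c g => by
        have : ((ContinuousMap.mk ((↑) : ℝ → ℂ) Complex.continuous_ofReal).comp
          (c • g).toContinuousMap) = (c : ℂ) • ((ContinuousMap.mk ((↑) : ℝ → ℂ)
            Complex.continuous_ofReal).comp g.toContinuousMap) := by
          ext x; simp
        rw [this, map_smul, smul_apply, inner_smul_right]
        simp }
    (by
      intro g hg
      -- Positivity: a nonnegative g is the product of √g with its conjugate, so the functional
      -- takes the value ‖√g(R)φ‖² on it.
      have : ((ContinuousMap.mk ((↑) : ℝ → ℂ) Complex.continuous_ofReal).comp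
          g.toContinuousMap) = star ((ContinuousMap.mk (fun x : ℝ => ((√x : ℝ) : ℂ))
            (by fun_prop)).comp g.toContinuousMap) *
            ((ContinuousMap.mk (fun x : ℝ => ((√x : ℝ) : ℂ))
            (by fun_prop)).comp g.toContinuousMap) := by
        ext x
        have : 0 ≤ g x := hg x
        simp only [ContinuousMap.comp_apply, ContinuousMap.coe_mk, ContinuousMap.mul_apply,
          ContinuousMap.star_apply, RCLike.star_def, Complex.conj_ofReal, ← Complex.ofReal_mul]
        congr 1
        exact (Real.mul_self_sqrt this).symm
      simp only [LinearMap.coe_mk, AddHom.coe_mk]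
      rw [this, ← norm_cfcHom_sq]
      positivity)

/-- The calculus of continuous functions of a normal operator. -/
noncomputable def normalCalculus : SpectralCalculus 𝓗 (spectrum ℂ R) C(spectrum ℂ R, ℂ) where
  val := ContinuousMap.coeFnAlgHom ℂ
  op := (cfcHom hR).toAlgHom
  conj := star
  val_conj _ _ := rfl
  inner_op := inner_cfcHom R
  meas φ := RealRMK.rieszMeasure (cfcFunctional R φ)
  isFiniteMeasure φ := inferInstance
  measurable g := g.continuous.measurable
  bounded g := by
    obtain ⟨C, hC⟩ := isCompact_univ.exists_bound_of_continuousOn g.continuous.continuousOn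
    exact ⟨C, fun x => hC x (mem_univ x)⟩
  eLpNorm_val g φ := by
    set k : CompactlySupportedContinuousMap (spectrum ℂ R) ℝ :=
      CompactlySupportedContinuousMap.continuousMapEquiv
        ⟨fun x => ‖g x‖ ^ 2, by fun_prop⟩ with hk
    have h1 := RealRMK.integral_rieszMeasure (cfcFunctional R φ) k
    have h2 : cfcFunctional R φ k = ‖cfcHom hR g φ‖ ^ 2 := by
      rw [norm_cfcHom_sq]
      change (inner ℂ φ (cfcHom hR _ φ)).re = _
      congr 4
      ext x
      simp only [ContinuousMap.comp_apply, ContinuousMap.coe_mk, ContinuousMap.mul_apply,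
          ContinuousMap.star_apply, RCLike.star_def]
      rw [mul_comm, Complex.mul_conj, Complex.normSq_eq_norm_sq]
      rfl
    refine (ENNReal.pow_right_strictMono two_ne_zero).injective ?_
    change eLpNorm g 2 _ ^ 2 = ‖cfcHom hR g φ‖ₑ ^ 2
    rw [eLpNorm_two_sq, ← ofReal_norm, ← ENNReal.ofReal_pow (norm_nonneg _), ← h2, ← h1,
      ofReal_integral_eq_lintegral_ofReal]
    · refine lintegral_congr fun x => ?_
      rw [← ofReal_norm, ← ENNReal.ofReal_pow (norm_nonneg _)]
      rfl
    · exact k.continuous.integrable_of_hasCompactSupport k.hasCompactSupport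
    · exact ae_of_all _ fun x => by change 0 ≤ ‖g x‖ ^ 2; positivity
  exists_approx ν _ f hf ε hε := by
    obtain ⟨g, hg, _⟩ := hf.exists_boundedContinuous_eLpNorm_sub_le (by norm_num) hε
    exact ⟨g.toContinuousMap, hg⟩

end

/-! ### Resolvent identities, and passage from the normal operator (H - i)⁻¹ to H -/

section
variable {𝓗 : Type*} [NormedAddCommGroup 𝓗] [InnerProductSpace ℂ 𝓗] [CompleteSpace 𝓗]
  {H : 𝓗 →ₗ.[ℂ] 𝓗}

theorem resolventOp_mem_graph (hH : IsSelfAdjoint H) {z : ℂ} (hz : z.im ≠ 0) (f : 𝓗) :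
    (resolventOp H z f, f + z • resolventOp H z f) ∈ H.graph :=
  (resolventOp_eq_iff hH hz _ _).1 rfl

theorem inner_resolventOp (hH : IsSelfAdjoint H) {z : ℂ} (hz : z.im ≠ 0) (f g : 𝓗) :
    inner ℂ (resolventOp H (starRingEnd ℂ z) f) g = inner ℂ f (resolventOp H z g) := by
  have h1 := resolventOp_mem_graph hH (z := starRingEnd ℂ z) (by simpa using hz) f
  have h2 := resolventOp_mem_graph hH hz g
  have h := hH.isSymmGraph _ h1 _ h2
  simp only [inner_add_left, inner_add_right, inner_smul_left, inner_smul_right,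
    RingHomCompTriple.comp_apply, RingHom.id_apply] at h
  linear_combination -h

theorem resolventOp_sub (hH : IsSelfAdjoint H) {z w : ℂ} (hz : z.im ≠ 0) (hw : w.im ≠ 0) (f : 𝓗) :
    resolventOp H z f - resolventOp H w f =
      (z - w) • resolventOp H z (resolventOp H w f) := by
  have h1 := resolventOp_mem_graph hH hz f
  have h2 := resolventOp_mem_graph hH hw f
  rw [← map_smul, eq_comm, resolventOp_eq_iff hH hz]
  convert H.graph.sub_mem h1 h2 using 1
  ext
  · rfl
  · simp only [Prod.snd_sub, smul_sub, sub_smul]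
    abel

theorem adjoint_resolventOp (hH : IsSelfAdjoint H) {z : ℂ} (hz : z.im ≠ 0) :
    star (resolventOp H z) = resolventOp H (starRingEnd ℂ z) := by
  rw [ContinuousLinearMap.star_eq_adjoint, eq_comm, ContinuousLinearMap.eq_adjoint_iff]
  exact inner_resolventOp hH hz

theorem resolventOp_I_relation (hH : IsSelfAdjoint H) :
    resolventOp H Complex.I - star (resolventOp H Complex.I) =
      (2 * Complex.I) • (resolventOp H Complex.I * star (resolventOp H Complex.I)) := by
  rw [adjoint_resolventOp hH (by simp)]
  ext f
  simp only [sub_apply, smul_apply]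
  rw [resolventOp_sub hH (by simp) (by simp)]
  simp [two_mul]

/-- The resolvent identity between i and -i, used in both orders, gives R - R* = 2iRR* and R - R* =
2iR*R. -/
theorem isStarNormal_resolventOp (hH : IsSelfAdjoint H) :
    IsStarNormal (resolventOp H Complex.I) := by
  have h1 := resolventOp_I_relation hH
  have h2 : resolventOp H Complex.I - star (resolventOp H Complex.I) =
      (2 * Complex.I) • (star (resolventOp H Complex.I) * resolventOp H Complex.I) := by
    rw [adjoint_resolventOp hH (by simp)]
    ext f
    simp only [sub_apply, smul_apply]
    rw [← neg_sub, resolventOp_sub hH (by simp) (by simp), ← neg_smul]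
    simp [two_mul, sub_eq_add_neg]
  refine ⟨?_⟩
  rw [h1] at h2
  exact ((smul_right_injective _ (by simp : (2 * Complex.I) ≠ 0)) h2).symm

theorem norm_ofReal_sub_ge (x : ℝ) (z : ℂ) : |z.im| ≤ ‖(x : ℂ) - z‖ := by
  have := Complex.abs_im_le_norm ((x : ℂ) - z)
  simpa using this

theorem measurable_resolventFun (z : ℂ) : Measurable fun x : ℝ => ((x : ℂ) - z)⁻¹ := by fun_prop

theorem norm_resolventFun_le {z : ℂ} (hz : z.im ≠ 0) (x : ℝ) : ‖((x : ℂ) - z)⁻¹‖ ≤ |z.im|⁻¹ := by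
  rw [norm_inv]
  exact inv_anti₀ (abs_pos.2 hz) (norm_ofReal_sub_ge x z)

theorem ofReal_sub_ne_zero {z : ℂ} (hz : z.im ≠ 0) (x : ℝ) : (x : ℂ) - z ≠ 0 := by
  intro h
  have := congrArg Complex.im h
  simp at this
  exact hz this

/-- A projection-valued measure whose integral of `(x - i)⁻¹` is the resolvent is the spectral
measure. -/
theorem isSpectralMeasure_of_resolvent (hH : IsSelfAdjoint H) {E : PVM 𝓗}
    (hE : ∀ φ, E.HasIntegral (fun x => ((x : ℂ) - Complex.I)⁻¹) φ (resolventOp H Complex.I φ)) :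
    IsSpectralMeasure H E := by
  have hI : Complex.I.im ≠ 0 := by simp
  have hm : Measurable fun x : ℝ => (x : ℂ) := by fun_prop
  intro φ u
  constructor
  · intro h
    have hφ : resolventOp H Complex.I (u - Complex.I • φ) = φ := by
      rw [resolventOp_eq_iff hH hI]; simpa using h
    have h1 := hE (u - Complex.I • φ)
    rw [hφ] at h1
    refine h1.comp_of_mul ?_ hm.aestronglyMeasurable
    -- The decomposition x(x - i)⁻¹ = 1 + i(x - i)⁻¹ shows that x is integrable for φ, with value u.
    have h2 := (PVM.HasIntegral.one (E := E) (u - Complex.I • φ)).add (h1.const_smul Complex.I)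
    rw [sub_add_cancel] at h2
    refine h2.congr (Eventually.of_forall fun x => ?_)
    have := ofReal_sub_ne_zero hI x
    simp only [Pi.add_apply, Pi.smul_apply, smul_eq_mul]
    field_simp
    ring
  · intro h
    have h1 := h.sub (PVM.HasIntegral.const (E := E) Complex.I φ)
    have h2 := h1.comp (hE (u - Complex.I • φ))
      (measurable_resolventFun Complex.I).aestronglyMeasurable
    have h3 : resolventOp H Complex.I (u - Complex.I • φ) = φ := by
      refine (h2.congr (Eventually.of_forall fun x => ?_)).unique (PVM.HasIntegral.one φ)
      have := ofReal_sub_ne_zero hI x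
      simp only [Pi.sub_apply]
      field_simp
    rw [resolventOp_eq_iff hH hI] at h3
    simpa using h3

/-- The **spectral theorem** for unbounded self-adjoint operators. -/
theorem exists_isSpectralMeasure (hH : IsSelfAdjoint H) : ∃ E, IsSpectralMeasure H E := by
  set R := resolventOp H Complex.I with hRdef
  have hR : IsStarNormal R := isStarNormal_resolventOp hH
  have hI : Complex.I.im ≠ 0 := by simp
  set F := normalCalculus R with hF
  have hinj : ∀ φ, R φ = 0 → φ = 0 := by
    intro φ h
    have := (resolventOp_eq_iff hH hI φ 0).1 h
    simp only [smul_zero, add_zero] at this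
    exact H.graph_fst_eq_zero_snd this rfl
  set e : C(spectrum ℂ R, ℂ) := (ContinuousMap.id ℂ).restrict (spectrum ℂ R) with he
  have hopid : F.op e = R := cfcHom_id hR
  have hval : ∀ r, F.val e r = (r : ℂ) := fun r => rfl
  -- The point 0 carries no mass because the resolvent is injective; hence 1/r makes sense almost
  -- everywhere.
  have h0 : ∀ φ, ∀ᵐ r : spectrum ℂ R ∂(F.meas φ), (r : ℂ) ≠ 0 := by
    intro φ
    have hB : MeasurableSet {r : spectrum ℂ R | (r : ℂ) = 0} :=
      measurableSet_eq_fun (by fun_prop) (by fun_prop)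
    obtain ⟨P, hP⟩ := F.exists_indicatorOp hB
    have h1 := (hP φ).op e
    have h2 : F.op e (P φ) = 0 := by
      have h3 := (SpectralCalculus.has_one (F := F) φ).const_smul 0
      rw [zero_smul, zero_smul] at h3
      refine h1.unique (h3.congr (Eventually.of_forall fun x => ?_))
      beta_reduce
      rw [hval]
      by_cases hx : (x : ℂ) = 0
      · simp [hx]
      · rw [indicator_of_notMem (by exact hx)]; simp
    rw [hopid] at h2
    have h4 := F.indicator_measure hB (hP φ)
    rw [hinj _ h2] at h4
    rw [ae_iff]
    simpa using h4.symm
  -- The operator identity R - R* = 2iRR* holds pointwise almost everywhere on the spectrum. Divided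
  -- by |r|², it says Im(1/r) = -1.
  have hrel : ∀ φ, ∀ᵐ r : spectrum ℂ R ∂(F.meas φ),
      (r : ℂ) - starRingEnd ℂ (r : ℂ) = (2 * Complex.I) * ((r : ℂ) * starRingEnd ℂ (r : ℂ)) := by
    intro φ
    have h1 : F.op (e - star e - (2 * Complex.I) • (e * star e)) = 0 := by
      have h2 : F.op (star e) = star R := by
        change cfcHom hR (star e) = _
        rw [map_star]
        exact congrArg star hopid
      rw [map_sub, map_sub, map_smul, map_mul, h2, hopid, sub_eq_zero]
      exact resolventOp_I_relation hH
    have h3 := F.eLpNorm_val (e - star e - (2 * Complex.I) • (e * star e)) φ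
    rw [h1] at h3
    simp only [zero_apply, enorm_zero] at h3
    rw [eLpNorm_eq_zero_iff (F.measurable _).aestronglyMeasurable (by norm_num)] at h3
    filter_upwards [h3] with r hr
    rw [← sub_eq_zero]
    exact hr
  -- Inverts r = (x - i)⁻¹: almost everywhere 1/r = x - i, so x = Re(1/r), and the spectral measure
  -- of H is the image under this map.
  set c : spectrum ℂ R → ℝ := fun r => ((r : ℂ)⁻¹).re with hc'
  have hc : Measurable c := by fun_prop
  refine ⟨F.toPVM c hc, isSpectralMeasure_of_resolvent hH fun φ => ?_⟩
  obtain ⟨u, hu⟩ : ∃ u, (F.toPVM c hc).HasIntegral (fun x => ((x : ℂ) - Complex.I)⁻¹) φ u :=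
    ⟨_, PVM.hasIntegral_boundedOp _ (measurable_resolventFun _) (norm_resolventFun_le hI) φ⟩
  have h1 := SpectralCalculus.has_of_toPVM hu
  have h2 : F.Has (F.val e) φ (F.op e φ) := SpectralCalculus.has_val e φ
  have h3 : u = F.op e φ := by
    refine (h1.congr ?_).unique h2
    filter_upwards [h0 φ, hrel φ] with r hr hr'
    rw [hval, Function.comp_apply]
    have hr2 : starRingEnd ℂ (r : ℂ) ≠ 0 := by simpa using hr
    have h4 : ((r : ℂ)⁻¹).im = -1 := by
      have h5 : (r : ℂ)⁻¹ - starRingEnd ℂ ((r : ℂ)⁻¹) = - (2 * Complex.I) := by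
        rw [map_inv₀]
        field_simp
        linear_combination -hr'
      have := congrArg Complex.im h5
      simp only [Complex.sub_im, Complex.conj_im, Complex.neg_im, Complex.mul_im,
        Complex.I_im, Complex.I_re] at this
      norm_num at this
      rw [Complex.inv_im]
      linarith
    have h6 : ((c r : ℝ) : ℂ) - Complex.I = (r : ℂ)⁻¹ := by
      apply Complex.ext
      · simp [hc']
      · simp only [Complex.sub_im, Complex.ofReal_im, Complex.I_im]
        rw [h4]; norm_num
    rw [h6, inv_inv]
  rw [h3, hopid] at hu
  exact hu

theorem isSpectralMeasure_spectralMeasure (hH : IsSelfAdjoint H) :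
    IsSpectralMeasure H (spectralMeasure H) :=
  Classical.epsilon_spec (exists_isSpectralMeasure hH)

theorem hasIntegral_resolventOp (hH : IsSelfAdjoint H) {z : ℂ} (hz : z.im ≠ 0) (f : 𝓗) :
    (spectralMeasure H).HasIntegral (fun x => ((x : ℂ) - z)⁻¹) f (resolventOp H z f) := by
  have h1 := PVM.hasIntegral_boundedOp (spectralMeasure H) (measurable_resolventFun z)
    (norm_resolventFun_le hz) f
  set u := (spectralMeasure H).boundedOp _ (measurable_resolventFun z) _
    (norm_resolventFun_le hz) f
  have h2 : (spectralMeasure H).HasIntegral (fun x => (x : ℂ)) u (f + z • u) := by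
    refine h1.comp_of_mul ?_ (by fun_prop : Measurable fun x : ℝ => (x : ℂ)).aestronglyMeasurable
    have h3 := (PVM.HasIntegral.one (E := spectralMeasure H) f).add (h1.const_smul z)
    refine h3.congr (Eventually.of_forall fun x => ?_)
    have := ofReal_sub_ne_zero hz x
    simp only [Pi.add_apply, Pi.smul_apply, smul_eq_mul]
    field_simp
    ring
  rw [(resolventOp_eq_iff hH hz f u).2 ((isSpectralMeasure_spectralMeasure hH _ _).2 h2)]
  exact h1

end

/-! ### The perturbed operator and its resolvent -/

section
variable {𝓗 : Type*} [NormedAddCommGroup 𝓗] [InnerProductSpace ℂ 𝓗]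
  {X : Type*} [NormedAddCommGroup X] [InnerProductSpace ℂ X]
  {Y : Type*} [NormedAddCommGroup Y] [InnerProductSpace ℂ Y]

@[simp] theorem toAntiDual_apply (ι : X →L[ℂ] 𝓗) (u : 𝓗) (g : X) :
    toAntiDual ι u g = inner ℂ (ι g) u := rfl

/-- The resolvent as an operator from `X` to `X*_H`. -/
noncomputable def resolventY (ι : X →L[ℂ] 𝓗) (j : Y →L[ℂ] AntiDual X) (H : 𝓗 →ₗ.[ℂ] 𝓗) (z : ℂ) :
    X →L[ℂ] Y :=
  Classical.epsilon fun T : X →L[ℂ] Y => ∀ f, j (T f) = toAntiDual ι (resolventOp H z (ι f))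

variable [CompleteSpace X] [CompleteSpace Y] {ι : X →L[ℂ] 𝓗}
  {j : Y →L[ℂ] AntiDual X} {H : 𝓗 →ₗ.[ℂ] 𝓗} {J : Set ℝ} {V : Y →L[ℂ] X} {z : ℂ}

/-- Injectivity of j makes the pointwise choice of preimages linear. Continuity comes from the
closed graph theorem, since composing with j gives a continuous map. -/
theorem j_resolventY (hj : Function.Injective j) (hY : IsAdapted ι j H J) (hz : z.im ≠ 0) (f : X) :
    j (resolventY ι j H z f) = toAntiDual ι (resolventOp H z (ι f)) := by
  have hex : ∃ T : X →L[ℂ] Y, ∀ f, j (T f) = toAntiDual ι (resolventOp H z (ι f)) := by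
    choose T hT using hY.maps_into z hz
    let T' : X →ₗ[ℂ] Y :=
      { toFun := T
        map_add' := fun f g => hj (by simp [hT])
        map_smul' := fun c f => hj (by simp [hT]) }
    have hc : Continuous T' := by
      refine T'.continuous_of_seq_closed_graph fun u f y hu hy => hj ?_
      have h1 : Tendsto (fun n => j (T' (u n))) atTop (𝓝 (j y)) := (j.continuous.tendsto y).comp hy
      have h2 : Tendsto (fun n => j (T' (u n))) atTop
          (𝓝 (toAntiDual ι (resolventOp H z (ι f)))) := by
        have h3 : ∀ n, j (T' (u n)) = (toAntiDual ι ∘L resolventOp H z ∘L ι) (u n) :=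
          fun n => hT (u n)
        simp_rw [h3]
        exact ((toAntiDual ι ∘L resolventOp H z ∘L ι).continuous.tendsto f).comp hu
      exact (tendsto_nhds_unique h1 h2).trans (hT f).symm
    exact ⟨⟨T', hc⟩, hT⟩
  exact Classical.epsilon_spec hex f

theorem exists_norm_resolventY_le (hj : Function.Injective j) (hY : IsAdapted ι j H J) {x : ℝ}
    (hx : x ∈ J) : ∃ M : ℝ, 0 ≤ M ∧ ∃ δ > 0, ∀ ε : ℝ, 0 < |ε| → |ε| < δ →
      ‖resolventY ι j H (x + ε * Complex.I)‖ ≤ M := by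
  obtain ⟨M, δ, hδ, h⟩ := hY.locally_bounded x hx
  refine ⟨max M 0, le_max_right _ _, δ, hδ, fun ε h0 h1 => ?_⟩
  refine ContinuousLinearMap.opNorm_le_bound _ (le_max_right _ _) fun f => ?_
  refine (h ε h0 h1 f _ (j_resolventY hj hY ?_ f)).trans
    (mul_le_mul_of_nonneg_right (le_max_left _ _) (norm_nonneg f))
  simpa using h0

variable [CompleteSpace 𝓗]

theorem resolventOp_mem_interDomain (hj : Function.Injective j) (hH : IsSelfAdjoint H)
    (hY : IsAdapted ι j H J) (hz : z.im ≠ 0) (f : X) :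
    resolventOp H z (ι f) ∈ interDomain ι j H :=
  ⟨LinearPMap.mem_domain_of_mem_graph (resolventOp_mem_graph hH hz (ι f)),
    ⟨_, j_resolventY hj hY hz f⟩⟩

/-- By compactness only the eigenvalue -1 has to be excluded. If VR(z)f = -f and u = R(z)f, symmetry
of V makes the inner product of f and u real; symmetry of H then gives Im z ‖u‖² = 0, so u = 0 and f
= 0. -/
theorem isUnit_one_add_comp_resolventY (hι : Function.Injective ι) (hj : Function.Injective j)
    (hH : IsSelfAdjoint H) (hY : IsAdapted ι j H J) (hV : IsShortRange ι j H V) (hz : z.im ≠ 0) :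
    IsUnit (1 + V ∘L resolventY ι j H z) := by
  have hcomp : IsCompactOperator (V ∘L resolventY ι j H z) :=
    hV.compact.comp_clm (resolventY ι j H z)
  rcases hcomp.hasEigenvalue_or_mem_resolventSet (μ := (-1 : ℂ)) (by norm_num) with h | h
  · exfalso
    obtain ⟨f, hf⟩ := h.exists_hasEigenvector
    have hf1 : V (resolventY ι j H z f) = -f := by simpa using hf.apply_eq_smul
    have hf2 := hf.2
    set u := resolventOp H z (ι f) with hu
    have hgr := resolventOp_mem_graph hH hz (ι f)
    rw [← hu] at hgr
    have hdom := resolventOp_mem_interDomain hj hH hY hz f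
    have hs := hV.symmetric u hdom u hdom _ _ (j_resolventY hj hY hz f) (j_resolventY hj hY hz f)
    rw [hf1, map_neg, inner_neg_left, inner_neg_right, neg_inj] at hs
    have hs2 := hH.isSymmGraph _ hgr _ hgr
    simp only [inner_add_left, inner_add_right, inner_smul_left, inner_smul_right] at hs2
    rw [hs, add_right_inj] at hs2
    have hu0 : u = 0 := by
      have h1 : (starRingEnd ℂ z - z) * inner ℂ u u = 0 := by rw [sub_mul, hs2, sub_self]
      rcases mul_eq_zero.1 h1 with h2 | h2
      · exfalso
        have := congrArg Complex.im h2
        simp only [Complex.sub_im, Complex.conj_im, Complex.zero_im] at this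
        exact hz (by linarith)
      · exact inner_self_eq_zero.1 h2
    rw [hu0, smul_zero, add_zero] at hgr
    exact hf2 (hι ((H.graph_fst_eq_zero_snd hgr rfl).trans (map_zero ι).symm))
  · rw [spectrum.mem_resolventSet_iff] at h
    have := h.neg
    convert this using 1
    simp [add_comm]

omit [CompleteSpace X] [CompleteSpace Y] in
theorem isSymmGraph_perturbedGraph (hH : IsSelfAdjoint H) (hV : IsShortRange ι j H V) :
    IsSymmGraph (perturbedGraph ι j H V) := by
  rintro p ⟨y, hy, hp⟩ q ⟨w, hw, hq⟩
  have hpd : p.1 ∈ interDomain ι j H := ⟨LinearPMap.mem_domain_of_mem_graph hp, ⟨y, hy⟩⟩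
  have hqd : q.1 ∈ interDomain ι j H := ⟨LinearPMap.mem_domain_of_mem_graph hq, ⟨w, hw⟩⟩
  have h1 := hV.symmetric _ hpd _ hqd _ _ hy hw
  have h2 := hH.isSymmGraph _ hp _ hq
  simp only [inner_sub_left, inner_sub_right] at h2
  linear_combination h1 + h2

omit [CompleteSpace X] [CompleteSpace Y] [CompleteSpace 𝓗] in
theorem dense_domain_perturbedGraph (hV : IsShortRange ι j H V) :
    Dense {u : 𝓗 | ∃ v, (u, v) ∈ (perturbedGraph ι j H V).topologicalClosure} := by
  refine hV.dense.mono ?_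
  rintro u ⟨hu, y, hy⟩
  obtain ⟨v, hv⟩ := LinearPMap.mem_domain_iff.1 hu
  exact ⟨v + ι (V y), Submodule.le_topologicalClosure _ ⟨y, hy, by simpa using hv⟩⟩

/-- With g = (I + VR(z))⁻¹f, the vector R(z)g satisfies (H + V - z)R(z)g = g + VR(z)g = f. This
gives both the dense range and the formula for the perturbed resolvent. -/
theorem mem_perturbedGraph (hι : Function.Injective ι) (hj : Function.Injective j)
    (hH : IsSelfAdjoint H) (hY : IsAdapted ι j H J) (hV : IsShortRange ι j H V) (hz : z.im ≠ 0)
    (f : X) :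
    (resolventOp H z (ι (Ring.inverse (1 + V ∘L resolventY ι j H z) f)),
      ι f + z • resolventOp H z (ι (Ring.inverse (1 + V ∘L resolventY ι j H z) f))) ∈
        perturbedGraph ι j H V := by
  set g := Ring.inverse (1 + V ∘L resolventY ι j H z) f with hg
  have h1 : g + V (resolventY ι j H z g) = f := by
    have := congrArg (fun T : X →L[ℂ] X => T f)
      (Ring.mul_inverse_cancel _ (isUnit_one_add_comp_resolventY hι hj hH hY hV hz))
    exact this
  refine ⟨resolventY ι j H z g, j_resolventY hj hY hz g, ?_⟩
  have h2 := resolventOp_mem_graph hH hz (ι g)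
  convert h2 using 2
  simp only
  rw [← h1, map_add]
  abel

theorem dense_range_perturbedGraph (hι : Function.Injective ι) (hι_dense : DenseRange ι)
    (hj : Function.Injective j)
    (hH : IsSelfAdjoint H) (hY : IsAdapted ι j H J) (hV : IsShortRange ι j H V) (hz : z.im ≠ 0) :
    Dense {f : 𝓗 | ∃ u, (u, f + z • u) ∈ (perturbedGraph ι j H V).topologicalClosure} := by
  refine Dense.mono ?_ hι_dense
  rintro _ ⟨f, rfl⟩
  exact ⟨_, Submodule.le_topologicalClosure _ (mem_perturbedGraph hι hj hH hY hV hz f)⟩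

theorem isSelfAdjoint_perturbed (hι : Function.Injective ι) (hι_dense : DenseRange ι)
    (hj : Function.Injective j)
    (hH : IsSelfAdjoint H) (hY : IsAdapted ι j H J) (hV : IsShortRange ι j H V) :
    IsSelfAdjoint (perturbed ι j H V) :=
  (isSymmGraph_perturbedGraph hH hV).topologicalClosure.isSelfAdjoint
    (Submodule.isClosed_topologicalClosure _) (dense_domain_perturbedGraph hV)
    fun _ hz => dense_range_perturbedGraph hι hι_dense hj hH hY hV hz

theorem resolventOp_perturbed (hι : Function.Injective ι) (hι_dense : DenseRange ι)
    (hj : Function.Injective j)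
    (hH : IsSelfAdjoint H) (hY : IsAdapted ι j H J) (hV : IsShortRange ι j H V) (hz : z.im ≠ 0)
    (f : X) :
    resolventOp (perturbed ι j H V) z (ι f) =
      resolventOp H z (ι (Ring.inverse (1 + V ∘L resolventY ι j H z) f)) := by
  rw [resolventOp_eq_iff (isSelfAdjoint_perturbed hι hι_dense hj hH hY hV) hz, perturbed,
    (isSymmGraph_perturbedGraph hH hV).topologicalClosure.graph_toLinearPMap
      (dense_domain_perturbedGraph hV)]
  exact Submodule.le_topologicalClosure _ (mem_perturbedGraph hι hj hH hY hV hz f)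

end

/-! ### The spectral density -/

section
variable {X : Type*} [NormedAddCommGroup X] [InnerProductSpace ℂ X]

/-- A sesquilinear form is determined by its diagonal. -/
theorem antiDual_ext {L T : X →L[ℂ] AntiDual X} (h : ∀ f, L f f = T f f) : L = T := by
  have h0 : ∀ f, (L - T) f f = 0 := fun f => by
    rw [sub_apply, sub_apply, h, sub_self]
  rw [← sub_eq_zero]
  set B := L - T
  ext f g
  have h1 : B f g + B g f = 0 := by
    have := h0 (f + g)
    simp only [map_add, add_apply, h0] at this
    linear_combination this
  have h2 : Complex.I * B f g - Complex.I * B g f = 0 := by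
    have := h0 (Complex.I • f + g)
    simp only [map_add, add_apply, map_smul, smul_apply, h0, map_smulₛₗ, smul_eq_mul,
      Complex.conj_I] at this
    linear_combination this
  have h3 : B f g = 0 := by
    have hI := Complex.I_ne_zero
    have : Complex.I * (B f g - B g f) = 0 := by linear_combination h2
    rcases mul_eq_zero.1 this with h | h
    · exact absurd h hI
    · linear_combination (h1 + h) / 2
  simpa using h3

variable {𝓗 : Type*} [NormedAddCommGroup 𝓗] [InnerProductSpace ℂ 𝓗] [CompleteSpace 𝓗]
  {ι : X →L[ℂ] 𝓗} {E : PVM 𝓗} {J : Set ℝ} {A : ℝ → X →L[ℂ] AntiDual X}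

/-- Taking adjoints in the assumption moves P_ac to the other side of E(J); hence P_ac can be
dropped over subsets of J. -/
theorem PVM.proj_acProj (hac : E.acProj * E.proj J = E.proj J) (hJ : MeasurableSet J) {B : Set ℝ}
    (hB : MeasurableSet B) (hBJ : B ⊆ J) (φ : 𝓗) : E.proj B (E.acProj φ) = E.proj B φ := by
  have hsa : star E.acProj = E.acProj := isSelfAdjoint_starProjection _
  have h1 : E.proj J * E.acProj = E.proj J := by
    have := congrArg star hac
    rwa [star_mul, hsa, (E.isStarProjection J hJ).isSelfAdjoint.star_eq] at this
  have h2 : E.proj B = E.proj B * E.proj J := by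
    rw [← E.proj_inter B J hB hJ, inter_eq_left.2 hBJ]
  rw [h2]
  change E.proj B ((E.proj J * E.acProj) φ) = _
  rw [h1]
  rfl

theorem PVM.proj_Iio_sub (E : PVM 𝓗) {a b : ℝ} (hab : a ≤ b) (φ : 𝓗) :
    E.proj (Iio b) φ - E.proj (Iio a) φ = E.proj (Ico a b) φ := by
  have h : Iio b = Iio a ∪ Ico a b := (Iio_union_Ico_eq_Iio hab).symm
  have hd : Disjoint (Iio a) (Ico a b) := by
    rw [disjoint_left]; intro x hx hx'; exact absurd hx'.1 (not_le.2 hx)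
  rw [h, E.proj_union measurableSet_Iio measurableSet_Ico hd]
  simp

theorem slope_spectralDensity (hac : E.acProj * E.proj J = E.proj J) (hJ : MeasurableSet J)
    {a b : ℝ} (hab : a ≤ b) (hI : Icc a b ⊆ J) (φ ψ : 𝓗) :
    inner ℂ ψ (E.proj (Iio b) (E.acProj φ)) - inner ℂ ψ (E.proj (Iio a) (E.acProj φ)) =
      inner ℂ ψ (E.proj (Ico a b) φ) := by
  rw [← inner_sub_right, E.proj_Iio_sub hab,
    PVM.proj_acProj hac hJ measurableSet_Ico (Ico_subset_Icc_self.trans hI)]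

/-- Evaluation of a form at a pair of vectors. -/
noncomputable def formEval (f g : X) : (X →L[ℂ] AntiDual X) →L[ℂ] ℂ :=
  (ContinuousLinearMap.apply' ℂ (starRingEnd ℂ) g : AntiDual X →L[ℂ] ℂ) ∘L
    (ContinuousLinearMap.apply' (AntiDual X) (RingHom.id ℂ) f :
      (X →L[ℂ] AntiDual X) →L[ℂ] AntiDual X)

theorem clm_intervalIntegral_smul {Z : Type*} [NormedAddCommGroup Z] [NormedSpace ℂ Z]
    [CompleteSpace Z] {A : ℝ → Z} (ev : Z →L[ℂ] ℂ) {a b : ℝ} (hab : a ≤ b)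
    (hc : ContinuousOn A (Icc a b)) {q : ℝ → ℂ} (hq : ContinuousOn q (Icc a b)) :
    ev (∫ x in a..b, q x • A x) = ∫ x in a..b, q x * ev (A x) := by
  rw [← uIcc_of_le hab] at hc hq
  have hint : IntervalIntegrable (fun x => q x • A x) volume a b := (hq.smul hc).intervalIntegrable
  rw [← ev.intervalIntegral_comp_comm hint]
  simp

theorem continuousOn_density_apply (hc : ContinuousOn A J) (f g : X) :
    ContinuousOn (fun x => A x f g) J :=
  (formEval f g).continuous.comp_continuousOn hc

theorem inner_proj_Ico (hac : E.acProj * E.proj J = E.proj J) (hJ : IsOpen J)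
    (hA : IsSpectralDensity ι E J A) (hc : ContinuousOn A J) {a b : ℝ} (hab : a ≤ b)
    (hI : Icc a b ⊆ J) (f g : X) :
    inner ℂ (ι g) (E.proj (Ico a b) (ι f)) = ∫ x in a..b, A x f g := by
  rw [← uIcc_of_le hab] at hI
  rw [intervalIntegral.integral_eq_sub_of_hasDerivAt (fun x hx => hA x (hI hx) f g)
    ((continuousOn_density_apply hc f g).mono hI).intervalIntegrable]
  rw [uIcc_of_le hab] at hI
  exact (slope_spectralDensity hac hJ.measurableSet hab hI _ _).symm

/-- The diagonal value is the limit of the quotients ‖E([x, y))f‖²/(y - x) as y ↓ x. -/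
theorem density_self_nonneg (hac : E.acProj * E.proj J = E.proj J) (hJ : IsOpen J)
    (hA : IsSpectralDensity ι E J A) {x : ℝ} (hx : x ∈ J) (f : X) :
    0 ≤ (A x f f).re ∧ A x f f = ((A x f f).re : ℂ) := by
  have h1 := (hA x hx f f).hasDerivWithinAt (s := Ioi x)
  rw [hasDerivWithinAt_iff_tendsto_slope' self_notMem_Ioi] at h1
  have hcl : IsClosed {z : ℂ | 0 ≤ z.re ∧ z.im = 0} :=
    (isClosed_le continuous_const Complex.continuous_re).inter
      (isClosed_eq Complex.continuous_im continuous_const)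
  have h2 : A x f f ∈ {z : ℂ | 0 ≤ z.re ∧ z.im = 0} := by
    refine hcl.mem_of_tendsto h1 ?_
    obtain ⟨δ, hδ, hb⟩ := Metric.isOpen_iff.1 hJ x hx
    filter_upwards [Ioo_mem_nhdsGT (show x < x + δ by linarith)] with y hy
    have hI : Icc x y ⊆ J := fun t ht => hb (by
      rw [Metric.mem_ball, Real.dist_eq, abs_lt]; constructor <;> linarith [ht.1, ht.2, hy.2])
    rw [slope_def_module, slope_spectralDensity hac hJ.measurableSet hy.1.le hI,
      E.inner_proj measurableSet_Ico]
    have h3 : 0 < y - x := by linarith [hy.1]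
    constructor
    · simp only [Complex.real_smul, ← Complex.ofReal_mul, Complex.ofReal_re]
      positivity
    · simp only [Complex.real_smul, ← Complex.ofReal_mul, Complex.ofReal_im]
  refine ⟨h2.1, Complex.ext (by simp) (by simpa using h2.2)⟩

theorem scalarMeasure_Ico (hac : E.acProj * E.proj J = E.proj J) (hJ : IsOpen J)
    (hA : IsSpectralDensity ι E J A) (hc : ContinuousOn A J) {a b : ℝ} (hab : a ≤ b)
    (hI : Icc a b ⊆ J) (f : X) :
    E.scalarMeasure (ι f) (Ico a b) = ENNReal.ofReal (∫ x in a..b, (A x f f).re) := by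
  have h1 := inner_proj_Ico hac hJ hA hc hab hI f f
  rw [E.inner_proj measurableSet_Ico] at h1
  rw [E.scalarMeasure_apply _ measurableSet_Ico]
  congr 1
  have h2 : ∫ x in a..b, A x f f = ((∫ x in a..b, (A x f f).re : ℝ) : ℂ) := by
    rw [← intervalIntegral.integral_ofReal]
    refine intervalIntegral.integral_congr fun x hx => ?_
    rw [uIcc_of_le hab] at hx
    exact (density_self_nonneg hac hJ hA (hI hx) f).2
  rw [h2] at h1
  exact_mod_cast h1

/-- Equality on half-open intervals, obtained from the fundamental theorem of calculus, determines
the measure. -/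
theorem scalarMeasure_restrict_Ico (hac : E.acProj * E.proj J = E.proj J) (hJ : IsOpen J)
    (hA : IsSpectralDensity ι E J A) (hc : ContinuousOn A J) {a b : ℝ}
    (hI : Icc a b ⊆ J) (f : X) :
    (E.scalarMeasure (ι f)).restrict (Ico a b) =
      (volume.restrict (Ico a b)).withDensity fun x => ENNReal.ofReal (A x f f).re := by
  refine Measure.ext_of_Ico _ _ fun c d _ => ?_
  rw [withDensity_apply _ measurableSet_Ico, Measure.restrict_apply measurableSet_Ico,
    Measure.restrict_restrict measurableSet_Ico, Ico_inter_Ico]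
  rcases le_or_gt (c ⊔ a) (d ⊓ b) with h | h
  · have hsub : Icc (c ⊔ a) (d ⊓ b) ⊆ J :=
      (Icc_subset_Icc le_sup_right inf_le_right).trans hI
    rw [scalarMeasure_Ico hac hJ hA hc h hsub, intervalIntegral.integral_of_le h,
      ← restrict_Ico_eq_restrict_Ioc, ofReal_integral_eq_lintegral_ofReal]
    · refine IntegrableOn.mono_set ?_ Ico_subset_Icc_self
      exact (Complex.continuous_re.comp_continuousOn
        ((continuousOn_density_apply hc f f).mono hsub)).integrableOn_Icc
    · rw [EventuallyLE, ae_restrict_iff' measurableSet_Ico]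
      exact ae_of_all _ fun x hx =>
        (density_self_nonneg hac hJ hA (hsub (Ico_subset_Icc_self hx)) f).1
  · rw [Ico_eq_empty (not_lt.2 h.le)]
    simp

theorem inner_hasIntegral_Ico (hac : E.acProj * E.proj J = E.proj J) (hJ : IsOpen J)
    (hA : IsSpectralDensity ι E J A) (hc : ContinuousOn A J) {a b : ℝ} (hab : a ≤ b)
    (hI : Icc a b ⊆ J) (f : X) {q : ℝ → ℂ} {u : 𝓗}
    (hu : E.HasIntegral ((Ico a b).indicator q) (ι f) u) :
    inner ℂ (ι f) u = ∫ x in a..b, q x * A x f f := by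
  rw [PVM.inner_hasIntegral hu, integral_indicator measurableSet_Ico,
    scalarMeasure_restrict_Ico hac hJ hA hc hI, integral_withDensity_eq_integral_toReal_smul₀,
    intervalIntegral.integral_of_le hab, ← restrict_Ico_eq_restrict_Ioc]
  · refine setIntegral_congr_fun measurableSet_Ico fun x hx => ?_
    obtain ⟨h1, h2⟩ := density_self_nonneg hac hJ hA (hI (Ico_subset_Icc_self hx)) f
    rw [ENNReal.toReal_ofReal h1, h2, Complex.real_smul, Complex.ofReal_re, mul_comm]
  · refine AEMeasurable.ennreal_ofReal ?_
    exact (Complex.continuous_re.comp_continuousOn ((continuousOn_density_apply hc f f).mono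
      (Ico_subset_Icc_self.trans hI))).aemeasurable measurableSet_Ico
  · exact ae_of_all _ fun x => ENNReal.ofReal_lt_top

omit [CompleteSpace 𝓗] in
theorem asXDual_apply (ι : X →L[ℂ] 𝓗) (T : 𝓗 →L[ℂ] 𝓗) (f g : X) :
    asXDual ι T f g = inner ℂ (ι g) (T (ι f)) := rfl

/-- Polarization leaves only the diagonal to check, where the spectral measure of f has the density
`A x f f`. The integral on the right is a Bochner integral in operator norm, which permits norm
limits later. -/
theorem asXDual_eq_integral (hac : E.acProj * E.proj J = E.proj J) (hJ : IsOpen J)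
    (hA : IsSpectralDensity ι E J A) (hc : ContinuousOn A J) {a b : ℝ} (hab : a ≤ b)
    (hI : Icc a b ⊆ J) {q : ℝ → ℂ} (hq : ContinuousOn q (Icc a b)) {T : 𝓗 →L[ℂ] 𝓗}
    (hT : ∀ φ, E.HasIntegral ((Ico a b).indicator q) φ (T φ)) :
    asXDual ι T = ∫ x in a..b, q x • A x := by
  refine antiDual_ext fun f => ?_
  rw [asXDual_apply, inner_hasIntegral_Ico hac hJ hA hc hab hI f (hT (ι f))]
  have h := clm_intervalIntegral_smul (Z := X →L[ℂ] AntiDual X) (formEval f f) hab (hc.mono hI) hq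
  exact h.symm

end

/-! ### Boundary values of Cauchy integrals -/

theorem intervalIntegrable_abs_sub_rpow {r : ℝ} (hr : -1 < r) (x₀ δ : ℝ) (hδ : 0 < δ) :
    IntervalIntegrable (fun x => |x - x₀| ^ r) volume (x₀ - δ) (x₀ + δ) := by
  have h1 : IntervalIntegrable (fun x : ℝ => |x| ^ r) volume 0 δ := by
    refine (intervalIntegral.intervalIntegrable_rpow' hr (a := 0) (b := δ)).congr fun x hx => ?_
    rw [uIoc_of_le hδ.le] at hx
    simp only [abs_of_pos hx.1]
  have h2 : IntervalIntegrable (fun x : ℝ => |x| ^ r) volume (-δ) 0 := by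
    have h3 := (IntervalIntegrable.iff_comp_neg (f := fun x : ℝ => |x| ^ r)).1 h1
    simp only [abs_neg, neg_zero] at h3
    exact h3.symm
  have h4 := (h2.trans h1).comp_sub_right x₀
  rwa [neg_add_eq_sub, add_comm δ x₀] at h4

theorem integral_inv_sub {x₀ δ : ℝ} {τ : ℝ} (hτ : τ ≠ 0) :
    ∫ x in (x₀ - δ)..(x₀ + δ), ((x : ℂ) - (x₀ + τ * Complex.I))⁻¹ =
      Complex.log (δ - τ * Complex.I) - Complex.log (-δ - τ * Complex.I) := by
  have him : (x₀ + τ * Complex.I : ℂ).im ≠ 0 := by simpa using hτ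
  have hd : ∀ x : ℝ, HasDerivAt (fun x : ℝ => Complex.log ((x : ℂ) - (x₀ + τ * Complex.I)))
      (((x : ℂ) - (x₀ + τ * Complex.I))⁻¹) x := by
    intro x
    have h1 : HasDerivAt (fun x : ℝ => (x : ℂ) - (x₀ + τ * Complex.I)) 1 x :=
      (Complex.ofRealCLM.hasDerivAt (x := x)).sub_const _
    have h2 := h1.clog_real (Or.inr (by simpa using hτ))
    simpa using h2
  rw [intervalIntegral.integral_eq_sub_of_hasDerivAt (fun x _ => hd x)]
  · congr 2 <;> push_cast <;> ring
  · refine Continuous.intervalIntegrable ?_ _ _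
    exact Continuous.inv₀ (by fun_prop) (fun x => ofReal_sub_ne_zero him x)

/-- The logarithm at δ is continuous, while -δ lies on the branch cut: it is approached from below
for s = 1 and from above for s = -1. The two one-sided values of the argument produce sπi. -/
theorem tendsto_integral_inv_sub {x₀ δ : ℝ} (hδ : 0 < δ) {s : ℝ} (hs : s = 1 ∨ s = -1) :
    Tendsto (fun ε : ℝ => ∫ x in (x₀ - δ)..(x₀ + δ), ((x : ℂ) - (x₀ + s * ε * Complex.I))⁻¹)
      (𝓝[>] 0) (𝓝 (s * Real.pi * Complex.I)) := by
  have h1 : ∀ᶠ ε : ℝ in 𝓝[>] 0, Complex.log (δ - (s * ε : ℝ) * Complex.I) -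
      Complex.log (-δ - (s * ε : ℝ) * Complex.I) =
      ∫ x in (x₀ - δ)..(x₀ + δ), ((x : ℂ) - (x₀ + s * ε * Complex.I))⁻¹ := by
    filter_upwards [self_mem_nhdsWithin] with ε hε
    have hε' : (0 : ℝ) < ε := hε
    rw [← integral_inv_sub (τ := s * ε) (by
      rcases hs with h | h <;> rw [h] <;> simp [hε'.ne'])]
    push_cast
    rfl
  refine Tendsto.congr' h1 ?_
  have hz : Tendsto (fun ε : ℝ => ((s * ε : ℝ) : ℂ) * Complex.I) (𝓝[>] 0) (𝓝 0) := by
    have : Continuous fun ε : ℝ => ((s * ε : ℝ) : ℂ) * Complex.I := by fun_prop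
    have h := this.tendsto 0
    simp only [mul_zero, Complex.ofReal_zero, zero_mul] at h
    exact h.mono_left nhdsWithin_le_nhds
  have h2 : Tendsto (fun ε : ℝ => Complex.log (δ - (s * ε : ℝ) * Complex.I)) (𝓝[>] 0)
      (𝓝 (Real.log δ : ℝ)) := by
    have h3 : ContinuousAt Complex.log (δ : ℂ) :=
      continuousAt_clog (Or.inl (by simpa using hδ))
    rw [Complex.ofReal_log hδ.le]
    refine h3.tendsto.comp ?_
    simpa using (tendsto_const_nhds (x := (δ : ℂ))).sub hz
  have h4 : Tendsto (fun ε : ℝ => -(δ : ℂ) - (s * ε : ℝ) * Complex.I) (𝓝[>] 0) (𝓝 (-(δ : ℂ))) := by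
    simpa using (tendsto_const_nhds (x := -(δ : ℂ))).sub hz
  have h5 : Tendsto (fun ε : ℝ => Complex.log (-δ - (s * ε : ℝ) * Complex.I)) (𝓝[>] 0)
      (𝓝 ((Real.log δ : ℝ) - s * Real.pi * Complex.I)) := by
    rcases hs with rfl | rfl
    · have h6 := Complex.tendsto_log_nhdsWithin_im_neg_of_re_neg_of_im_zero (z := -(δ : ℂ))
        (by simpa using hδ) (by simp)
      simp only [norm_neg, Complex.norm_real, Real.norm_eq_abs, abs_of_pos hδ] at h6
      have h7 := h6.comp (tendsto_nhdsWithin_iff.2 ⟨h4, by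
        filter_upwards [self_mem_nhdsWithin] with ε hε
        have : (0 : ℝ) < ε := hε
        simpa using this⟩)
      simpa [Function.comp_def] using h7
    · have h6 := (Complex.continuousWithinAt_log_of_re_neg_of_im_zero (z := -(δ : ℂ))
        (by simpa using hδ) (by simp)).tendsto
      have h7 := h6.comp (tendsto_nhdsWithin_iff.2 ⟨h4, by
        filter_upwards [self_mem_nhdsWithin] with ε hε
        have : (0 : ℝ) < ε := hε
        simpa using this.le⟩)
      have h8 : Complex.log (-(δ : ℂ)) = (Real.log δ : ℝ) + Real.pi * Complex.I := by
        rw [← Complex.ofReal_neg, Complex.log, Complex.arg_ofReal_of_neg (by linarith)]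
        simp [abs_of_pos hδ]
      rw [h8] at h7
      simpa [Function.comp_def] using h7
  simpa using h2.sub h5

theorem tendsto_add_of_tendsto {Z β : Type*} [NormedAddCommGroup Z] {l : Filter β} {f g : β → Z}
    {a b : Z} (hf : Tendsto f l (𝓝 a)) (hg : Tendsto g l (𝓝 b)) :
    Tendsto (fun x => f x + g x) l (𝓝 (a + b)) :=
  hf.add hg

/-- The Sokhotski–Plemelj formula. Subtracting A(x₀) leaves an integrand dominated by c|x -
x₀|^{α-1}, integrable since α > 0; the subtracted constant contributes the jump. The limit B of the
first part does not depend on the side. -/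
theorem exists_tendsto_cauchyIntegral {Z : Type*} [NormedAddCommGroup Z] [NormedSpace ℂ Z]
    [CompleteSpace Z]
    {A : ℝ → Z} {x₀ δ c α : ℝ} (hδ : 0 < δ) (hα : 0 < α)
    (hc : ContinuousOn A (Icc (x₀ - δ) (x₀ + δ)))
    (hH : ∀ x ∈ Icc (x₀ - δ) (x₀ + δ), ‖A x - A x₀‖ ≤ c * |x - x₀| ^ α) :
    ∃ B : Z, ∀ s : ℝ, s = 1 ∨ s = -1 →
      Tendsto (fun ε : ℝ => ∫ x in (x₀ - δ)..(x₀ + δ), ((x : ℂ) - (x₀ + s * ε * Complex.I))⁻¹ • A x)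
        (𝓝[>] 0) (𝓝 (B + (s * Real.pi * Complex.I : ℂ) • A x₀)) := by
  have hle : x₀ - δ ≤ x₀ + δ := by linarith
  refine ⟨∫ x in (x₀ - δ)..(x₀ + δ), ((x : ℂ) - x₀)⁻¹ • (A x - A x₀), fun s hs => ?_⟩
  have hcont : ∀ ε : ℝ, 0 < ε → Continuous fun x : ℝ => ((x : ℂ) - (x₀ + s * ε * Complex.I))⁻¹ := by
    intro ε hε
    refine Continuous.inv₀ (by fun_prop) (fun x => ofReal_sub_ne_zero ?_ x)
    rcases hs with rfl | rfl <;> simp [hε.ne']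
  have hsplit : ∀ᶠ ε : ℝ in 𝓝[>] 0,
      (∫ x in (x₀ - δ)..(x₀ + δ), ((x : ℂ) - (x₀ + s * ε * Complex.I))⁻¹ • (A x - A x₀)) +
        (∫ x in (x₀ - δ)..(x₀ + δ), ((x : ℂ) - (x₀ + s * ε * Complex.I))⁻¹) • A x₀ =
      ∫ x in (x₀ - δ)..(x₀ + δ), ((x : ℂ) - (x₀ + s * ε * Complex.I))⁻¹ • A x := by
    filter_upwards [self_mem_nhdsWithin] with ε hε
    have hcc := (hcont ε hε).continuousOn (s := uIcc (x₀ - δ) (x₀ + δ))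
    have h1 : IntervalIntegrable
        (fun x : ℝ => ((x : ℂ) - (x₀ + s * ε * Complex.I))⁻¹ • (A x - A x₀)) volume
        (x₀ - δ) (x₀ + δ) := by
      rw [← uIcc_of_le hle] at hc
      exact (hcc.smul (hc.sub continuousOn_const)).intervalIntegrable
    have h2 : IntervalIntegrable
        (fun x : ℝ => ((x : ℂ) - (x₀ + s * ε * Complex.I))⁻¹ • A x₀) volume
        (x₀ - δ) (x₀ + δ) := (hcc.smul continuousOn_const).intervalIntegrable
    rw [← intervalIntegral.integral_smul_const, ← intervalIntegral.integral_add h1 h2]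
    refine intervalIntegral.integral_congr fun x _ => ?_
    simp [← smul_add]
  refine Tendsto.congr' hsplit (Tendsto.add ?_ ((tendsto_integral_inv_sub hδ hs).smul_const _))
  refine intervalIntegral.tendsto_integral_filter_of_dominated_convergence
    (fun x => c * |x - x₀| ^ (α - 1)) ?_ ?_
    ((intervalIntegrable_abs_sub_rpow (by linarith) x₀ δ hδ).const_mul c) ?_
  · filter_upwards [self_mem_nhdsWithin] with ε hε
    have h1 : ContinuousOn (fun x : ℝ => ((x : ℂ) - (x₀ + s * ε * Complex.I))⁻¹ • (A x - A x₀))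
        (Icc (x₀ - δ) (x₀ + δ)) :=
      (hcont ε hε).continuousOn.smul (hc.sub continuousOn_const)
    rw [uIoc_of_le hle]
    exact (h1.mono Ioc_subset_Icc_self).aestronglyMeasurable measurableSet_Ioc
  · filter_upwards [self_mem_nhdsWithin] with ε hε
    have hne : ∀ᵐ x : ℝ, x ≠ x₀ := by simp [ae_iff, measure_singleton]
    filter_upwards [hne] with x hx hxI
    rw [uIoc_of_le hle] at hxI
    have h1 := hH x (Ioc_subset_Icc_self hxI)
    have hpos : 0 < |x - x₀| := abs_pos.2 (sub_ne_zero.2 hx)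
    have h2 : |x - x₀| ≤ ‖(x : ℂ) - (x₀ + s * ε * Complex.I)‖ := by
      have := Complex.abs_re_le_norm ((x : ℂ) - (x₀ + s * ε * Complex.I))
      simpa using this
    rw [norm_smul, norm_inv]
    calc ‖(x : ℂ) - (x₀ + s * ε * Complex.I)‖⁻¹ * ‖A x - A x₀‖
        ≤ |x - x₀|⁻¹ * (c * |x - x₀| ^ α) := by gcongr
      _ = c * |x - x₀| ^ (α - 1) := by
          rw [Real.rpow_sub_one hpos.ne']; field_simp
  · have hne : ∀ᵐ x : ℝ, x ≠ x₀ := by simp [ae_iff, measure_singleton]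
    filter_upwards [hne] with x hx _
    refine Tendsto.smul_const ?_ _
    have hx0 : (x : ℂ) - x₀ ≠ 0 := by
      rw [← Complex.ofReal_sub]; exact_mod_cast sub_ne_zero.2 hx
    refine Tendsto.inv₀ ?_ hx0
    have : Continuous fun ε : ℝ => (x : ℂ) - (x₀ + s * ε * Complex.I) := by fun_prop
    have h := this.tendsto 0
    simp only [Complex.ofReal_zero, mul_zero, zero_mul, add_zero] at h
    exact h.mono_left nhdsWithin_le_nhds

/-! ### Boundary values of the resolvent as a map from X to X* -/

section
variable {𝓗 : Type*} [NormedAddCommGroup 𝓗] [InnerProductSpace ℂ 𝓗] [CompleteSpace 𝓗]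
  {X : Type*} [NormedAddCommGroup X] [InnerProductSpace ℂ X]
  {ι : X →L[ℂ] 𝓗} {H : 𝓗 →ₗ.[ℂ] 𝓗} {J : Set ℝ} {A : ℝ → X →L[ℂ] AntiDual X}

/-- At distance at least δ from x₀ the resolvent functions converge uniformly, with error at most
ε/δ². The alternative for real z lets T be a total function of z, although the integral need not be
a bounded operator there. -/
theorem tendsto_boundedOp_compl (E : PVM 𝓗) {x₀ δ : ℝ} (hδ : 0 < δ) {T : ℂ → 𝓗 →L[ℂ] 𝓗}
    (hT : ∀ z φ, E.HasIntegral ((Ico (x₀ - δ) (x₀ + δ))ᶜ.indicator fun x => ((x : ℂ) - z)⁻¹) φ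
      (T z φ) ∨ z.im = 0) :
    ∃ T₀ : 𝓗 →L[ℂ] 𝓗, ∀ s : ℝ, s = 1 ∨ s = -1 →
      Tendsto (fun ε : ℝ => T (x₀ + s * ε * Complex.I)) (𝓝[>] 0) (𝓝 T₀) := by
  have hfar : ∀ x : ℝ, x ∈ (Ico (x₀ - δ) (x₀ + δ))ᶜ → δ ≤ |x - x₀| := by
    intro x hx
    by_contra h
    push Not at h
    rw [abs_lt] at h
    exact hx ⟨by linarith, by linarith⟩
  have hmeas : ∀ z : ℂ, Measurable ((Ico (x₀ - δ) (x₀ + δ))ᶜ.indicator fun x : ℝ =>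
      ((x : ℂ) - z)⁻¹) := fun z => (measurable_resolventFun z).indicator measurableSet_Ico.compl
  have hb : ∀ x : ℝ, ‖(Ico (x₀ - δ) (x₀ + δ))ᶜ.indicator (fun x : ℝ => ((x : ℂ) - x₀)⁻¹) x‖ ≤
      δ⁻¹ := by
    intro x
    by_cases hx : x ∈ (Ico (x₀ - δ) (x₀ + δ))ᶜ
    · rw [indicator_of_mem hx, norm_inv, ← Complex.ofReal_sub, Complex.norm_real]
      exact inv_anti₀ hδ (hfar x hx)
    · rw [indicator_of_notMem hx]; simpa using hδ.le
  refine ⟨E.boundedOp _ (hmeas x₀) _ hb, fun s hs => ?_⟩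
  rw [tendsto_iff_norm_sub_tendsto_zero]
  have hlim : Tendsto (fun ε : ℝ => ε / δ ^ 2) (𝓝[>] 0) (𝓝 0) := by
    have : Continuous fun ε : ℝ => ε / δ ^ 2 := by fun_prop
    simpa using (this.tendsto 0).mono_left nhdsWithin_le_nhds
  refine squeeze_zero' (Eventually.of_forall fun _ => norm_nonneg _) ?_ hlim
  filter_upwards [self_mem_nhdsWithin] with ε hε
  have hε' : (0 : ℝ) < ε := hε
  refine ContinuousLinearMap.opNorm_le_bound _ (by positivity) fun φ => ?_
  have h1 : E.HasIntegral ((Ico (x₀ - δ) (x₀ + δ))ᶜ.indicator fun x : ℝ =>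
      ((x : ℂ) - (x₀ + s * ε * Complex.I))⁻¹) φ (T (x₀ + s * ε * Complex.I) φ) := by
    refine (hT _ φ).resolve_right ?_
    rcases hs with rfl | rfl <;> simp [hε'.ne']
  have h2 := h1.sub (PVM.hasIntegral_boundedOp E (hmeas x₀) hb φ)
  rw [sub_apply]
  refine h2.enorm_le fun x => ?_
  rw [Pi.sub_apply]
  by_cases hx : x ∈ (Ico (x₀ - δ) (x₀ + δ))ᶜ
  · rw [indicator_of_mem hx, indicator_of_mem hx]
    have hx1 := hfar x hx
    have hn1 : δ ≤ ‖(x : ℂ) - x₀‖ := by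
      rw [← Complex.ofReal_sub, Complex.norm_real]; exact hx1
    have hn2 : δ ≤ ‖(x : ℂ) - (x₀ + s * ε * Complex.I)‖ := by
      have := Complex.abs_re_le_norm ((x : ℂ) - (x₀ + s * ε * Complex.I))
      refine hx1.trans ?_
      simpa using this
    have hz1 : (x : ℂ) - x₀ ≠ 0 := norm_pos_iff.1 (hδ.trans_le hn1)
    have hz2 : (x : ℂ) - (x₀ + s * ε * Complex.I) ≠ 0 := norm_pos_iff.1 (hδ.trans_le hn2)
    rw [inv_sub_inv hz2 hz1, norm_div, norm_mul]
    have h3 : ‖(x : ℂ) - x₀ - ((x : ℂ) - (x₀ + s * ε * Complex.I))‖ = ε := by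
      rw [show (x : ℂ) - x₀ - ((x : ℂ) - (x₀ + s * ε * Complex.I)) = s * ε * Complex.I by ring]
      rcases hs with rfl | rfl <;> simp [abs_of_pos hε']
    rw [h3, sq]
    gcongr
  · rw [indicator_of_notMem hx, indicator_of_notMem hx, sub_zero, norm_zero]
    positivity

/-- Cut the resolvent at an interval around x₀ inside J: the near part is a Cauchy integral of A,
the far part converges even in the norm of B(𝓗). Both signs share the same B, which is used to
control its imaginary part. -/
theorem exists_tendsto_asXDual_resolvent (hH : IsSelfAdjoint H)
    (hac : (spectralMeasure H).acProj * (spectralMeasure H).proj J = (spectralMeasure H).proj J)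
    (hJ : IsOpen J) (hA : IsSpectralDensity ι (spectralMeasure H) J A) (hc : ContinuousOn A J)
    {α : ℝ} (hα : 0 < α)
    (hhol : ∀ K ⊆ J, IsCompact K → ∃ c : ℝ, ∀ x ∈ K, ∀ y ∈ K, ‖A x - A y‖ ≤ c * |x - y| ^ α)
    {x₀ : ℝ} (hx₀ : x₀ ∈ J) :
    ∃ B : X →L[ℂ] AntiDual X, ∀ s : ℝ, s = 1 ∨ s = -1 →
      Tendsto (fun ε : ℝ => asXDual ι (resolventOp H (x₀ + s * ε * Complex.I)))
        (𝓝[>] 0) (𝓝 (B + (s * Real.pi * Complex.I : ℂ) • A x₀)) := by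
  set E := spectralMeasure H
  obtain ⟨δ', hδ', hb⟩ := Metric.isOpen_iff.1 hJ x₀ hx₀
  set δ := δ' / 2 with hδdef
  have hδ : 0 < δ := by positivity
  have hI : Icc (x₀ - δ) (x₀ + δ) ⊆ J := fun t ht => hb (by
    rw [Metric.mem_ball, Real.dist_eq, abs_lt]; constructor <;> linarith [ht.1, ht.2])
  obtain ⟨c, hcc⟩ := hhol _ hI isCompact_Icc
  have hmem : x₀ ∈ Icc (x₀ - δ) (x₀ + δ) := ⟨by linarith, by linarith⟩
  obtain ⟨B, hB⟩ := exists_tendsto_cauchyIntegral (Z := X →L[ℂ] AntiDual X) hδ hα (hc.mono hI)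
    (fun x hx => hcc x hx x₀ hmem)
  have hbd : ∀ (S : Set ℝ) (z : ℂ), z.im ≠ 0 → ∀ x, ‖S.indicator (fun x : ℝ => ((x : ℂ) - z)⁻¹) x‖ ≤
      |z.im|⁻¹ := by
    intro S z hz x
    exact (norm_indicator_le_norm_self _ _).trans (norm_resolventFun_le hz x)
  have hex : ∀ S : Set ℝ, MeasurableSet S → ∀ z : ℂ, ∃ T : 𝓗 →L[ℂ] 𝓗, ∀ φ,
      E.HasIntegral (S.indicator fun x : ℝ => ((x : ℂ) - z)⁻¹) φ (T φ) ∨ z.im = 0 := by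
    intro S hS z
    by_cases hz : z.im = 0
    · exact ⟨0, fun _ => Or.inr hz⟩
    · exact ⟨E.boundedOp _ ((measurable_resolventFun z).indicator hS) _ (hbd S z hz),
        fun φ => Or.inl (PVM.hasIntegral_boundedOp E _ _ φ)⟩
  choose T hT using hex (Ico (x₀ - δ) (x₀ + δ))ᶜ measurableSet_Ico.compl
  choose S hS using hex (Ico (x₀ - δ) (x₀ + δ)) measurableSet_Ico
  obtain ⟨T₀, hT₀⟩ := tendsto_boundedOp_compl E hδ hT
  have hcontX : Continuous (asXDual ι) := by
    unfold asXDual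
    fun_prop
  refine ⟨B + asXDual ι T₀, fun s hs => ?_⟩
  have h1 := tendsto_add_of_tendsto (Z := X →L[ℂ] AntiDual X) (hB s hs)
    ((hcontX.tendsto T₀).comp (hT₀ s hs))
  have hcomm : B + asXDual ι T₀ + (s * Real.pi * Complex.I : ℂ) • A x₀ =
      B + (s * Real.pi * Complex.I : ℂ) • A x₀ + asXDual ι T₀ := by
    ext f g
    simp only [add_apply, smul_apply]
    ring
  rw [hcomm]
  refine h1.congr' ?_
  filter_upwards [self_mem_nhdsWithin] with ε hε
  have hε' : (0 : ℝ) < ε := hε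
  have hz : (x₀ + s * ε * Complex.I : ℂ).im ≠ 0 := by
    rcases hs with rfl | rfl <;> simp [hε'.ne']
  have h2 : resolventOp H (x₀ + s * ε * Complex.I) =
      S (x₀ + s * ε * Complex.I) + T (x₀ + s * ε * Complex.I) := by
    ext φ
    refine (hasIntegral_resolventOp hH hz φ).unique ?_
    have h3 := ((hS _ φ).resolve_right hz).add ((hT _ φ).resolve_right hz)
    rwa [indicator_self_add_compl] at h3
  have hq : ContinuousOn (fun x : ℝ => ((x : ℂ) - (x₀ + s * ε * Complex.I))⁻¹)
      (Icc (x₀ - δ) (x₀ + δ)) :=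
    (Continuous.inv₀ (by fun_prop) (fun x => ofReal_sub_ne_zero hz x)).continuousOn
  rw [← asXDual_eq_integral hac hJ hA hc (by linarith) hI hq
    (fun φ => (hS (x₀ + s * ε * Complex.I) φ).resolve_right hz), h2]
  ext f g
  simp [asXDual_apply]

end

/-! ### Weak limits and compact operators -/

section
variable {Y : Type*} [NormedAddCommGroup Y] [InnerProductSpace ℂ Y] [CompleteSpace Y]

/-- Banach–Alaoglu and Riesz. Ultrafilters replace weakly convergent subsequences, so no
separability is required. -/
theorem exists_weak_limit {β : Type*} (U : Ultrafilter β) {u : β → Y} {r : ℝ}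
    (hu : ∀ᶠ i in (U : Filter β), ‖u i‖ ≤ r) :
    ∃ y : Y, ‖y‖ ≤ r ∧ ∀ k : Y, Tendsto (fun i => inner ℂ k (u i)) U (𝓝 (inner ℂ k y)) := by
  let D : Y → WeakDual ℂ Y := fun y => StrongDual.toWeakDual (InnerProductSpace.toDual ℂ Y y)
  have hcomp := WeakDual.isCompact_closedBall (𝕜 := ℂ) (E := Y) 0 r
  obtain ⟨w, hw, hlim⟩ := hcomp.ultrafilter_le_nhds (U.map fun i => D (u i)) (by
    rw [le_principal_iff]
    change ∀ᶠ i in (U : Filter β), _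
    filter_upwards [hu] with i hi
    change WeakDual.toStrongDual (D (u i)) ∈ Metric.closedBall 0 r
    rw [mem_closedBall_zero_iff]
    simpa [D] using hi)
  refine ⟨(InnerProductSpace.toDual ℂ Y).symm (WeakDual.toStrongDual w), ?_, fun k => ?_⟩
  · have : WeakDual.toStrongDual w ∈ Metric.closedBall 0 r := hw
    rw [mem_closedBall_zero_iff] at this
    simpa using this
  · have h1 : Tendsto (fun i => D (u i)) U (𝓝 w) := hlim
    have h2 := ((WeakDual.eval_continuous k).tendsto w).comp h1
    have h3 := (Complex.continuous_conj.tendsto _).comp h2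
    have h4 : (starRingEnd ℂ) (w k) =
        inner ℂ k ((InnerProductSpace.toDual ℂ Y).symm (WeakDual.toStrongDual w)) := by
      rw [← inner_conj_symm, InnerProductSpace.toDual_symm_apply]
      rfl
    rw [h4] at h3
    refine h3.congr fun i => ?_
    simp only [Function.comp_apply]
    rw [← inner_conj_symm k]
    rfl

/-- Weak limits are mapped to weak limits by bounded operators. -/
theorem eq_of_weak_limit {Z β : Type*} [NormedAddCommGroup Z] [NormedSpace ℂ Z] {l : Filter β}
    [l.NeBot] {u : β → Y} {y : Y}
    (hu : ∀ k : Y, Tendsto (fun i => inner ℂ k (u i)) l (𝓝 (inner ℂ k y))) (T : Y →L[ℂ] Z) {z : Z}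
    (hz : Tendsto (fun i => T (u i)) l (𝓝 z)) : T y = z := by
  rw [SeparatingDual.eq_iff_forall_dual_eq (R := ℂ)]
  intro ℓ
  have h1 := hu ((InnerProductSpace.toDual ℂ Y).symm (ℓ ∘L T))
  simp only [InnerProductSpace.toDual_symm_apply] at h1
  exact tendsto_nhds_unique h1 ((ℓ.continuous.tendsto z).comp hz)

/-- A bounded family in the Hilbert space Y has weak limits, and j maps them to the limit taken in
Z. So limits stay in the range of j with the same bound. -/
theorem exists_lift_of_tendsto {X Z β : Type*} [NormedAddCommGroup X] [NormedSpace ℂ X]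
    [NormedAddCommGroup Z] [NormedSpace ℂ Z] {l : Filter β} [l.NeBot] {j : Y →L[ℂ] Z}
    (hj : Function.Injective j) {T : β → X →L[ℂ] Y} {M : ℝ} (hT : ∀ᶠ i in l, ‖T i‖ ≤ M)
    {L : X →L[ℂ] Z} (hL : ∀ f, Tendsto (fun i => j (T i f)) l (𝓝 (L f))) :
    ∃ W : X →L[ℂ] Y, j ∘L W = L := by
  have hex : ∀ f : X, ∃ y : Y, ‖y‖ ≤ M * ‖f‖ ∧ j y = L f := by
    intro f
    have hle := Ultrafilter.of_le l
    obtain ⟨y, hy, hlim⟩ := exists_weak_limit (Ultrafilter.of l) (u := fun i => T i f)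
      (r := M * ‖f‖) (hle (by
        filter_upwards [hT] with i hi
        exact (T i).le_of_opNorm_le hi f))
    exact ⟨y, hy, eq_of_weak_limit hlim j ((hL f).mono_left hle)⟩
  choose W hW hjW using hex
  let W' : X →ₗ[ℂ] Y :=
    { toFun := W
      map_add' := fun f g => hj (by simp [hjW])
      map_smul' := fun c f => hj (by simp [hjW]) }
  refine ⟨W'.mkContinuous M hW, ?_⟩
  ext1 f
  exact hjW f

/-- Ehrling's inequality. -/
theorem IsCompactOperator.exists_norm_le {X Z : Type*} [NormedAddCommGroup X]
    [InnerProductSpace ℂ X] [CompleteSpace X] [NormedAddCommGroup Z] [NormedSpace ℂ Z]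
    {V : Y →L[ℂ] X} (hV : IsCompactOperator V) {j : Y →L[ℂ] Z}
    (hj : Function.Injective j) {η : ℝ} (hη : 0 < η) :
    ∃ C : ℝ, 0 ≤ C ∧ ∀ y, ‖V y‖ ≤ η * ‖y‖ + C * ‖j y‖ := by
  by_contra hcon
  push Not at hcon
  choose y hy using fun n : ℕ => hcon n n.cast_nonneg
  have hy0 : ∀ n, 0 < ‖y n‖ := by
    intro n
    rw [norm_pos_iff]
    intro h0
    simpa [h0] using hy n
  -- Normalized counterexamples satisfy ‖V u_n‖ ≥ η and j u_n → 0. Their weak limit vanishes by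
  -- injectivity of j, and compactness makes V u_n tend to 0 strongly along the ultrafilter.
  let u : ℕ → Y := fun n => (‖y n‖⁻¹ : ℂ) • y n
  have hcn : ∀ n, ‖(‖y n‖⁻¹ : ℂ)‖ = ‖y n‖⁻¹ := fun n => by simp
  have hu1 : ∀ n, ‖u n‖ = 1 := by
    intro n
    simp only [u, norm_smul, hcn]
    exact inv_mul_cancel₀ (hy0 n).ne'
  have hVu : ∀ n : ℕ, η + n * ‖j (u n)‖ ≤ ‖V (u n)‖ := by
    intro n
    simp only [u, map_smul, norm_smul, hcn]
    have h := mul_le_mul_of_nonneg_left (hy n).le (inv_nonneg.2 (hy0 n).le)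
    refine le_trans (le_of_eq ?_) h
    field_simp [(hy0 n).ne']
  have hju : Tendsto (fun n => j (u n)) atTop (𝓝 0) := by
    rw [tendsto_zero_iff_norm_tendsto_zero]
    refine squeeze_zero' (Eventually.of_forall fun _ => norm_nonneg _) ?_
      (tendsto_const_div_atTop_nhds_zero_nat ‖V‖)
    filter_upwards [eventually_gt_atTop 0] with n hn
    rw [le_div_iff₀ (by exact_mod_cast hn), mul_comm]
    have h1 := hVu n
    have h2 := V.le_opNorm (u n)
    rw [hu1, mul_one] at h2
    linarith
  let U : Ultrafilter ℕ := hyperfilter ℕ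
  have hU : (U : Filter ℕ) ≤ atTop := Nat.hyperfilter_le_atTop
  obtain ⟨w, -, hw⟩ := exists_weak_limit U (u := u) (r := 1)
    (Eventually.of_forall fun n => (hu1 n).le)
  have hw0 : w = 0 := hj (by rw [map_zero]; exact eq_of_weak_limit hw j (hju.mono_left hU))
  obtain ⟨K, hK, hVK⟩ := IsCompactOperator.image_closedBall_subset_compact (f := (V : Y →ₗ[ℂ] X)) hV 1
  obtain ⟨x, -, hx⟩ := hK.ultrafilter_le_nhds (U.map fun n => V (u n)) (by
    rw [le_principal_iff]
    change ∀ᶠ n in (U : Filter ℕ), _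
    exact Eventually.of_forall fun n => hVK ⟨u n, by simp [hu1], rfl⟩)
  have hx' : Tendsto (fun n => V (u n)) U (𝓝 x) := hx
  have hx0 : V w = x := eq_of_weak_limit hw V hx'
  have h3 := hx'.norm
  rw [← hx0, hw0, map_zero, norm_zero] at h3
  have h4 : η ≤ 0 := ge_of_tendsto h3 (Eventually.of_forall fun n =>
    le_trans (le_add_of_nonneg_right (by positivity)) (hVu n))
  linarith

/-- Norm convergence is known only after j, while V acts on Y. Ehrling's inequality bridges the gap:
its η-term absorbs the uniform bound in Y, and its other term tends to 0. -/
theorem tendsto_comp_of_isCompactOperator {X X' Z β : Type*} [NormedAddCommGroup X]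
    [InnerProductSpace ℂ X] [CompleteSpace X] [NormedAddCommGroup X'] [NormedSpace ℂ X']
    [NormedAddCommGroup Z] [NormedSpace ℂ Z]
    {V : Y →L[ℂ] X} (hV : IsCompactOperator V) {j : Y →L[ℂ] Z}
    (hj : Function.Injective j) {l : Filter β} {T : β → X' →L[ℂ] Y} {W : X' →L[ℂ] Y} {M : ℝ}
    (hT : ∀ᶠ i in l, ‖T i‖ ≤ M) (hL : Tendsto (fun i => ‖j ∘L (T i - W)‖) l (𝓝 0)) :
    Tendsto (fun i => V ∘L T i) l (𝓝 (V ∘L W)) := by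
  rw [tendsto_iff_norm_sub_tendsto_zero, Metric.tendsto_nhds]
  intro e he
  have hM : 0 < |M| + ‖W‖ + 1 := by positivity
  obtain ⟨C, hC0, hC⟩ := hV.exists_norm_le hj (η := e / 4 / (|M| + ‖W‖ + 1)) (by positivity)
  have h1 : ∀ᶠ i in l, C * ‖j ∘L (T i - W)‖ < e / 4 := by
    have := hL.const_mul C
    rw [mul_zero] at this
    exact this.eventually_lt_const (by positivity)
  filter_upwards [hT, h1] with i hi h1i
  rw [dist_zero_right, norm_norm]
  refine lt_of_le_of_lt (b := e / 2) ?_ (by linarith)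
  refine ContinuousLinearMap.opNorm_le_bound _ (by positivity) fun f => ?_
  rw [← ContinuousLinearMap.comp_sub, ContinuousLinearMap.comp_apply]
  refine (hC _).trans ?_
  have h2 : ‖(T i - W) f‖ ≤ (|M| + ‖W‖ + 1) * ‖f‖ := by
    refine ContinuousLinearMap.le_of_opNorm_le _ ((norm_sub_le _ _).trans ?_) f
    linarith [le_abs_self M]
  have h3 : ‖j ((T i - W) f)‖ ≤ ‖j ∘L (T i - W)‖ * ‖f‖ := (j ∘L (T i - W)).le_opNorm f
  calc e / 4 / (|M| + ‖W‖ + 1) * ‖(T i - W) f‖ + C * ‖j ((T i - W) f)‖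
      ≤ e / 4 / (|M| + ‖W‖ + 1) * ((|M| + ‖W‖ + 1) * ‖f‖) + C * (‖j ∘L (T i - W)‖ * ‖f‖) := by
        gcongr
    _ = e / 4 * ‖f‖ + C * ‖j ∘L (T i - W)‖ * ‖f‖ := by field_simp
    _ ≤ e / 4 * ‖f‖ + e / 4 * ‖f‖ := by gcongr
    _ = e / 2 * ‖f‖ := by ring

end

/-! ### Boundary behaviour of the resolvent of the perturbed operator -/

section
variable {𝓗 : Type*} [NormedAddCommGroup 𝓗] [InnerProductSpace ℂ 𝓗] [CompleteSpace 𝓗]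
  {X : Type*} [NormedAddCommGroup X] [InnerProductSpace ℂ X]
  {Y : Type*} [NormedAddCommGroup Y] [InnerProductSpace ℂ Y]
  {ι : X →L[ℂ] 𝓗} {j : Y →L[ℂ] AntiDual X} {H : 𝓗 →ₗ.[ℂ] 𝓗} {J : Set ℝ} {V : Y →L[ℂ] X}
  {A : ℝ → X →L[ℂ] AntiDual X}

/-- The left side has a boundary value, and the right side, for z = x + iε, is the quantity
ε‖R(z)g‖² that controls the spectral measure near x. -/
theorem im_asXDual_resolventOp (hH : IsSelfAdjoint H) {z : ℂ} (hz : z.im ≠ 0) (g : X) :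
    (asXDual ι (resolventOp H z) g g).im = z.im * ‖resolventOp H z (ι g)‖ ^ 2 := by
  have h1 := resolventOp_mem_graph hH hz (ι g)
  set u := resolventOp H z (ι g) with hu
  have h2 := hH.isSymmGraph _ h1 _ h1
  rw [asXDual_apply, ← hu]
  have h3 : (inner ℂ (ι g + z • u) u : ℂ).im = (inner ℂ u (ι g + z • u) : ℂ).im := by rw [h2]
  rw [inner_add_left, inner_add_right, inner_smul_left, inner_smul_right,
    ← inner_conj_symm u (ι g), inner_self_eq_norm_sq_to_K] at h3
  have h4 : ((‖u‖ : ℂ) ^ 2).im = 0 := by rw [← Complex.ofReal_pow]; exact Complex.ofReal_im _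
  have h5 : ((‖u‖ : ℂ) ^ 2).re = ‖u‖ ^ 2 := by rw [← Complex.ofReal_pow]; exact Complex.ofReal_re _
  simp only [Complex.add_im, Complex.mul_im, Complex.conj_im, Complex.conj_re, RCLike.ofReal_eq_complex_ofReal] at h3
  rw [h4, h5] at h3
  linarith

end

theorem tendsto_eval_antiDual {X β : Type*} [NormedAddCommGroup X] [InnerProductSpace ℂ X]
    {l : Filter β} {T : β → AntiDual X} {T₀ : AntiDual X} {g : β → X} {g₀ : X}
    (hT : Tendsto T l (𝓝 T₀)) (hg : Tendsto g l (𝓝 g₀)) :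
    Tendsto (fun i => T i (g i)) l (𝓝 (T₀ g₀)) := by
  have h1 : Tendsto (fun i => (T i - T₀) (g i)) l (𝓝 0) := by
    rw [tendsto_zero_iff_norm_tendsto_zero]
    have h2 := (tendsto_iff_norm_sub_tendsto_zero.1 hT).mul hg.norm
    rw [zero_mul] at h2
    exact squeeze_zero (fun _ => norm_nonneg _) (fun i => (T i - T₀).le_opNorm (g i)) h2
  have h3 := h1.add ((T₀.continuous.tendsto g₀).comp hg)
  simpa using h3

theorem tendsto_clm_apply {X Z β : Type*} [NormedAddCommGroup X] [NormedSpace ℂ X]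
    [NormedAddCommGroup Z] [NormedSpace ℂ Z]
    {l : Filter β} {T : β → X →L[ℂ] Z} {T₀ : X →L[ℂ] Z} {g : β → X} {g₀ : X}
    (hT : Tendsto T l (𝓝 T₀)) (hg : Tendsto g l (𝓝 g₀)) :
    Tendsto (fun i => T i (g i)) l (𝓝 (T₀ g₀)) :=
  (isBoundedBilinearMap_apply.continuous.tendsto (T₀, g₀)).comp (hT.prodMk_nhds hg)

theorem norm_form_apply_le {X : Type*} [NormedAddCommGroup X] [InnerProductSpace ℂ X]
    (T : X →L[ℂ] AntiDual X) (f g : X) : ‖T f g‖ ≤ ‖T‖ * ‖f‖ * ‖g‖ :=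
  ((T f).le_opNorm g).trans (mul_le_mul_of_nonneg_right (T.le_opNorm f) (norm_nonneg g))

section
variable {𝓗 : Type*} [NormedAddCommGroup 𝓗] [InnerProductSpace ℂ 𝓗] [CompleteSpace 𝓗]
  {X : Type*} [NormedAddCommGroup X] [InnerProductSpace ℂ X] [CompleteSpace X]
  {Y : Type*} [NormedAddCommGroup Y] [InnerProductSpace ℂ Y] [CompleteSpace Y]
  {ι : X →L[ℂ] 𝓗} {j : Y →L[ℂ] AntiDual X} {H : 𝓗 →ₗ.[ℂ] 𝓗} {J : Set ℝ} {V : Y →L[ℂ] X}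
  {A : ℝ → X →L[ℂ] AntiDual X}

omit [CompleteSpace 𝓗] in
/-- The resolvents `R(x₀ + iε)` converge, as maps into `X*_H` after composition with `V`. -/
theorem exists_limitResolvent (hj : Function.Injective j) (hY : IsAdapted ι j H J)
    (hV : IsCompactOperator V) {x₀ : ℝ} (hx₀ : x₀ ∈ J) {L : X →L[ℂ] AntiDual X}
    (hL : Tendsto (fun ε : ℝ => asXDual ι (resolventOp H (x₀ + ε * Complex.I))) (𝓝[>] 0) (𝓝 L)) :
    ∃ W : X →L[ℂ] Y, IsLimitResolvent ι j H 1 x₀ W ∧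
      Tendsto (fun ε : ℝ => V ∘L resolventY ι j H (x₀ + ε * Complex.I)) (𝓝[>] 0)
        (𝓝 (V ∘L W)) := by
  obtain ⟨M, -, δ, hδ, hM⟩ := exists_norm_resolventY_le hj hY hx₀
  have hT : ∀ᶠ ε : ℝ in 𝓝[>] 0, ‖resolventY ι j H (x₀ + ε * Complex.I)‖ ≤ M := by
    filter_upwards [Ioo_mem_nhdsGT hδ] with ε hε
    refine hM ε (abs_pos.2 hε.1.ne') ?_
    rw [abs_of_pos hε.1]
    exact hε.2
  have hjT : ∀ ε : ℝ, 0 < ε → j ∘L resolventY ι j H (x₀ + ε * Complex.I) =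
      asXDual ι (resolventOp H (x₀ + ε * Complex.I)) := by
    intro ε hε
    ext1 f
    exact j_resolventY hj hY (by simpa using hε.ne') f
  obtain ⟨W, hW⟩ := exists_lift_of_tendsto (l := 𝓝[>] (0 : ℝ)) hj hT (L := L) (fun f => by
    refine (tendsto_clm_apply hL (tendsto_const_nhds (x := f))).congr' ?_
    filter_upwards [self_mem_nhdsWithin] with ε hε
    rw [← hjT ε hε]
    rfl)
  refine ⟨W, ?_, tendsto_comp_of_isCompactOperator hV hj hT ?_⟩
  · rw [IsLimitResolvent, hW]
    simpa using hL
  · refine ((tendsto_iff_norm_sub_tendsto_zero (E := X →L[ℂ] AntiDual X)).1 hL).congr' ?_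
    filter_upwards [self_mem_nhdsWithin] with ε hε
    rw [← hjT ε hε, ← hW]
    congr 1
    ext f g
    simp

/-- With g_ε = (I + VR(x₀ + iε))⁻¹f, the left side is the imaginary part of the form of R(x₀ + iε)
at g_ε. Both the form and g_ε converge in norm, and the limit of g_ε has norm at most M‖f‖. -/
theorem eventually_resolvent_perturbed_lt (hι : Function.Injective ι) (hι_dense : DenseRange ι)
    (hj : Function.Injective j) (hH : IsSelfAdjoint H)
    (hac : (spectralMeasure H).acProj * (spectralMeasure H).proj J = (spectralMeasure H).proj J)
    (hJ : IsOpen J) (hA : IsSpectralDensity ι (spectralMeasure H) J A) (hc : ContinuousOn A J)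
    {α : ℝ} (hα : 0 < α)
    (hhol : ∀ K ⊆ J, IsCompact K → ∃ c : ℝ, ∀ x ∈ K, ∀ y ∈ K, ‖A x - A y‖ ≤ c * |x - y| ^ α)
    (hY : IsAdapted ι j H J) (hV : IsShortRange ι j H V) {M : ℝ}
    (hM : ∀ x ∈ J, ∀ s : ℝ, s = 1 ∨ s = -1 → ∀ W : X →L[ℂ] Y, IsLimitResolvent ι j H s x W →
      IsUnit (1 + V ∘L W) ∧ ‖Ring.inverse (1 + V ∘L W)‖ ≤ M)
    {x₀ : ℝ} (hx₀ : x₀ ∈ J) (f : X) {κ : ℝ}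
    (hκ : 2 * Real.pi * M ^ 2 * ‖A x₀‖ * ‖f‖ ^ 2 < κ) :
    ∀ᶠ ε : ℝ in 𝓝[>] 0,
      ε * ‖resolventOp (perturbed ι j H V) (x₀ + ε * Complex.I) (ι f)‖ ^ 2 < κ := by
  obtain ⟨B, hB⟩ := exists_tendsto_asXDual_resolvent hH hac hJ hA hc hα hhol hx₀
  set L := B + (Real.pi * Complex.I : ℂ) • A x₀ with hLdef
  have hL : Tendsto (fun ε : ℝ => asXDual ι (resolventOp H (x₀ + ε * Complex.I))) (𝓝[>] 0) (𝓝 L) := by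
    simpa using hB 1 (Or.inl rfl)
  obtain ⟨W, hW, hVW⟩ := exists_limitResolvent hj hY hV.compact hx₀ hL
  obtain ⟨hunit, hnorm⟩ := hM x₀ hx₀ 1 (Or.inl rfl) W hW
  set G : ℝ → X →L[ℂ] X :=
    fun ε => Ring.inverse (1 + V ∘L resolventY ι j H (x₀ + ε * Complex.I)) with hG
  set g₀ := Ring.inverse (1 + V ∘L W) f with hg₀
  have hg : Tendsto (fun ε => G ε f) (𝓝[>] 0) (𝓝 g₀) := by
    refine tendsto_clm_apply ?_ tendsto_const_nhds
    obtain ⟨w, hw⟩ := hunit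
    have h1 := NormedRing.inverse_continuousAt w
    rw [hw] at h1
    exact h1.tendsto.comp (tendsto_const_nhds.add hVW)
  have hform : Tendsto (fun ε : ℝ =>
      (asXDual ι (resolventOp H (x₀ + ε * Complex.I)) (G ε f) (G ε f)).im) (𝓝[>] 0)
      (𝓝 (L g₀ g₀).im) :=
    (Complex.continuous_im.tendsto _).comp (tendsto_eval_antiDual (tendsto_clm_apply hL hg) hg)
  -- The imaginary part of R^- is nonpositive, which bounds that of B by πA. Symmetry of B is not
  -- needed; the price is a factor 2.
  have hBle : (B g₀ g₀).im ≤ Real.pi * (A x₀ g₀ g₀).re := by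
    have h1 : Tendsto (fun ε : ℝ =>
        (asXDual ι (resolventOp H (x₀ + (-1 : ℝ) * ε * Complex.I)) g₀ g₀).im) (𝓝[>] 0)
        (𝓝 ((B + ((-1 : ℝ) * Real.pi * Complex.I : ℂ) • A x₀) g₀ g₀).im) :=
      (Complex.continuous_im.tendsto _).comp (tendsto_eval_antiDual
        (tendsto_clm_apply (hB (-1) (Or.inr rfl)) tendsto_const_nhds) tendsto_const_nhds)
    have h2 : ((B + ((-1 : ℝ) * Real.pi * Complex.I : ℂ) • A x₀) g₀ g₀).im ≤ 0 := by
      refine le_of_tendsto h1 ?_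
      filter_upwards [self_mem_nhdsWithin] with ε hε
      have hε' : (0 : ℝ) < ε := hε
      rw [im_asXDual_resolventOp hH (by simpa using hε'.ne')]
      refine mul_nonpos_of_nonpos_of_nonneg ?_ (by positivity)
      simpa using hε'.le
    simp only [add_apply, smul_apply, smul_eq_mul, Complex.add_im, Complex.mul_im] at h2
    simp at h2
    linarith
  have hLle : (L g₀ g₀).im ≤ 2 * Real.pi * M ^ 2 * ‖A x₀‖ * ‖f‖ ^ 2 := by
    have h1 : (L g₀ g₀).im = (B g₀ g₀).im + Real.pi * (A x₀ g₀ g₀).re := by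
      simp [hLdef, Complex.mul_im]
    have h2 : (A x₀ g₀ g₀).re ≤ ‖A x₀‖ * ‖g₀‖ * ‖g₀‖ :=
      (Complex.re_le_norm _).trans (norm_form_apply_le _ _ _)
    have h3 : ‖g₀‖ ≤ M * ‖f‖ := ContinuousLinearMap.le_of_opNorm_le _ hnorm f
    have hMf : 0 ≤ M * ‖f‖ := (norm_nonneg _).trans h3
    have h4 : ‖A x₀‖ * ‖g₀‖ * ‖g₀‖ ≤ ‖A x₀‖ * (M * ‖f‖) * (M * ‖f‖) :=
      mul_le_mul (mul_le_mul_of_nonneg_left h3 (ContinuousLinearMap.opNorm_nonneg _)) h3 (norm_nonneg _)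
        (mul_nonneg (ContinuousLinearMap.opNorm_nonneg _) hMf)
    have h5 : Real.pi * (A x₀ g₀ g₀).re ≤ Real.pi * (‖A x₀‖ * (M * ‖f‖) * (M * ‖f‖)) :=
      mul_le_mul_of_nonneg_left (h2.trans h4) Real.pi_pos.le
    rw [h1]
    linarith
  filter_upwards [hform.eventually_lt_const (hLle.trans_lt hκ), self_mem_nhdsWithin] with ε h1 hε
  have hε' : (0 : ℝ) < ε := hε
  have hz : (x₀ + ε * Complex.I : ℂ).im ≠ 0 := by simpa using hε'.ne'
  rw [im_asXDual_resolventOp hH hz] at h1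
  rw [resolventOp_perturbed hι hι_dense hj hH hY hV hz f]
  simpa using h1

end

/-! ### Comparison of a measure with Lebesgue measure -/

/-- A Besicovitch covering argument: control of arbitrarily small balls centred at each point of S
already bounds the measure of S. -/
theorem measure_le_of_closedBall_le {ρ : Measure ℝ} [IsFiniteMeasure ρ] {c : ℝ} {S : Set ℝ}
    (h : ∀ x ∈ S, ∃ᶠ r in 𝓝[>] (0 : ℝ),
      ρ (Metric.closedBall x r) ≤ ENNReal.ofReal c * volume (Metric.closedBall x r)) :
    ρ S ≤ ENNReal.ofReal c * volume S := by
  have : IsLocallyFiniteMeasure (ENNReal.ofReal c • (volume : Measure ℝ)) :=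
    inferInstanceAs (IsLocallyFiniteMeasure (Real.toNNReal c • (volume : Measure ℝ)))
  have h1 := VitaliFamily.measure_le_of_frequently_le (v := Besicovitch.vitaliFamily ρ)
    (ENNReal.ofReal c • (volume : Measure ℝ)) (Measure.AbsolutelyContinuous.refl ρ) S
    (fun x hx => (Besicovitch.tendsto_filterAt ρ x).frequently (by simpa using h x hx))
  simpa using h1

theorem measure_le_lintegral_of_closedBall_le {ρ : Measure ℝ} [IsFiniteMeasure ρ] {k : ℝ → ℝ}
    (hk : Measurable k) {J : Set ℝ} (hk0 : ∀ x ∈ J, 0 ≤ k x)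
    (h : ∀ x ∈ J, ∀ κ > k x, ∃ᶠ r in 𝓝[>] (0 : ℝ),
      ρ (Metric.closedBall x r) ≤ ENNReal.ofReal κ * volume (Metric.closedBall x r))
    {B : Set ℝ} (hB : MeasurableSet B) (hBJ : B ⊆ J) :
    ρ B ≤ ∫⁻ x in B, ENNReal.ofReal (k x) := by
  have hη : ∀ B : Set ℝ, MeasurableSet B → B ⊆ J → ∀ η : ℝ, 0 < η →
      ρ B ≤ (∫⁻ x in B, ENNReal.ofReal (k x)) + ENNReal.ofReal η * volume B := by
    intro B hB hBJ η hη
    -- Slice B by the level of k in steps of η. On slice i one has iη ≤ k < (i + 1)η, so the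
    -- constant (i + 1)η is admissible there and exceeds k by at most η.
    let F : ℝ → ℕ := fun x => ⌊k x / η⌋₊
    have hF : Measurable F := Nat.measurable_floor.comp (hk.div_const η)
    let P : ℕ → Set ℝ := fun i => B ∩ F ⁻¹' {i}
    have hP : ∀ i, MeasurableSet (P i) := fun i => hB.inter (hF (measurableSet_singleton i))
    have hPB : B = ⋃ i, P i := by
      ext x
      simp [P]
    have hPd : Pairwise (fun m n => Disjoint (P m) (P n)) := by
      intro m n hmn
      refine Set.disjoint_left.2 fun x hx hx' => hmn ?_
      exact (mem_singleton_iff.1 hx.2).symm.trans (mem_singleton_iff.1 hx'.2)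
    have hPle : ∀ i, ρ (P i) ≤ ∫⁻ x in P i, (ENNReal.ofReal (k x) + ENNReal.ofReal η) := by
      intro i
      have h1 : ρ (P i) ≤ ENNReal.ofReal ((i + 1) * η) * volume (P i) := by
        refine measure_le_of_closedBall_le fun x hx => h x (hBJ hx.1) _ ?_
        have h2 : ⌊k x / η⌋₊ = i := hx.2
        have h3 := Nat.lt_floor_add_one (k x / η)
        rw [h2, div_lt_iff₀ hη] at h3
        exact h3
      refine h1.trans ?_
      rw [← setLIntegral_const]
      refine setLIntegral_mono' (hP i) fun x hx => ?_
      have h2 : ⌊k x / η⌋₊ = i := hx.2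
      have hkx := hk0 x (hBJ hx.1)
      have h3 := Nat.floor_le (div_nonneg hkx hη.le)
      rw [h2, le_div_iff₀ hη] at h3
      rw [← ENNReal.ofReal_add hkx hη.le]
      refine ENNReal.ofReal_le_ofReal ?_
      linarith
    calc ρ B = ρ (⋃ i, P i) := by rw [← hPB]
      _ ≤ ∑' i, ρ (P i) := measure_iUnion_le _
      _ ≤ ∑' i, ∫⁻ x in P i, (ENNReal.ofReal (k x) + ENNReal.ofReal η) :=
          ENNReal.tsum_le_tsum hPle
      _ = ∫⁻ x in ⋃ i, P i, (ENNReal.ofReal (k x) + ENNReal.ofReal η) :=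
          (lintegral_iUnion hP hPd _).symm
      _ = (∫⁻ x in B, ENNReal.ofReal (k x)) + ENNReal.ofReal η * volume B := by
          rw [← hPB, lintegral_add_left hk.ennreal_ofReal, setLIntegral_const]
  -- The error η·volume(B) disappears as η ↓ 0 only when the volume is finite; the general case
  -- follows by exhaustion with bounded intervals.
  have hfin : ∀ B : Set ℝ, MeasurableSet B → B ⊆ J → volume B ≠ ∞ →
      ρ B ≤ ∫⁻ x in B, ENNReal.ofReal (k x) := by
    intro B hB hBJ hv
    have hlim : Tendsto (fun η : ℝ => (∫⁻ x in B, ENNReal.ofReal (k x)) +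
        ENNReal.ofReal η * volume B) (𝓝[>] 0) (𝓝 ((∫⁻ x in B, ENNReal.ofReal (k x)) + 0)) := by
      refine tendsto_const_nhds.add ?_
      have h1 : Tendsto (fun η : ℝ => ENNReal.ofReal η) (𝓝[>] 0) (𝓝 0) := by
        have := (ENNReal.continuous_ofReal.tendsto 0).mono_left (nhdsWithin_le_nhds (s := Ioi 0))
        simpa using this
      have h2 := ENNReal.Tendsto.mul_const h1 (Or.inr hv)
      simpa using h2
    rw [add_zero] at hlim
    refine ge_of_tendsto hlim ?_
    filter_upwards [self_mem_nhdsWithin] with η hη'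
    exact hη B hB hBJ η hη'
  have hmono : Monotone fun n : ℕ => B ∩ Icc (-(n : ℝ)) n := by
    intro m n hmn
    refine inter_subset_inter_right _ (Icc_subset_Icc ?_ ?_)
    · exact neg_le_neg (by exact_mod_cast hmn)
    · exact_mod_cast hmn
  have hU : B = ⋃ n : ℕ, B ∩ Icc (-(n : ℝ)) n := by
    rw [← inter_iUnion, eq_comm, inter_eq_left]
    intro x _
    obtain ⟨n, hn⟩ := exists_nat_ge |x|
    exact mem_iUnion.2 ⟨n, abs_le.1 hn⟩
  conv_lhs => rw [hU]
  rw [hmono.measure_iUnion]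
  refine iSup_le fun n => ?_
  refine (hfin _ (hB.inter measurableSet_Icc) (inter_subset_left.trans hBJ) ?_).trans
    (lintegral_mono_set inter_subset_left)
  exact ((measure_mono inter_subset_right).trans_lt measure_Icc_lt_top).ne

theorem continuousOn_norm_comp {Z : Type*} [NormedAddCommGroup Z] {A : ℝ → Z} {J : Set ℝ}
    (hc : ContinuousOn A J) : ContinuousOn (fun x => ‖A x‖) J :=
  hc.norm

/-! ### Domination of the perturbed spectral measures by the unperturbed density -/

section
variable {𝓗 : Type*} [NormedAddCommGroup 𝓗] [InnerProductSpace ℂ 𝓗] [CompleteSpace 𝓗]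
  {X : Type*} [NormedAddCommGroup X] [InnerProductSpace ℂ X] [CompleteSpace X]
  {Y : Type*} [NormedAddCommGroup Y] [InnerProductSpace ℂ Y] [CompleteSpace Y]
  {ι : X →L[ℂ] 𝓗} {j : Y →L[ℂ] AntiDual X} {H : 𝓗 →ₗ.[ℂ] 𝓗} {J : Set ℝ} {V : Y →L[ℂ] X}
  {A : ℝ → X →L[ℂ] AntiDual X}

omit [CompleteSpace X] [NormedAddCommGroup X] [InnerProductSpace ℂ X] in
-- For |t - x| ≤ ε one has |t - x - iε|⁻² ≥ 1/(2ε²), so the measure of the ball is at most 2ε²‖R(x +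
-- iε)φ‖² ≤ 2εκ, and 2ε is the length of the ball.
theorem scalarMeasure_closedBall_le (hH : IsSelfAdjoint H) (φ : 𝓗) (x : ℝ) {ε κ : ℝ} (hε : 0 < ε)
    (h : ε * ‖resolventOp H (x + ε * Complex.I) φ‖ ^ 2 ≤ κ) :
    (spectralMeasure H).scalarMeasure φ (Metric.closedBall x ε) ≤
      ENNReal.ofReal κ * volume (Metric.closedBall x ε) := by
  have hz : (x + ε * Complex.I : ℂ).im ≠ 0 := by simpa using hε.ne'
  set μ := (spectralMeasure H).scalarMeasure φ
  have h1 := (hasIntegral_resolventOp hH hz φ).enorm_sq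
  have h2 : ENNReal.ofReal (2 * ε ^ 2)⁻¹ * μ (Metric.closedBall x ε) ≤
      ENNReal.ofReal (‖resolventOp H (x + ε * Complex.I) φ‖ ^ 2) := by
    rw [← ofReal_norm, ← ENNReal.ofReal_pow (norm_nonneg _)] at h1
    rw [h1, ← setLIntegral_const]
    refine le_trans (setLIntegral_mono' Metric.isClosed_closedBall.measurableSet fun t ht => ?_)
      (setLIntegral_le_lintegral _ _)
    rw [← ofReal_norm, ← ENNReal.ofReal_pow (norm_nonneg _)]
    refine ENNReal.ofReal_le_ofReal ?_
    rw [norm_inv, inv_pow, ← Complex.normSq_eq_norm_sq]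
    have h3 : Complex.normSq ((t : ℂ) - (x + ε * Complex.I)) = (t - x) ^ 2 + ε ^ 2 := by
      rw [Complex.normSq_apply]
      simp
      ring
    rw [h3]
    have h4 : (t - x) ^ 2 ≤ ε ^ 2 := by
      rw [Metric.mem_closedBall, Real.dist_eq] at ht
      exact sq_le_sq' (abs_le.1 ht).1 (abs_le.1 ht).2
    exact inv_anti₀ (by positivity) (by linarith)
  rw [Real.volume_closedBall, ← ENNReal.ofReal_mul' (by positivity)]
  have h5 : μ (Metric.closedBall x ε) = ENNReal.ofReal (2 * ε ^ 2) *
      (ENNReal.ofReal (2 * ε ^ 2)⁻¹ * μ (Metric.closedBall x ε)) := by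
    rw [← mul_assoc, ← ENNReal.ofReal_mul (by positivity), mul_inv_cancel₀ (by positivity),
      ENNReal.ofReal_one, one_mul]
  rw [h5]
  refine (mul_le_mul_right h2 _).trans ?_
  rw [← ENNReal.ofReal_mul (by positivity)]
  refine ENNReal.ofReal_le_ofReal ?_
  nlinarith

/-- The spectral measures of the perturbed operator are dominated, over `J`, by the spectral
density of the unperturbed one. -/
theorem scalarMeasure_perturbed_le (hι : Function.Injective ι) (hι_dense : DenseRange ι)
    (hj : Function.Injective j) (hH : IsSelfAdjoint H)
    (hac : (spectralMeasure H).acProj * (spectralMeasure H).proj J = (spectralMeasure H).proj J)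
    (hJ : IsOpen J) (hA : IsSpectralDensity ι (spectralMeasure H) J A) (hc : ContinuousOn A J)
    {α : ℝ} (hα : 0 < α)
    (hhol : ∀ K ⊆ J, IsCompact K → ∃ c : ℝ, ∀ x ∈ K, ∀ y ∈ K, ‖A x - A y‖ ≤ c * |x - y| ^ α)
    (hY : IsAdapted ι j H J) (hV : IsShortRange ι j H V) {M : ℝ}
    (hM : ∀ x ∈ J, ∀ s : ℝ, s = 1 ∨ s = -1 → ∀ W : X →L[ℂ] Y, IsLimitResolvent ι j H s x W →
      IsUnit (1 + V ∘L W) ∧ ‖Ring.inverse (1 + V ∘L W)‖ ≤ M)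
    (f : X) {B : Set ℝ} (hB : MeasurableSet B) (hBJ : B ⊆ J) :
    (spectralMeasure (perturbed ι j H V)).scalarMeasure (ι f) B ≤
      ∫⁻ x in B, ENNReal.ofReal (2 * Real.pi * M ^ 2 * ‖A x‖ * ‖f‖ ^ 2) := by
  have hn : ContinuousOn (fun x => ‖A x‖) J := continuousOn_norm_comp (Z := X →L[ℂ] AntiDual X) hc
  have hk : Measurable (J.indicator fun x => 2 * Real.pi * M ^ 2 * ‖A x‖ * ‖f‖ ^ 2) := by
    classical
    exact ContinuousOn.measurable_piecewise ((continuousOn_const.mul hn).mul continuousOn_const)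
      continuous_zero.continuousOn hJ.measurableSet
  have h1 := measure_le_lintegral_of_closedBall_le
    (ρ := (spectralMeasure (perturbed ι j H V)).scalarMeasure (ι f)) hk (J := J)
    (fun x hx => by rw [indicator_of_mem hx]; positivity)
    (fun x hx κ hκ => by
      rw [indicator_of_mem hx] at hκ
      refine Eventually.frequently ?_
      filter_upwards [self_mem_nhdsWithin, eventually_resolvent_perturbed_lt hι hι_dense hj hH hac
        hJ hA hc hα hhol hY hV hM hx f hκ] with ε hε h
      exact scalarMeasure_closedBall_le (isSelfAdjoint_perturbed hι hι_dense hj hH hY hV) _ _ hε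
        h.le) hB hBJ
  refine h1.trans (le_of_eq (setLIntegral_congr_fun hB fun x hx => ?_))
  simp only [indicator_of_mem (hBJ hx)]

end

/-! ### Consequences of a smoothing estimate for the spectral density -/

theorem measurable_indicator_of_continuousOn {Z : Type*} [TopologicalSpace Z] [Zero Z]
    [TopologicalSpace.PseudoMetrizableSpace Z] [MeasurableSpace Z] [BorelSpace Z]
    {U : Set ℝ} {g : ℝ → Z} (hU : MeasurableSet U) (hg : ContinuousOn g U) :
    Measurable (U.indicator g) := by
  classical
  exact ContinuousOn.measurable_piecewise hg continuous_const.continuousOn hU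

theorem measurable_indicator_of_continuousOn_diff {Z : Type*} [TopologicalSpace Z] [Zero Z]
    [TopologicalSpace.PseudoMetrizableSpace Z] [MeasurableSpace Z] [BorelSpace Z]
    {J : Set ℝ} {N : Finset ℝ} {g : ℝ → Z} (hJ : IsOpen J) (hg : ContinuousOn g (J \ N)) :
    Measurable (J.indicator g) := by
  have h1 := measurable_indicator_of_continuousOn
    (hJ.measurableSet.diff N.finite_toSet.measurableSet) hg
  refine h1.measurable_of_countable_ne (N.countable_toSet.mono fun x hx => ?_)
  by_contra hxN
  refine hx ?_
  by_cases hxJ : x ∈ J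
  · rw [indicator_of_mem hxJ, indicator_of_mem (show x ∈ J \ (N : Set ℝ) from ⟨hxJ, hxN⟩)]
  · rw [indicator_of_notMem hxJ, indicator_of_notMem fun h => hxJ h.1]

namespace IsAdmissiblePair

variable {J : Set ℝ} {N : Finset ℝ} {σ a : ℝ → ℝ}

theorem isOpen_diff (_h : IsAdmissiblePair J N σ a) (hJ : IsOpen J) : IsOpen (J \ (N : Set ℝ)) :=
  hJ.sdiff N.finite_toSet.isClosed

theorem differentiableAt (h : IsAdmissiblePair J N σ a) (hJ : IsOpen J) {x : ℝ}
    (hx : x ∈ J \ (N : Set ℝ)) : DifferentiableAt ℝ a x :=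
  (h.contDiffOn.differentiableOn (by norm_num)).differentiableAt
    ((h.isOpen_diff hJ).mem_nhds hx)

theorem continuousOn_deriv (h : IsAdmissiblePair J N σ a) (hJ : IsOpen J) :
    ContinuousOn (deriv a) (J \ N) :=
  h.contDiffOn.continuousOn_deriv_of_isOpen (h.isOpen_diff hJ) le_rfl

theorem measurable_indicator_exp (h : IsAdmissiblePair J N σ a) (hJ : IsOpen J) (t : ℝ) :
    Measurable (J.indicator fun x => (σ x : ℂ) * Complex.exp (Complex.I * t * a x)) := by
  refine measurable_indicator_of_continuousOn_diff (N := N) hJ ?_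
  have h1 : ContinuousOn σ (J \ N) := h.continuousOn.mono sdiff_subset
  have h2 : ContinuousOn a (J \ N) := h.contDiffOn.continuousOn
  fun_prop

end IsAdmissiblePair

theorem norm_exp_I_mul_mul (t x : ℝ) : ‖Complex.exp (Complex.I * t * x)‖ = 1 := by
  rw [show Complex.I * t * x = ((t * x : ℝ) : ℂ) * Complex.I by push_cast; ring,
    Complex.norm_exp_ofReal_mul_I]

section
variable {𝓗 : Type*} [NormedAddCommGroup 𝓗] [InnerProductSpace ℂ 𝓗] [CompleteSpace 𝓗]
  {X : Type*} [NormedAddCommGroup X] [InnerProductSpace ℂ X]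
  {ι : X →L[ℂ] 𝓗} {H : 𝓗 →ₗ.[ℂ] 𝓗} {J : Set ℝ} {A : ℝ → X →L[ℂ] AntiDual X}
  {N : Finset ℝ} {σ a : ℝ → ℝ}

theorem hasIntegral_evolution (h : IsAdmissiblePair J N σ a) (hJ : IsOpen J) {φ : 𝓗}
    (hφ : MemLp (J.indicator σ) 2 ((spectralMeasure H).scalarMeasure φ)) (t : ℝ) :
    (spectralMeasure H).HasIntegral
      (J.indicator fun x => (σ x : ℂ) * Complex.exp (Complex.I * t * a x)) φ
      (evolution H J σ a t φ) := by
  refine PVM.hasIntegral_integral (hφ.of_le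
    (h.measurable_indicator_exp hJ t).aestronglyMeasurable (ae_of_all _ fun x => ?_))
  by_cases hx : x ∈ J
  · rw [indicator_of_mem hx, indicator_of_mem hx, norm_mul, norm_exp_I_mul_mul, mul_one,
      Complex.norm_real]
  · simp [indicator_of_notMem hx]

theorem memLp_indicator_proj (E : PVM 𝓗) {g : ℝ → ℝ} (hg : Measurable g) {B : Set ℝ}
    (hB : MeasurableSet B) {C : ℝ} (hC : ∀ x ∈ B, ‖g x‖ ≤ C) (φ : 𝓗) :
    MemLp g 2 (E.scalarMeasure (E.proj B φ)) := by
  refine MemLp.of_bound hg.aestronglyMeasurable C ?_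
  have h0 : E.scalarMeasure (E.proj B φ) Bᶜ = 0 := by
    rw [E.scalarMeasure_apply _ hB.compl, E.proj_proj hB.compl hB, compl_inter_self, E.proj_empty]
    simp
  have h1 : ∀ᵐ x ∂(E.scalarMeasure (E.proj B φ)), x ∈ B := h0
  filter_upwards [h1] with x hx using hC x hx

theorem inner_evolution_proj_Ico (h : IsAdmissiblePair J N σ a)
    (hac : (spectralMeasure H).acProj * (spectralMeasure H).proj J = (spectralMeasure H).proj J)
    (hJ : IsOpen J) (hA : IsSpectralDensity ι (spectralMeasure H) J A) (hc : ContinuousOn A J)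
    {b c : ℝ} (hbc : b ≤ c) (hI : Icc b c ⊆ J \ N) (f : X) (t : ℝ)
    (hm : MemLp (J.indicator σ) 2
      ((spectralMeasure H).scalarMeasure ((spectralMeasure H).proj (Ico b c) (ι f)))) :
    inner ℂ (ι f) (evolution H J σ a t ((spectralMeasure H).proj (Ico b c) (ι f))) =
      ∫ x in b..c, (σ x : ℂ) * Complex.exp (Complex.I * t * a x) * A x f f := by
  refine inner_hasIntegral_Ico hac hJ hA hc hbc (hI.trans sdiff_subset) f ?_
  have h1 := (PVM.HasIntegral.indicator_one (E := spectralMeasure H)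
    (measurableSet_Ico (a := b) (b := c)) (ι f)).comp (hasIntegral_evolution h hJ hm t)
    (h.measurable_indicator_exp hJ t).aestronglyMeasurable
  convert h1 using 2 with x
  by_cases hx : x ∈ Ico b c
  · simp [hx, (hI (Ico_subset_Icc_self hx)).1]
  · simp [hx]

/-- For these times the phase changes by at most 1 across the interval, so after removing its value
at x₀ the real part of the exponential is at least 1/2. -/
theorem le_norm_inner_evolution (h : IsAdmissiblePair J N σ a)
    (hac : (spectralMeasure H).acProj * (spectralMeasure H).proj J = (spectralMeasure H).proj J)
    (hJ : IsOpen J) (hA : IsSpectralDensity ι (spectralMeasure H) J A) (hc : ContinuousOn A J)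
    {x₀ r s D ζ : ℝ} (hr : 0 < r) (hs : 0 ≤ s) (hI : Icc x₀ (x₀ + r) ⊆ J \ N) (hζ : |ζ| = 1)
    (hσ : ∀ x ∈ Icc x₀ (x₀ + r), s ≤ ζ * σ x) (ha : ∀ x ∈ Icc x₀ (x₀ + r), |deriv a x| ≤ D)
    (f : X) {t : ℝ} (ht : |t| * (D * r) ≤ 1)
    (hm : MemLp (J.indicator σ) 2
      ((spectralMeasure H).scalarMeasure ((spectralMeasure H).proj (Ico x₀ (x₀ + r)) (ι f)))) :
    s / 2 * ∫ x in x₀..(x₀ + r), (A x f f).re ≤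
      ‖inner ℂ (ι f) (evolution H J σ a t ((spectralMeasure H).proj (Ico x₀ (x₀ + r)) (ι f)))‖ := by
  have hle : x₀ ≤ x₀ + r := by linarith
  rw [inner_evolution_proj_Ico h hac hJ hA hc hle hI f t hm]
  set z := ∫ x in x₀..(x₀ + r), (σ x : ℂ) * Complex.exp (Complex.I * t * a x) * A x f f
  -- Unimodular factor that cancels the sign of σ and the phase at x₀.
  set w : ℂ := ζ * Complex.exp (Complex.I * t * (-a x₀ : ℝ)) with hw
  have hwn : ‖w‖ = 1 := by
    rw [hw, norm_mul, norm_exp_I_mul_mul, Complex.norm_real, Real.norm_eq_abs, hζ, one_mul]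
  have hq : ContinuousOn (fun x => A x f f) (uIcc x₀ (x₀ + r)) := by
    rw [uIcc_of_le hle]
    exact (continuousOn_density_apply hc f f).mono (hI.trans sdiff_subset)
  have hσc : ContinuousOn σ (uIcc x₀ (x₀ + r)) := by
    rw [uIcc_of_le hle]
    exact h.continuousOn.mono (hI.trans sdiff_subset)
  have hac' : ContinuousOn a (uIcc x₀ (x₀ + r)) := by
    rw [uIcc_of_le hle]
    exact h.contDiffOn.continuousOn.mono hI
  have hint : ContinuousOn (fun x => w * ((σ x : ℂ) * Complex.exp (Complex.I * t * a x) * A x f f))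
      (uIcc x₀ (x₀ + r)) := by fun_prop
  have h1 : (w * z).re = ∫ x in x₀..(x₀ + r),
      (w * ((σ x : ℂ) * Complex.exp (Complex.I * t * a x) * A x f f)).re := by
    rw [← intervalIntegral.integral_const_mul]
    exact (Complex.reCLM.intervalIntegral_comp_comm hint.intervalIntegrable).symm
  have h2 : s / 2 * ∫ x in x₀..(x₀ + r), (A x f f).re ≤ (w * z).re := by
    rw [h1, ← intervalIntegral.integral_const_mul]
    refine intervalIntegral.integral_mono_on hle ?_ ?_ fun x hx => ?_
    · exact (continuousOn_const.mul
        (Complex.continuous_re.comp_continuousOn hq)).intervalIntegrable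
    · exact (Complex.continuous_re.comp_continuousOn hint).intervalIntegrable
    · obtain ⟨hq0, hqr⟩ := density_self_nonneg hac hJ hA (hI hx).1 f
      set q := (A x f f).re
      have h3 : w * ((σ x : ℂ) * Complex.exp (Complex.I * t * a x) * A x f f) =
          ((ζ * σ x * q : ℝ) : ℂ) * Complex.exp ((t * (a x - a x₀) : ℝ) * Complex.I) := by
        rw [hqr, hw]
        have : ((t * (a x - a x₀) : ℝ) : ℂ) * Complex.I =
            Complex.I * t * (-a x₀ : ℝ) + Complex.I * t * a x := by push_cast; ring
        rw [this, Complex.exp_add]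
        push_cast
        ring
      rw [h3, Complex.re_ofReal_mul, Complex.exp_ofReal_mul_I_re]
      have h4 : |a x - a x₀| ≤ D * r := by
        have h5 := Convex.norm_image_sub_le_of_norm_deriv_le (f := a)
          (fun y hy => h.differentiableAt hJ (hI hy)) ha (convex_Icc x₀ (x₀ + r))
          (left_mem_Icc.2 hle) hx
        refine h5.trans (mul_le_mul_of_nonneg_left ?_ ((abs_nonneg _).trans (ha x hx)))
        rw [Real.norm_eq_abs, abs_of_nonneg (by linarith [hx.1])]
        linarith [hx.2]
      have h6 : |t * (a x - a x₀)| ≤ 1 := by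
        rw [abs_mul]
        exact (mul_le_mul_of_nonneg_left h4 (abs_nonneg t)).trans ht
      have h7 : 1 / 2 ≤ Real.cos (t * (a x - a x₀)) := by
        have h8 := Real.one_sub_sq_div_two_le_cos (x := t * (a x - a x₀))
        have h9 : (t * (a x - a x₀)) ^ 2 ≤ 1 := by
          rw [← sq_abs]
          exact pow_le_one₀ (abs_nonneg _) h6
        linarith
      calc s / 2 * q = s * q * (1 / 2) := by ring
        _ ≤ ζ * σ x * q * Real.cos (t * (a x - a x₀)) := by
          have h8 := hσ x hx
          exact mul_le_mul (mul_le_mul_of_nonneg_right h8 hq0) h7 (by norm_num)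
            (mul_nonneg (hs.trans h8) hq0)
  refine h2.trans ((Complex.re_le_norm _).trans ?_)
  rw [norm_mul, hwn, one_mul]

/-- Test the estimate on φ = E([x₀, x₀ + r))f and put Q = ‖φ‖². For |t| ≤ 1/(Dr) the pairing with f
is at least sQ/2, so (2/(Dr))(sQ/2)² ≤ ‖f‖²C₀²Q. Cancel one Q, then use Q ≥ rp to cancel r. -/
theorem density_le_of_smoothing_of_bounds (h : IsAdmissiblePair J N σ a)
    (hac : (spectralMeasure H).acProj * (spectralMeasure H).proj J = (spectralMeasure H).proj J)
    (hJ : IsOpen J) (hA : IsSpectralDensity ι (spectralMeasure H) J A) (hc : ContinuousOn A J)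
    {C₀ : ℝ} (hS : SmoothingEstimate ι H J σ a C₀)
    {x₀ r s D p ζ : ℝ} (hr : 0 < r) (hs : 0 ≤ s) (hD : 0 < D) (hp : 0 < p)
    (hI : Icc x₀ (x₀ + r) ⊆ J \ N) (hζ : |ζ| = 1)
    (hσ : ∀ x ∈ Icc x₀ (x₀ + r), s ≤ ζ * σ x) (ha : ∀ x ∈ Icc x₀ (x₀ + r), |deriv a x| ≤ D)
    (f : X) (hf : ∀ x ∈ Icc x₀ (x₀ + r), p ≤ (A x f f).re) :
    s ^ 2 * p ≤ 2 * D * C₀ ^ 2 * ‖f‖ ^ 2 := by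
  obtain ⟨S, hS1, hS2⟩ := hS
  set E := spectralMeasure H
  have hle : x₀ ≤ x₀ + r := by linarith
  set φ := E.proj (Ico x₀ (x₀ + r)) (ι f) with hφ
  set Q := ∫ x in x₀..(x₀ + r), (A x f f).re with hQ
  have hpQ : r * p ≤ Q := by
    have h1 : ∫ _ in x₀..(x₀ + r), p = r * p := by simp
    rw [← h1]
    refine intervalIntegral.integral_mono_on hle (by simp) ?_ hf
    refine ContinuousOn.intervalIntegrable ?_
    rw [uIcc_of_le hle]
    exact Complex.continuous_re.comp_continuousOn
      ((continuousOn_density_apply hc f f).mono (hI.trans sdiff_subset))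
  have hQ0 : 0 < Q := lt_of_lt_of_le (by positivity) hpQ
  have hφn : ‖φ‖ ^ 2 = Q := by
    have h1 := scalarMeasure_Ico hac hJ hA hc hle (hI.trans sdiff_subset) f
    rw [E.scalarMeasure_apply _ measurableSet_Ico,
      ENNReal.ofReal_eq_ofReal_iff (by positivity) hQ0.le] at h1
    exact h1
  obtain ⟨K, hK⟩ := isCompact_Icc.exists_bound_of_continuousOn
    (h.continuousOn.mono (hI.trans sdiff_subset))
  have hm : MemLp (J.indicator σ) 2 (E.scalarMeasure φ) := by
    refine memLp_indicator_proj E (measurable_indicator_of_continuousOn_diff (N := N) hJ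
      (h.continuousOn.mono sdiff_subset)) measurableSet_Ico (C := K) (fun x hx => ?_) _
    rw [indicator_of_mem (hI (Ico_subset_Icc_self hx)).1]
    exact hK x (Ico_subset_Icc_self hx)
  have hSφ := hS1 φ hm
  have hDr : 0 < D * r := by positivity
  have hpt : ∀ᵐ t : ℝ, t ∈ Icc (-(D * r)⁻¹) (D * r)⁻¹ →
      ENNReal.ofReal ((s / 2 * Q) ^ 2) ≤ ENNReal.ofReal (‖f‖ ^ 2) * ‖S φ t‖ₑ ^ 2 := by
    filter_upwards [hSφ] with t ht htI
    have h1 : |t| * (D * r) ≤ 1 := by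
      rw [← le_div_iff₀ hDr, one_div]
      exact abs_le.2 htI
    have h2 := le_norm_inner_evolution h hac hJ hA hc hr hs hI hζ hσ ha f h1 hm
    have h3 : ‖inner ℂ (ι f) (evolution H J σ a t φ)‖ ≤ ‖S φ t‖ * ‖f‖ := by
      rw [ht, ← toAntiDual_apply]
      exact (toAntiDual ι (evolution H J σ a t φ)).le_opNorm f
    rw [← ofReal_norm, ← ENNReal.ofReal_pow (norm_nonneg _),
      ← ENNReal.ofReal_mul (by positivity)]
    refine ENNReal.ofReal_le_ofReal ?_
    rw [← mul_pow, mul_comm ‖f‖]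
    exact pow_le_pow_left₀ (by positivity) (h2.trans h3) 2
  have hint : ENNReal.ofReal (2 * (D * r)⁻¹ * (s / 2 * Q) ^ 2) ≤
      ENNReal.ofReal (‖f‖ ^ 2 * (C₀ ^ 2 * Q)) := by
    have h1 : ‖S φ‖ₑ ^ 2 = ∫⁻ t, ‖S φ t‖ₑ ^ 2 := by
      rw [Lp.enorm_def, eLpNorm_two_sq]
    have h2 : ‖S φ‖ₑ ^ 2 ≤ ENNReal.ofReal (C₀ ^ 2 * Q) := by
      rw [← ofReal_norm, ← ENNReal.ofReal_pow (norm_nonneg _), ← hφn, ← mul_pow]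
      exact ENNReal.ofReal_le_ofReal (pow_le_pow_left₀ (norm_nonneg _) (hS2 φ) 2)
    have h3 : ENNReal.ofReal ((s / 2 * Q) ^ 2) * volume (Icc (-(D * r)⁻¹) (D * r)⁻¹) ≤
        ∫⁻ t in Icc (-(D * r)⁻¹) (D * r)⁻¹, ENNReal.ofReal (‖f‖ ^ 2) * ‖S φ t‖ₑ ^ 2 := by
      rw [← setLIntegral_const]
      exact setLIntegral_mono_ae' measurableSet_Icc hpt
    have h4 : ∫⁻ t in Icc (-(D * r)⁻¹) (D * r)⁻¹, ENNReal.ofReal (‖f‖ ^ 2) * ‖S φ t‖ₑ ^ 2 ≤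
        ENNReal.ofReal (‖f‖ ^ 2) * ENNReal.ofReal (C₀ ^ 2 * Q) := by
      refine (setLIntegral_le_lintegral _ _).trans ?_
      rw [lintegral_const_mul' _ _ ENNReal.ofReal_ne_top, ← h1]
      gcongr
    rw [Real.volume_Icc, ← ENNReal.ofReal_mul (by positivity)] at h3
    rw [← ENNReal.ofReal_mul (by positivity)] at h4
    refine le_trans (le_of_eq ?_) (h3.trans h4)
    congr 1
    ring
  rw [ENNReal.ofReal_le_ofReal_iff (by positivity)] at hint
  have h5 : s ^ 2 * Q ≤ 2 * D * C₀ ^ 2 * ‖f‖ ^ 2 * r := by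
    have h6 : 2 * (D * r)⁻¹ * (s / 2 * Q) ^ 2 = s ^ 2 * Q / (2 * D * r) * Q := by
      field_simp
    rw [h6, ← mul_assoc, mul_le_mul_iff_of_pos_right hQ0, div_le_iff₀ (by positivity)] at hint
    linarith
  have h7 : s ^ 2 * (r * p) ≤ 2 * D * C₀ ^ 2 * ‖f‖ ^ 2 * r :=
    (mul_le_mul_of_nonneg_left hpQ (by positivity)).trans h5
  rw [← mul_le_mul_iff_of_pos_right hr]
  linarith

theorem density_apply_le_of_smoothing (h : IsAdmissiblePair J N σ a)
    (hac : (spectralMeasure H).acProj * (spectralMeasure H).proj J = (spectralMeasure H).proj J)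
    (hJ : IsOpen J) (hA : IsSpectralDensity ι (spectralMeasure H) J A) (hc : ContinuousOn A J)
    {C₀ : ℝ} (hS : SmoothingEstimate ι H J σ a C₀) {x₀ : ℝ}
    (hx₀ : x₀ ∈ J \ (N : Set ℝ)) (f : X) :
    σ x₀ ^ 2 * (A x₀ f f).re ≤ 32 * C₀ ^ 2 * deriv a x₀ * ‖f‖ ^ 2 := by
  have hd := h.deriv_pos x₀ hx₀
  have hq0 := (density_self_nonneg hac hJ hA hx₀.1 f).1
  by_cases hσ0 : σ x₀ = 0
  · rw [hσ0]
    have : 0 ≤ 32 * C₀ ^ 2 * deriv a x₀ * ‖f‖ ^ 2 := by positivity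
    simpa using this
  rcases hq0.eq_or_lt with hq | hq
  · rw [← hq]
    have : 0 ≤ 32 * C₀ ^ 2 * deriv a x₀ * ‖f‖ ^ 2 := by positivity
    simpa using this
  obtain ⟨ζ, hζ, hζσ⟩ : ∃ ζ : ℝ, |ζ| = 1 ∧ ζ * σ x₀ = |σ x₀| := by
    rcases lt_or_gt_of_ne hσ0 with h1 | h1
    · exact ⟨-1, by simp, by rw [abs_of_neg h1]; ring⟩
    · exact ⟨1, by simp, by rw [abs_of_pos h1]; ring⟩
  have hU : J \ (N : Set ℝ) ∈ 𝓝 x₀ := (h.isOpen_diff hJ).mem_nhds hx₀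
  have e1 : ∀ᶠ x in 𝓝 x₀, |σ x₀| / 2 < ζ * σ x := by
    have h1 : ContinuousAt (fun x => ζ * σ x) x₀ :=
      continuousAt_const.mul (h.continuousOn.continuousAt (hJ.mem_nhds hx₀.1))
    refine h1.tendsto.eventually_const_lt ?_
    rw [hζσ]
    have := abs_pos.2 hσ0
    linarith
  have e2 : ∀ᶠ x in 𝓝 x₀, |deriv a x| < 2 * deriv a x₀ := by
    have h1 : ContinuousAt (fun x => |deriv a x|) x₀ :=
      ((h.continuousOn_deriv hJ).continuousAt hU).abs
    refine h1.tendsto.eventually_lt_const ?_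
    rw [abs_of_pos hd]
    linarith
  have e3 : ∀ᶠ x in 𝓝 x₀, (A x₀ f f).re / 2 < (A x f f).re := by
    have h1 : ContinuousAt (fun x => (A x f f).re) x₀ :=
      Complex.continuous_re.continuousAt.comp
        ((continuousOn_density_apply hc f f).continuousAt (hJ.mem_nhds hx₀.1))
    exact h1.tendsto.eventually_const_lt (by linarith)
  obtain ⟨δ, hδ, hball⟩ := Metric.eventually_nhds_iff.1 (e1.and (e2.and (e3.and hU)))
  have hmem : ∀ x ∈ Icc x₀ (x₀ + δ / 2), dist x x₀ < δ := by
    intro x hx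
    rw [Real.dist_eq, abs_of_nonneg (by linarith [hx.1])]
    linarith [hx.2]
  -- By continuity the bounds hold near x₀ with a factor 2 of slack each; the slack in σ², a' and
  -- the density turns the constant 2 into 2·4·2·2 = 32.
  have h9 := density_le_of_smoothing_of_bounds h hac hJ hA hc hS (r := δ / 2)
    (s := |σ x₀| / 2) (D := 2 * deriv a x₀) (p := (A x₀ f f).re / 2) (by positivity)
    (by positivity) (by positivity) (by positivity) (fun x hx => (hball (hmem x hx)).2.2.2) hζ
    (fun x hx => (hball (hmem x hx)).1.le) (fun x hx => (hball (hmem x hx)).2.1.le) f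
    (fun x hx => (hball (hmem x hx)).2.2.1.le)
  have h10 : (|σ x₀| / 2) ^ 2 = σ x₀ ^ 2 / 4 := by rw [div_pow, sq_abs]; norm_num
  rw [h10] at h9
  linarith

omit [CompleteSpace 𝓗] [NormedAddCommGroup 𝓗] [InnerProductSpace ℂ 𝓗] in
theorem norm_form_le {T : X →L[ℂ] AntiDual X} {c : ℝ} (hc : 0 ≤ c)
    (h : ∀ f, ‖T f f‖ ≤ c * ‖f‖ ^ 2) : ‖T‖ ≤ 2 * c := by
  have h1 : ∀ f g, ‖T f g‖ ≤ c * (‖f‖ ^ 2 + ‖g‖ ^ 2) := by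
    intro f g
    have e : (4 : ℂ) * T f g = T (f + g) (f + g) - T (f - g) (f - g) +
        Complex.I * T (f + Complex.I • g) (f + Complex.I • g) -
        Complex.I * T (f - Complex.I • g) (f - Complex.I • g) := by
      simp only [map_add, map_sub, map_smul, add_apply, sub_apply, smul_apply, smul_eq_mul,
        ContinuousLinearMap.map_smulₛₗ, Complex.conj_I]
      linear_combination (2 * T f g - 2 * T g f) * Complex.I_sq
    have p1 := parallelogram_law_with_norm ℂ f g
    have p2 := parallelogram_law_with_norm ℂ f (Complex.I • g)
    rw [norm_smul, Complex.norm_I, one_mul] at p2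
    have e1 : ‖(4 : ℂ) * T f g‖ ≤ c * ‖f + g‖ ^ 2 + c * ‖f - g‖ ^ 2 +
        c * ‖f + Complex.I • g‖ ^ 2 + c * ‖f - Complex.I • g‖ ^ 2 := by
      rw [e]
      refine (norm_sub_le _ _).trans (add_le_add ((norm_add_le _ _).trans (add_le_add
        ((norm_sub_le _ _).trans (add_le_add (h _) (h _))) ?_)) ?_)
      · rw [norm_mul, Complex.norm_I, one_mul]; exact h _
      · rw [norm_mul, Complex.norm_I, one_mul]; exact h _
    rw [norm_mul, show ‖(4 : ℂ)‖ = 4 by norm_num] at e1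
    have e2 : c * ‖f + g‖ ^ 2 + c * ‖f - g‖ ^ 2 + c * ‖f + Complex.I • g‖ ^ 2 +
        c * ‖f - Complex.I • g‖ ^ 2 = 4 * (c * (‖f‖ ^ 2 + ‖g‖ ^ 2)) := by
      linear_combination c * p1 + c * p2
    linarith
  refine ContinuousLinearMap.opNorm_le_bound _ (by positivity) fun f => ?_
  refine ContinuousLinearMap.opNorm_le_bound _ (by positivity) fun g => ?_
  by_cases hg : g = 0
  · simp [hg]
  by_cases hf : f = 0
  · simp [hf]
  have hg' : 0 < ‖g‖ := norm_pos_iff.2 hg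
  have hf' : 0 < ‖f‖ := norm_pos_iff.2 hf
  -- Rescaling g to the norm of f balances the two squares in c(‖f‖² + ‖g‖²) and gives 2c‖f‖‖g‖.
  have h2 := h1 f (((‖f‖ / ‖g‖ : ℝ) : ℂ) • g)
  rw [ContinuousLinearMap.map_smulₛₗ, Complex.conj_ofReal, norm_smul, norm_smul, Complex.norm_real,
    Real.norm_eq_abs, abs_of_pos (by positivity), div_mul_cancel₀ _ hg'.ne', div_mul_eq_mul_div,
    div_le_iff₀ hg'] at h2
  rw [← mul_le_mul_iff_of_pos_left hf']
  linarith

theorem norm_density_le_of_smoothing (h : IsAdmissiblePair J N σ a)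
    (hac : (spectralMeasure H).acProj * (spectralMeasure H).proj J = (spectralMeasure H).proj J)
    (hJ : IsOpen J) (hA : IsSpectralDensity ι (spectralMeasure H) J A) (hc : ContinuousOn A J)
    {C₀ : ℝ} (hS : SmoothingEstimate ι H J σ a C₀) {x₀ : ℝ}
    (hx₀ : x₀ ∈ J \ (N : Set ℝ)) :
    σ x₀ ^ 2 * ‖A x₀‖ ≤ 64 * C₀ ^ 2 * deriv a x₀ := by
  have hd := h.deriv_pos x₀ hx₀
  by_cases hσ0 : σ x₀ = 0
  · rw [hσ0]
    have : 0 ≤ 64 * C₀ ^ 2 * deriv a x₀ := by positivity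
    simpa using this
  have hσ : 0 < σ x₀ ^ 2 := by positivity
  have h1 : ‖A x₀‖ ≤ 2 * (32 * C₀ ^ 2 * deriv a x₀ / σ x₀ ^ 2) := by
    refine norm_form_le (by positivity) fun f => ?_
    obtain ⟨h0, hr⟩ := density_self_nonneg hac hJ hA hx₀.1 f
    rw [hr, Complex.norm_real, Real.norm_eq_abs, abs_of_nonneg h0, div_mul_eq_mul_div,
      le_div_iff₀ hσ, mul_comm]
    exact density_apply_le_of_smoothing h hac hJ hA hc hS hx₀ f
  have h2 := mul_le_mul_of_nonneg_left h1 hσ.le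
  refine h2.trans (le_of_eq ?_)
  field_simp
  ring

end

/-! ### The area formula for functions of bounded multiplicity -/

/-- On an interval inside U the function is strictly increasing. Intervals with rational endpoints
give a countable cover, which is then made disjoint. -/
theorem exists_injOn_partition {U : Set ℝ} (hU : IsOpen U) {f : ℝ → ℝ}
    (hf : ∀ x ∈ U, DifferentiableAt ℝ f x) (hpos : ∀ x ∈ U, 0 < deriv f x) :
    ∃ D : ℕ → Set ℝ, (∀ i, MeasurableSet (D i)) ∧ Pairwise (fun m n => Disjoint (D m) (D n)) ∧
      (∀ i, InjOn f (D i)) ∧ ⋃ i, D i = U := by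
  classical
  let P : ℚ × ℚ → Set ℝ := fun p => if Ioo (p.1 : ℝ) p.2 ⊆ U then Ioo (p.1 : ℝ) p.2 else ∅
  have hPU : ∀ p, P p ⊆ U := by
    intro p
    simp only [P]
    split_ifs with h
    · exact h
    · exact empty_subset _
  have hPm : ∀ p, MeasurableSet (P p) := by
    intro p
    simp only [P]
    split_ifs
    · exact measurableSet_Ioo
    · exact MeasurableSet.empty
  have hPinj : ∀ p, InjOn f (P p) := by
    intro p
    simp only [P]
    split_ifs with h
    · refine StrictMonoOn.injOn (strictMonoOn_of_deriv_pos (convex_Ioo _ _)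
        (fun x hx => (hf x (h hx)).continuousAt.continuousWithinAt) fun x hx => ?_)
      rw [interior_Ioo] at hx
      exact hpos x (h hx)
    · exact injOn_empty _
  obtain ⟨e, he⟩ := exists_surjective_nat (ℚ × ℚ)
  refine ⟨disjointed fun i => P (e i), fun i => MeasurableSet.disjointed (fun i => hPm (e i)) i,
    disjoint_disjointed _, fun i => (hPinj (e i)).mono (disjointed_subset _ i), ?_⟩
  rw [iUnion_disjointed]
  refine Subset.antisymm (iUnion_subset fun i => hPU (e i)) fun x hx => ?_
  obtain ⟨δ, hδ, hb⟩ := Metric.isOpen_iff.1 hU x hx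
  obtain ⟨p, hp1, hp2⟩ := exists_rat_btwn (show x - δ < x by linarith)
  obtain ⟨q, hq1, hq2⟩ := exists_rat_btwn (show x < x + δ by linarith)
  obtain ⟨i, hi⟩ := he (p, q)
  refine mem_iUnion.2 ⟨i, ?_⟩
  have hsub : Ioo (p : ℝ) q ⊆ U := fun y hy => hb (by
    rw [Metric.mem_ball, Real.dist_eq, abs_lt]
    constructor <;> linarith [hy.1, hy.2])
  simp only [hi, P, if_pos hsub]
  exact ⟨hp2, hq1⟩

theorem measurableSet_inter_preimage {U : Set ℝ} (hU : MeasurableSet U) {f : ℝ → ℝ}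
    (hf : ContinuousOn f U) {T : Set ℝ} (hT : MeasurableSet T) : MeasurableSet (U ∩ f ⁻¹' T) := by
  have h1 := hU.inter (measurable_indicator_of_continuousOn hU hf hT)
  convert h1 using 1
  ext x
  simp only [mem_inter_iff, mem_preimage, and_congr_right_iff]
  intro hx
  rw [indicator_of_mem hx]

/-- Change variables on each injective piece. Summing over the pieces, the integrand at η counts the
preimages of η in U, of which there are at most m. -/
theorem lintegral_deriv_preimage_le {U : Set ℝ} (hU : IsOpen U) {f : ℝ → ℝ}
    (hf : ∀ x ∈ U, DifferentiableAt ℝ f x) (hpos : ∀ x ∈ U, 0 < deriv f x) {m : ℕ}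
    (hm : ∀ η : ℝ, {x ∈ U | f x = η}.encard ≤ m) {T : Set ℝ} (hT : MeasurableSet T) :
    ∫⁻ x in U ∩ f ⁻¹' T, ENNReal.ofReal (deriv f x) ≤ m * volume T := by
  classical
  obtain ⟨D, hDm, hDd, hDi, hDU⟩ := exists_injOn_partition hU hf hpos
  have hDsub : ∀ i, D i ⊆ U := fun i => hDU ▸ subset_iUnion D i
  have hcont : ContinuousOn f U := fun x hx => (hf x hx).continuousAt.continuousWithinAt
  have him : ∀ i, MeasurableSet (f '' D i) := fun i =>
    (hDm i).image_of_continuousOn_injOn (hcont.mono (hDsub i)) (hDi i)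
  have hpiece : ∀ i, ∫⁻ x in D i, (f ⁻¹' T).indicator (fun x => ENNReal.ofReal (deriv f x)) x =
      ∫⁻ η in T, (f '' D i).indicator 1 η := by
    intro i
    have h1 := lintegral_image_eq_lintegral_abs_deriv_mul (hDm i)
      (fun x hx => (hf x (hDsub i hx)).hasDerivAt.hasDerivWithinAt) (hDi i)
      (T.indicator (1 : ℝ → ℝ≥0∞))
    have h2 : ∫⁻ η in T, (f '' D i).indicator 1 η = ∫⁻ x in f '' D i, T.indicator 1 x := by
      rw [lintegral_indicator_one (him i), lintegral_indicator_one hT,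
        Measure.restrict_apply (him i), Measure.restrict_apply hT, inter_comm]
    rw [h2, h1]
    refine setLIntegral_congr_fun (hDm i) fun x hx => ?_
    simp only [abs_of_pos (hpos x (hDsub i hx))]
    by_cases hxT : f x ∈ T
    · simp [hxT]
    · simp [hxT]
  have hset : ∫⁻ x in U ∩ f ⁻¹' T, ENNReal.ofReal (deriv f x) ≤
      ∫⁻ x in U, (f ⁻¹' T).indicator (fun x => ENNReal.ofReal (deriv f x)) x := by
    have h1 : ∫⁻ x in U ∩ f ⁻¹' T, ENNReal.ofReal (deriv f x) =
        ∫⁻ x in U ∩ f ⁻¹' T, (f ⁻¹' T).indicator (fun x => ENNReal.ofReal (deriv f x)) x := by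
      refine setLIntegral_congr_fun
        (measurableSet_inter_preimage hU.measurableSet hcont hT) fun x hx => ?_
      simp only [indicator_of_mem hx.2]
    rw [h1]
    exact lintegral_mono_set inter_subset_left
  refine hset.trans ?_
  conv_lhs => rw [← hDU]
  rw [lintegral_iUnion hDm hDd]
  simp_rw [hpiece]
  rw [← lintegral_tsum fun i => ((measurable_one.indicator (him i))).aemeasurable]
  rw [← setLIntegral_const]
  refine lintegral_mono fun η => ?_
  rw [ENNReal.tsum_eq_iSup_sum]
  refine iSup_le fun s => ?_
  have h1 : ∑ i ∈ s, (f '' D i).indicator (1 : ℝ → ℝ≥0∞) η = (s.filter fun i => η ∈ f '' D i).card := by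
    rw [Finset.card_filter]
    push_cast
    refine Finset.sum_congr rfl fun i _ => ?_
    by_cases hi : η ∈ f '' D i
    · rw [indicator_of_mem hi, if_pos hi]; rfl
    · rw [indicator_of_notMem hi, if_neg hi]
  rw [h1]
  set s' := s.filter fun i => η ∈ f '' D i
  -- One preimage is chosen in every piece whose image contains η; the pieces are disjoint, so these
  -- preimages are distinct points of a fibre.
  have hex : ∀ i ∈ s', ∃ x ∈ D i, f x = η := fun i hi => (Finset.mem_filter.1 hi).2
  choose! x hx using hex
  have hinj : InjOn x s' := by
    intro i hi k hk hik
    by_contra hne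
    exact Set.disjoint_left.1 (hDd hne) (hx i hi).1 (hik ▸ (hx k hk).1)
  have h2 : (x '' (s' : Set ℕ)).encard ≤ m := by
    refine (encard_le_encard ?_).trans (hm η)
    rintro _ ⟨i, hi, rfl⟩
    exact ⟨hDsub i (hx i hi).1, (hx i hi).2⟩
  rw [hinj.encard_image, encard_coe_eq_coe_finsetCard] at h2
  exact_mod_cast h2

/-! ### Orthogonality of exponentials with vector coefficients -/

theorem integral_exp_period {n : ℝ} (hn : 0 < n) (d : ℤ) :
    ∫ t in (-(Real.pi * n))..(Real.pi * n), Complex.exp (Complex.I * t * ((d : ℝ) / n : ℝ)) =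
      if d = 0 then ((2 * Real.pi * n : ℝ) : ℂ) else 0 := by
  split_ifs with hd
  · simp [hd]
    ring
  · have hc : Complex.I * (d / n) ≠ 0 := by
      have h1 : (n : ℂ) ≠ 0 := by exact_mod_cast hn.ne'
      have h2 : (d : ℂ) ≠ 0 := by exact_mod_cast hd
      exact mul_ne_zero Complex.I_ne_zero (div_ne_zero h2 h1)
    have h1 : ∀ t : ℝ, Complex.exp (Complex.I * t * ((d : ℝ) / n : ℝ)) =
        Complex.exp (Complex.I * (d / n) * t) := by
      intro t
      congr 1
      push_cast
      ring
    simp_rw [h1]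
    rw [integral_exp_mul_complex hc]
    have hn' : (n : ℂ) ≠ 0 := by exact_mod_cast hn.ne'
    have h2 : Complex.I * (d / n) * ((Real.pi * n : ℝ) : ℂ) =
        Complex.I * (d / n) * ((-(Real.pi * n) : ℝ) : ℂ) + d * (2 * Real.pi * Complex.I) := by
      push_cast
      field_simp
      ring
    rw [h2, Complex.exp_add, Complex.exp_int_mul_two_pi_mul_I, mul_one, sub_self, zero_div]

/-- Parseval with coefficients in an inner product space: the frequencies k/n share the period 2πn,
and distinct exponentials are orthogonal over it. -/
theorem integral_norm_sq_exp_sum {X : Type*} [NormedAddCommGroup X] [InnerProductSpace ℂ X]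
    {n : ℝ} (hn : 0 < n) (s : Finset ℤ) (x : ℤ → X) :
    ∫ t in (-(Real.pi * n))..(Real.pi * n),
      ‖∑ k ∈ s, Complex.exp (Complex.I * t * ((k : ℝ) / n : ℝ)) • x k‖ ^ 2 =
      2 * Real.pi * n * ∑ k ∈ s, ‖x k‖ ^ 2 := by
  have h1 : ∀ t : ℝ, ((‖∑ k ∈ s, Complex.exp (Complex.I * t * ((k : ℝ) / n : ℝ)) • x k‖ ^ 2 : ℝ) : ℂ) =
      ∑ k ∈ s, ∑ l ∈ s, Complex.exp (Complex.I * t * (((l - k : ℤ) : ℝ) / n : ℝ)) *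
        inner ℂ (x k) (x l) := by
    intro t
    push_cast
    have h0 := inner_self_eq_norm_sq_to_K (𝕜 := ℂ)
      (∑ k ∈ s, Complex.exp (Complex.I * t * ((k : ℝ) / n : ℝ)) • x k)
    simp only [Complex.coe_algebraMap] at h0
    push_cast at h0
    rw [← h0, sum_inner]
    refine Finset.sum_congr rfl fun k _ => ?_
    rw [inner_sum]
    refine Finset.sum_congr rfl fun l _ => ?_
    rw [inner_smul_left, inner_smul_right, ← Complex.exp_conj, ← mul_assoc, ← Complex.exp_add]
    congr 2
    simp
    ring
  have h2 : ((∫ t in (-(Real.pi * n))..(Real.pi * n),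
      ‖∑ k ∈ s, Complex.exp (Complex.I * t * ((k : ℝ) / n : ℝ)) • x k‖ ^ 2 : ℝ) : ℂ) =
      ((2 * Real.pi * n * ∑ k ∈ s, ‖x k‖ ^ 2 : ℝ) : ℂ) := by
    rw [← intervalIntegral.integral_ofReal]
    simp_rw [h1]
    have hci : ∀ k l : ℤ, IntervalIntegrable (fun t : ℝ =>
        Complex.exp (Complex.I * t * (((l - k : ℤ) : ℝ) / n : ℝ)) * inner ℂ (x k) (x l)) volume
        (-(Real.pi * n)) (Real.pi * n) := fun k l =>
      Continuous.intervalIntegrable (by fun_prop) _ _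
    rw [intervalIntegral.integral_finsetSum fun k _ => by
      exact Continuous.intervalIntegrable (by fun_prop) _ _]
    rw [Complex.ofReal_mul, Complex.ofReal_sum, Finset.mul_sum]
    refine Finset.sum_congr rfl fun k hk => ?_
    rw [intervalIntegral.integral_finsetSum fun l _ => hci k l]
    simp_rw [intervalIntegral.integral_mul_const, integral_exp_period hn]
    rw [Finset.sum_eq_single k]
    · rw [if_pos (sub_self k), inner_self_eq_norm_sq_to_K]
      push_cast
      rfl
    · intro l _ hl
      rw [if_neg (sub_ne_zero.2 hl), zero_mul]
    · exact fun h => absurd hk h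
  exact_mod_cast h2

/-! ### Smoothing estimates from bounds on the spectral measure -/

theorem tendsto_eLpNorm_two_sub {α : Type*} [MeasurableSpace α] {μ : Measure α} {F : ℕ → α → ℂ}
    {g : α → ℂ} {b : α → ℝ} (hF : ∀ n, AEStronglyMeasurable (F n) μ)
    (hg : AEStronglyMeasurable g μ) (hb : MemLp b 2 μ)
    (hbound : ∀ n, ∀ᵐ x ∂μ, ‖F n x - g x‖ ≤ ‖b x‖)
    (hlim : ∀ᵐ x ∂μ, Tendsto (fun n => F n x) atTop (𝓝 (g x))) :
    Tendsto (fun n => eLpNorm (fun x => F n x - g x) 2 μ) atTop (𝓝 0) := by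
  have hfin : ∫⁻ x, ‖b x‖ₑ ^ 2 ∂μ ≠ ∞ := by
    rw [← eLpNorm_two_sq]
    exact ENNReal.pow_ne_top hb.2.ne
  have h1 : Tendsto (fun n => ∫⁻ x, ‖F n x - g x‖ₑ ^ 2 ∂μ) atTop (𝓝 (∫⁻ _, 0 ∂μ)) := by
    refine tendsto_lintegral_of_dominated_convergence' _
      (fun n => ((hF n).sub hg).enorm.pow_const 2) (fun n => ?_) hfin ?_
    · filter_upwards [hbound n] with x hx
      refine pow_le_pow_left₀ zero_le ?_ 2
      rw [← ofReal_norm, ← ofReal_norm]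
      exact ENNReal.ofReal_le_ofReal hx
    · filter_upwards [hlim] with x hx
      have h2 := (hx.sub_const (g x)).enorm
      rw [sub_self, enorm_zero] at h2
      have h3 := ENNReal.Tendsto.pow (n := 2) h2
      simpa using h3
  rw [lintegral_zero] at h1
  simp_rw [← eLpNorm_two_sq] at h1
  have h2 := ((ENNReal.continuous_rpow_const (y := (1 / 2 : ℝ))).tendsto 0).comp h1
  have h3 : (0 : ℝ≥0∞) ^ (1 / 2 : ℝ) = 0 := by simp
  rw [h3] at h2
  refine h2.congr fun n => ?_
  simp only [Function.comp_apply]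
  rw [← ENNReal.rpow_natCast, ← ENNReal.rpow_mul]
  norm_num

section
variable {𝓗 : Type*} [NormedAddCommGroup 𝓗] [InnerProductSpace ℂ 𝓗] [CompleteSpace 𝓗]
  {X : Type*} [NormedAddCommGroup X] [InnerProductSpace ℂ X] [CompleteSpace X]

theorem PVM.HasIntegral.finsetSum {E : PVM 𝓗} {β : Type*} {s : Finset β} {g : β → ℝ → ℂ} {φ : 𝓗}
    {u : β → 𝓗} (h : ∀ i ∈ s, E.HasIntegral (g i) φ (u i)) :
    E.HasIntegral (fun x => ∑ i ∈ s, g i x) φ (∑ i ∈ s, u i) := by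
  classical
  induction s using Finset.induction_on with
  | empty =>
    have := PVM.HasIntegral.const (E := E) 0 φ
    simpa using this
  | insert i s hi ih =>
    have h1 := (h i (Finset.mem_insert_self i s)).add
      (ih fun k hk => h k (Finset.mem_insert_of_mem hk))
    rw [Finset.sum_insert hi]
    convert h1 using 1
    ext x
    rw [Finset.sum_insert hi]
    rfl

/-- The norm of X* on the image of 𝓗 is the Hilbert norm of ι*u in X, which makes Parseval
applicable. -/
theorem norm_toAntiDual (ι : X →L[ℂ] 𝓗) (u : 𝓗) :
    ‖toAntiDual ι u‖ = ‖ContinuousLinearMap.adjoint ι u‖ := by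
  have h : ∀ g, toAntiDual ι u g = inner ℂ g (ContinuousLinearMap.adjoint ι u) := fun g => by
    rw [toAntiDual_apply, ContinuousLinearMap.adjoint_inner_right]
  refine le_antisymm ?_ ?_
  · refine ContinuousLinearMap.opNorm_le_bound _ (norm_nonneg _) fun g => ?_
    rw [h, mul_comm]
    exact norm_inner_le_norm _ _
  · have h1 := (toAntiDual ι u).le_opNorm (ContinuousLinearMap.adjoint ι u)
    rw [h, inner_self_eq_norm_sq_to_K, norm_pow, RCLike.norm_ofReal, abs_norm, sq] at h1
    rcases (norm_nonneg (ContinuousLinearMap.adjoint ι u)).eq_or_lt with h0 | h0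
    · rw [← h0]; exact norm_nonneg _
    · exact le_of_mul_le_mul_right h1 h0

/-- The weak form of the Kato smoothness bound for the part of the spectrum in `G`. -/
theorem norm_adjoint_hasIntegral_le {E : PVM 𝓗} {ι : X →L[ℂ] 𝓗} {G : Set ℝ}
    (hG : MeasurableSet G) {σ : ℝ → ℝ} (hσ : Measurable (G.indicator σ)) {c : ℝ} (hc : 0 ≤ c)
    (h : ∀ f : X, ∫⁻ x in G, ENNReal.ofReal (σ x ^ 2) ∂(E.scalarMeasure (ι f)) ≤
      ENNReal.ofReal (c * ‖f‖ ^ 2)) {φ w : 𝓗}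
    (hw : E.HasIntegral (G.indicator fun x => (σ x : ℂ)) φ w) :
    ‖ContinuousLinearMap.adjoint ι w‖ ^ 2 ≤ c * ‖E.proj G φ‖ ^ 2 := by
  -- Duality with the test vector f = ι*w: here ‖f‖² is the inner product of ιf and w. Moving
  -- σ(H)E(G) onto ιf produces v, whose norm the hypothesis controls.
  set f := ContinuousLinearMap.adjoint ι w with hf
  have hmeas : Measurable (G.indicator fun x => (σ x : ℂ)) := by
    have h1 := Complex.measurable_ofReal.comp hσ
    convert h1 using 1
    ext x
    by_cases hx : x ∈ G <;> simp [hx]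
  have hnorm : ∫⁻ x, ‖G.indicator (fun x => (σ x : ℂ)) x‖ₑ ^ 2 ∂(E.scalarMeasure (ι f)) =
      ∫⁻ x in G, ENNReal.ofReal (σ x ^ 2) ∂(E.scalarMeasure (ι f)) := by
    rw [← lintegral_indicator hG]
    refine lintegral_congr fun x => ?_
    by_cases hx : x ∈ G
    · rw [indicator_of_mem hx, indicator_of_mem hx, ← ofReal_norm,
        ← ENNReal.ofReal_pow (norm_nonneg _), Complex.norm_real, Real.norm_eq_abs, sq_abs]
    · simp [hx]
  have hmem : MemLp (G.indicator fun x => (σ x : ℂ)) 2 (E.scalarMeasure (ι f)) := by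
    refine ⟨hmeas.aestronglyMeasurable, ?_⟩
    have h1 : eLpNorm (G.indicator fun x => (σ x : ℂ)) 2 (E.scalarMeasure (ι f)) ^ 2 < ∞ := by
      rw [eLpNorm_two_sq, hnorm]
      exact (h f).trans_lt ENNReal.ofReal_lt_top
    exact (ENNReal.pow_lt_top_iff (n := 2)).1 h1 |>.resolve_right (by norm_num)
  have hv := PVM.hasIntegral_integral hmem
  set v := E.integral (G.indicator fun x => (σ x : ℂ)) (ι f)
  have hvn : ‖v‖ ^ 2 ≤ c * ‖f‖ ^ 2 := by
    have h1 := hv.enorm_sq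
    rw [hnorm, ← ofReal_norm, ← ENNReal.ofReal_pow (norm_nonneg _)] at h1
    have h2 := h f
    rw [← h1, ENNReal.ofReal_le_ofReal_iff (by positivity)] at h2
    exact h2
  -- As v lies in the range of E(G), only E(G)φ enters the pairing. This localization is what allows
  -- summation over disjoint cells.
  have hGv : E.proj G v = v := by
    refine (hv.indicator hG).unique ?_
    rwa [indicator_indicator, inter_self]
  have hconj : (fun x => starRingEnd ℂ (G.indicator (fun x => (σ x : ℂ)) x)) =
      G.indicator fun x => (σ x : ℂ) := by
    ext x
    by_cases hx : x ∈ G <;> simp [hx]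
  have hin : inner ℂ (ι f) w = inner ℂ v (E.proj G φ) := by
    rw [hw.inner_eq (ψ := ι f) (v := v) (by rwa [hconj]), ← E.inner_proj_left hG, hGv]
  have h1 : ‖f‖ ^ 2 ≤ ‖v‖ * ‖E.proj G φ‖ := by
    have h2 : inner ℂ (ι f) w = ((‖f‖ ^ 2 : ℝ) : ℂ) := by
      rw [← ContinuousLinearMap.adjoint_inner_right, ← hf, inner_self_eq_norm_sq_to_K]
      push_cast
      rfl
    have h3 := norm_inner_le_norm (𝕜 := ℂ) v (E.proj G φ)
    rw [← hin, h2, Complex.norm_real, Real.norm_eq_abs, abs_of_nonneg (by positivity)] at h3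
    exact h3
  rcases (norm_nonneg f).eq_or_lt with h0 | h0
  · rw [← h0]
    have : 0 ≤ c * ‖E.proj G φ‖ ^ 2 := by positivity
    simpa using this
  · have h4 : (‖f‖ ^ 2) ^ 2 ≤ (c * ‖E.proj G φ‖ ^ 2) * ‖f‖ ^ 2 := by
      calc (‖f‖ ^ 2) ^ 2 ≤ (‖v‖ * ‖E.proj G φ‖) ^ 2 := pow_le_pow_left₀ (by positivity) h1 2
        _ = ‖v‖ ^ 2 * ‖E.proj G φ‖ ^ 2 := by ring
        _ ≤ c * ‖f‖ ^ 2 * ‖E.proj G φ‖ ^ 2 := by gcongr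
        _ = _ := by ring
    rw [sq (‖f‖ ^ 2)] at h4
    exact le_of_mul_le_mul_right h4 (by positivity)

theorem sum_norm_proj_sq_le (E : PVM 𝓗) {β : Type*} (s : Finset β) {G : β → Set ℝ}
    (hG : ∀ k, MeasurableSet (G k)) (hd : Pairwise (fun k l => Disjoint (G k) (G l))) (φ : 𝓗) :
    ∑ k ∈ s, ‖E.proj (G k) φ‖ ^ 2 ≤ ‖φ‖ ^ 2 := by
  have h1 : E.scalarMeasure φ (⋃ k ∈ s, G k) = ENNReal.ofReal (∑ k ∈ s, ‖E.proj (G k) φ‖ ^ 2) := by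
    rw [measure_biUnion_finset (fun k _ l _ hkl => hd hkl) (fun k _ => hG k),
      ENNReal.ofReal_sum_of_nonneg (fun k _ => by positivity)]
    exact Finset.sum_congr rfl fun k _ => E.scalarMeasure_apply φ (hG k)
  have h2 : E.scalarMeasure φ (⋃ k ∈ s, G k) ≤ ENNReal.ofReal (‖φ‖ ^ 2) := by
    refine (measure_mono (subset_univ _)).trans (le_of_eq ?_)
    rw [E.scalarMeasure_apply _ MeasurableSet.univ, E.proj_univ]
    rfl
  rw [h1, ENNReal.ofReal_le_ofReal_iff (by positivity)] at h2
  exact h2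

end

/-! ### Discretization of the evolution -/

theorem floor_mul_eq_iff {n : ℝ} (hn : 0 < n) (k : ℤ) :
    {y : ℝ | ⌊n * y⌋ = k} = Ico (k / n) ((k + 1) / n) := by
  ext y
  rw [mem_ofPred_eq, Int.floor_eq_iff, mem_Ico, div_le_iff₀ hn, lt_div_iff₀ hn, mul_comm n y]

theorem volume_floor_mul_eq {n : ℝ} (hn : 0 < n) (k : ℤ) :
    volume {y : ℝ | ⌊n * y⌋ = k} = ENNReal.ofReal n⁻¹ := by
  rw [floor_mul_eq_iff hn, Real.volume_Ico]
  congr 1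
  field_simp
  ring

theorem tendsto_floor_mul_div (y : ℝ) :
    Tendsto (fun n : ℕ => (⌊((n : ℝ) + 1) * y⌋ : ℝ) / ((n : ℝ) + 1)) atTop (𝓝 y) := by
  have h1 : Tendsto (fun n : ℕ => y - 1 / ((n : ℝ) + 1)) atTop (𝓝 y) := by
    simpa using tendsto_const_nhds.sub (tendsto_one_div_add_atTop_nhds_zero_nat (𝕜 := ℝ))
  refine tendsto_of_tendsto_of_tendsto_of_le_of_le h1 tendsto_const_nhds (fun n => ?_)
    (fun n => ?_)
  · have hn : (0 : ℝ) < (n : ℝ) + 1 := by positivity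
    have h2 := Int.lt_floor_add_one (((n : ℝ) + 1) * y)
    have h3 : (y - 1 / ((n : ℝ) + 1)) * ((n : ℝ) + 1) = ((n : ℝ) + 1) * y - 1 := by
      field_simp
    show y - 1 / ((n : ℝ) + 1) ≤ _
    rw [le_div_iff₀ hn, h3]
    linarith
  · have hn : (0 : ℝ) < (n : ℝ) + 1 := by positivity
    show _ / _ ≤ y
    rw [div_le_iff₀ hn, mul_comm y]
    exact Int.floor_le _

/-- The integers of absolute value at most `(n + 1)²`. -/
noncomputable def phaseIndices (n : ℕ) : Finset ℤ :=
  Finset.Icc (-((n : ℤ) + 1) ^ 2) (((n : ℤ) + 1) ^ 2)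

/-- Explains the quadratic cutoff: as soon as |y| ≤ n + 1, also |(n + 1)y| ≤ (n + 1)². So the sums
stay finite, yet every point is eventually included. -/
theorem eventually_floor_mul_mem (y : ℝ) :
    ∀ᶠ n : ℕ in atTop, ⌊((n : ℝ) + 1) * y⌋ ∈ phaseIndices n := by
  obtain ⟨K, hK⟩ := exists_nat_ge (|y|)
  filter_upwards [eventually_ge_atTop K] with n hn
  have hn1 : |y| ≤ (n : ℝ) + 1 := by
    have : (K : ℝ) ≤ n := by exact_mod_cast hn
    linarith
  have h0 : (0 : ℝ) < (n : ℝ) + 1 := by positivity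
  obtain ⟨h1, h2⟩ := abs_le.1 hn1
  rw [phaseIndices, Finset.mem_Icc]
  constructor
  · rw [Int.le_floor]
    push_cast
    nlinarith
  · have h3 := Int.floor_le (((n : ℝ) + 1) * y)
    have h4 : (⌊((n : ℝ) + 1) * y⌋ : ℝ) ≤ ((((n : ℤ) + 1) ^ 2 : ℤ) : ℝ) := by
      push_cast
      nlinarith
    exact_mod_cast h4

/-- The part of `J \ N` where `⌊n a⌋ = k`. -/
def levelCell (J : Set ℝ) (N : Finset ℝ) (a : ℝ → ℝ) (n : ℝ) (k : ℤ) : Set ℝ :=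
  (J \ N) ∩ a ⁻¹' {y | ⌊n * y⌋ = k}

section
variable {J : Set ℝ} {N : Finset ℝ} {σ a : ℝ → ℝ} {n : ℝ}

theorem levelCell_subset (k : ℤ) : levelCell J N a n k ⊆ J \ N := inter_subset_left

theorem mem_levelCell {k : ℤ} {x : ℝ} :
    x ∈ levelCell J N a n k ↔ x ∈ J \ (N : Set ℝ) ∧ ⌊n * a x⌋ = k := Iff.rfl

theorem pairwise_disjoint_levelCell :
    Pairwise fun k l => Disjoint (levelCell J N a n k) (levelCell J N a n l) := by
  intro k l hkl
  refine Set.disjoint_left.2 fun x hx hx' => hkl ?_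
  rw [mem_levelCell] at hx hx'
  exact hx.2.symm.trans hx'.2

theorem measurableSet_levelCell (h : IsAdmissiblePair J N σ a) (hJ : IsOpen J) (hn : 0 < n) (k : ℤ) :
    MeasurableSet (levelCell J N a n k) := by
  refine measurableSet_inter_preimage (h.isOpen_diff hJ).measurableSet h.contDiffOn.continuousOn ?_
  rw [floor_mul_eq_iff hn]
  exact measurableSet_Ico

theorem measurable_indicator_levelCell (h : IsAdmissiblePair J N σ a) (hJ : IsOpen J) (hn : 0 < n)
    (k : ℤ) : Measurable ((levelCell J N a n k).indicator σ) :=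
  measurable_indicator_of_continuousOn (measurableSet_levelCell h hJ hn k)
    (h.continuousOn.mono ((levelCell_subset k).trans sdiff_subset))

theorem lintegral_deriv_levelCell_le (h : IsAdmissiblePair J N σ a) (hJ : IsOpen J) (hn : 0 < n)
    {m : ℕ} (hm : ∀ η : ℝ, {x ∈ J \ N | a x = η}.encard ≤ m) (k : ℤ) :
    ∫⁻ x in levelCell J N a n k, ENNReal.ofReal (deriv a x) ≤ ENNReal.ofReal (m / n) := by
  have hT : MeasurableSet {y : ℝ | ⌊n * y⌋ = k} := by
    rw [floor_mul_eq_iff hn]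
    exact measurableSet_Ico
  refine (lintegral_deriv_preimage_le (h.isOpen_diff hJ) (fun x hx => h.differentiableAt hJ hx)
    h.deriv_pos hm hT).trans (le_of_eq ?_)
  rw [volume_floor_mul_eq hn, div_eq_mul_inv, ENNReal.ofReal_mul m.cast_nonneg,
    ENNReal.ofReal_natCast]

/-- The discretization of `σ e^{ita}` in which `a` is rounded down to a multiple of `1 / n`. -/
noncomputable def discretePhase (J : Set ℝ) (N : Finset ℝ) (σ a : ℝ → ℝ) (n : ℕ) (t : ℝ) : ℝ → ℂ :=
  fun x => ∑ k ∈ phaseIndices n,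
    Complex.exp (Complex.I * t * ((k : ℝ) / ((n : ℝ) + 1) : ℝ)) *
      (levelCell J N a ((n : ℝ) + 1) k).indicator (fun x => (σ x : ℂ)) x

theorem discretePhase_eq (n : ℕ) (t : ℝ) {x : ℝ} (hx : x ∈ J \ (N : Set ℝ)) :
    discretePhase J N σ a n t x =
      if ⌊((n : ℝ) + 1) * a x⌋ ∈ phaseIndices n then
        Complex.exp (Complex.I * t * ((⌊((n : ℝ) + 1) * a x⌋ : ℝ) / ((n : ℝ) + 1) : ℝ)) * σ x
      else 0 := by
  have h0 : ∀ k : ℤ, k ≠ ⌊((n : ℝ) + 1) * a x⌋ → Complex.exp (Complex.I * t *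
      ((k : ℝ) / ((n : ℝ) + 1) : ℝ)) *
      (levelCell J N a ((n : ℝ) + 1) k).indicator (fun x => (σ x : ℂ)) x = 0 := by
    intro k hk
    rw [indicator_of_notMem, mul_zero]
    intro h
    exact hk (mem_levelCell.1 h).2.symm
  unfold discretePhase
  split_ifs with hk
  · rw [Finset.sum_eq_single_of_mem _ hk fun k _ hk' => h0 k hk',
      indicator_of_mem (mem_levelCell.2 ⟨hx, rfl⟩)]
  · exact Finset.sum_eq_zero fun k hk' => h0 k fun hkk => hk (hkk ▸ hk')

theorem discretePhase_of_notMem (n : ℕ) (t : ℝ) {x : ℝ} (hx : x ∉ J \ (N : Set ℝ)) :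
    discretePhase J N σ a n t x = 0 := by
  refine Finset.sum_eq_zero fun k _ => ?_
  rw [indicator_of_notMem (fun h => hx (levelCell_subset k h)), mul_zero]

/-- Supplies the dominating function 2|σ|, independent of n, for convergence in L² of the spectral
measure. Points of N belong to no cell and are excluded. -/
theorem norm_discretePhase_sub_le (n : ℕ) (t : ℝ) {x : ℝ} (hxN : x ∉ (N : Set ℝ)) :
    ‖discretePhase J N σ a n t x -
      J.indicator (fun x => (σ x : ℂ) * Complex.exp (Complex.I * t * a x)) x‖ ≤
      ‖2 * J.indicator σ x‖ := by
  by_cases hx : x ∈ J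
  · rw [indicator_of_mem hx, indicator_of_mem hx, discretePhase_eq n t ⟨hx, hxN⟩]
    refine (norm_sub_le _ _).trans ?_
    rw [norm_mul, norm_mul, norm_exp_I_mul_mul, mul_one, Complex.norm_real, Real.norm_two, two_mul]
    refine add_le_add_left ?_ _
    split_ifs
    · rw [norm_mul, norm_exp_I_mul_mul, one_mul, Complex.norm_real]
    · rw [norm_zero]; exact norm_nonneg _
  · rw [indicator_of_notMem hx, discretePhase_of_notMem n t fun h => hx h.1, sub_zero, norm_zero]
    exact norm_nonneg _

theorem tendsto_discretePhase (t : ℝ) {x : ℝ} (hxN : x ∉ (N : Set ℝ)) :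
    Tendsto (fun n => discretePhase J N σ a n t x) atTop
      (𝓝 (J.indicator (fun x => (σ x : ℂ) * Complex.exp (Complex.I * t * a x)) x)) := by
  by_cases hx : x ∈ J
  · rw [indicator_of_mem hx, mul_comm]
    have hcont : Continuous fun y : ℝ => Complex.exp (Complex.I * t * y) * (σ x : ℂ) := by fun_prop
    refine ((hcont.tendsto (a x)).comp (tendsto_floor_mul_div (a x))).congr' ?_
    filter_upwards [eventually_floor_mul_mem (a x)] with n hn
    rw [discretePhase_eq n t ⟨hx, hxN⟩, if_pos hn]
    rfl
  · rw [indicator_of_notMem hx]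
    refine tendsto_const_nhds.congr fun n => ?_
    rw [discretePhase_of_notMem n t fun h => hx h.1]

end

section
variable {𝓗 : Type*} [NormedAddCommGroup 𝓗] [InnerProductSpace ℂ 𝓗] [CompleteSpace 𝓗]
  {X : Type*} [NormedAddCommGroup X] [InnerProductSpace ℂ X] [CompleteSpace X]
  {ι : X →L[ℂ] 𝓗} {H : 𝓗 →ₗ.[ℂ] 𝓗} {J : Set ℝ} {N : Finset ℝ} {σ a : ℝ → ℝ}

omit [CompleteSpace X] [NormedAddCommGroup X] [InnerProductSpace ℂ X] in
theorem exists_hasIntegral_levelCell (h : IsAdmissiblePair J N σ a) (hJ : IsOpen J) {φ : 𝓗}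
    (hφ : MemLp (J.indicator σ) 2 ((spectralMeasure H).scalarMeasure φ)) {n : ℝ} (hn : 0 < n)
    (k : ℤ) : ∃ w, (spectralMeasure H).HasIntegral
      ((levelCell J N a n k).indicator fun x => (σ x : ℂ)) φ w := by
  refine ⟨_, PVM.hasIntegral_integral (hφ.of_le ?_ (ae_of_all _ fun x => ?_))⟩
  · have h1 := Complex.measurable_ofReal.comp (measurable_indicator_levelCell h hJ hn k)
    refine Measurable.aestronglyMeasurable ?_
    convert h1 using 1
    ext x
    by_cases hx : x ∈ levelCell J N a n k <;> simp [hx]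
  · by_cases hx : x ∈ levelCell J N a n k
    · rw [indicator_of_mem hx, indicator_of_mem (levelCell_subset k hx).1, Complex.norm_real]
    · rw [indicator_of_notMem hx, norm_zero]
      exact norm_nonneg _

/-- The evolution is a limit of trigonometric polynomials, whose mean squares over a period are
uniformly bounded. -/
theorem exists_tendsto_evolution (h : IsAdmissiblePair J N σ a) (hJ : IsOpen J) {m : ℕ}
    (hm : ∀ η : ℝ, {x ∈ J \ N | a x = η}.encard ≤ m) {κ : ℝ} (hκ0 : 0 ≤ κ)
    (hκ : ∀ (f : X) (G : Set ℝ), MeasurableSet G → G ⊆ J \ N →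
      ∫⁻ x in G, ENNReal.ofReal (σ x ^ 2) ∂((spectralMeasure H).scalarMeasure (ι f)) ≤
        ENNReal.ofReal (κ * ‖f‖ ^ 2) * ∫⁻ x in G, ENNReal.ofReal (deriv a x))
    (hN : (spectralMeasure H).proj N = 0) {φ : 𝓗}
    (hφ : MemLp (J.indicator σ) 2 ((spectralMeasure H).scalarMeasure φ)) :
    ∃ u : ℕ → ℝ → 𝓗, (∀ n, Continuous (u n)) ∧
      (∀ t, Tendsto (fun n => u n t) atTop (𝓝 (evolution H J σ a t φ))) ∧
      ∀ n : ℕ, ∫ t in (-(Real.pi * ((n : ℝ) + 1)))..(Real.pi * ((n : ℝ) + 1)),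
        ‖ContinuousLinearMap.adjoint ι (u n t)‖ ^ 2 ≤ 2 * Real.pi * m * κ * ‖φ‖ ^ 2 := by
  set E := spectralMeasure H
  have hn : ∀ n : ℕ, (0 : ℝ) < (n : ℝ) + 1 := fun n => by positivity
  choose w hw using fun (n : ℕ) (k : ℤ) => exists_hasIntegral_levelCell h hJ hφ (hn n) k
  refine ⟨fun n t => ∑ k ∈ phaseIndices n,
    Complex.exp (Complex.I * t * ((k : ℝ) / ((n : ℝ) + 1) : ℝ)) • w n k, fun n => by fun_prop,
    fun t => ?_, fun n => ?_⟩
  · have hu : ∀ n, E.HasIntegral (discretePhase J N σ a n t) φ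
        (∑ k ∈ phaseIndices n,
          Complex.exp (Complex.I * t * ((k : ℝ) / ((n : ℝ) + 1) : ℝ)) • w n k) := fun n =>
      PVM.HasIntegral.finsetSum fun k _ => (hw n k).const_smul _
    have hev := hasIntegral_evolution h hJ hφ t
    have hNae : ∀ᵐ x ∂(E.scalarMeasure φ), x ∉ (N : Set ℝ) := by
      rw [ae_iff]
      simp only [not_not]
      change E.scalarMeasure φ (N : Set ℝ) = 0
      rw [E.scalarMeasure_apply _ N.finite_toSet.measurableSet, hN]
      simp
    refine PVM.tendsto_of_hasIntegral hev hu ?_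
    refine tendsto_eLpNorm_two_sub (b := fun x => 2 * J.indicator σ x) (fun n => (hu n).1.1)
      hev.1.1 (hφ.const_mul 2) (fun n => ?_) ?_
    · filter_upwards [hNae] with x hx using norm_discretePhase_sub_le n t hx
    · filter_upwards [hNae] with x hx using tendsto_discretePhase t hx
  · simp only [map_sum, map_smul]
    rw [integral_norm_sq_exp_sum (hn n)]
    -- On one cell the assumed bound has constant κ times the integral of a' over it, and the area
    -- formula bounds this integral by m/(n + 1), since a ranges in an interval of length 1/(n + 1).
    have h1 : ∀ k : ℤ, ‖ContinuousLinearMap.adjoint ι (w n k)‖ ^ 2 ≤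
        κ * (m / ((n : ℝ) + 1)) * ‖E.proj (levelCell J N a ((n : ℝ) + 1) k) φ‖ ^ 2 := by
      intro k
      refine norm_adjoint_hasIntegral_le (measurableSet_levelCell h hJ (hn n) k)
        (measurable_indicator_levelCell h hJ (hn n) k) (by positivity) (fun f => ?_) (hw n k)
      refine (hκ f _ (measurableSet_levelCell h hJ (hn n) k) (levelCell_subset k)).trans ?_
      refine (mul_le_mul_right (lintegral_deriv_levelCell_le h hJ (hn n) hm k) _).trans ?_
      rw [← ENNReal.ofReal_mul (by positivity)]
      exact ENNReal.ofReal_le_ofReal (le_of_eq (by ring))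
    calc 2 * Real.pi * ((n : ℝ) + 1) *
          ∑ k ∈ phaseIndices n,
            ‖ContinuousLinearMap.adjoint ι (w n k)‖ ^ 2
        ≤ 2 * Real.pi * ((n : ℝ) + 1) * (κ * (m / ((n : ℝ) + 1)) * ‖φ‖ ^ 2) := by
          refine mul_le_mul_of_nonneg_left ?_ (by positivity)
          refine (Finset.sum_le_sum fun k _ => h1 k).trans ?_
          rw [← Finset.mul_sum]
          exact mul_le_mul_of_nonneg_left (sum_norm_proj_sq_le E _
            (measurableSet_levelCell h hJ (hn n)) pairwise_disjoint_levelCell φ) (by positivity)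
      _ = 2 * Real.pi * m * κ * ‖φ‖ ^ 2 := by
          field_simp

end

/-! ### Bounded extensions with values in `L²` -/

/-- Fatou's lemma on the growing intervals: bounds over longer and longer periods become a bound on
the whole line. -/
theorem memLp_two_of_tendsto {Z : Type*} [NormedAddCommGroup Z] {u : ℕ → ℝ → Z} {v : ℝ → Z}
    (hu : ∀ n, Continuous (u n)) (huv : ∀ t, Tendsto (fun n => u n t) atTop (𝓝 (v t)))
    {T : ℕ → ℝ} (hT0 : ∀ n, 0 ≤ T n) (hT : Tendsto T atTop atTop) {K : ℝ}
    (hK : ∀ n, ∫ t in (-(T n))..(T n), ‖u n t‖ ^ 2 ≤ K) :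
    MemLp v 2 volume ∧ eLpNorm v 2 volume ^ 2 ≤ ENNReal.ofReal K := by
  have hmeas : StronglyMeasurable v :=
    stronglyMeasurable_of_tendsto atTop (fun n => (hu n).stronglyMeasurable)
      (tendsto_pi_nhds.2 huv)
  have hle : ∀ n, ∫⁻ t, (Ioc (-(T n)) (T n)).indicator (fun t => ‖u n t‖ₑ ^ 2) t ≤
      ENNReal.ofReal K := by
    intro n
    have h1 : IntervalIntegrable (fun t => ‖u n t‖ ^ 2) volume (-(T n)) (T n) :=
      (((hu n).norm).pow 2).intervalIntegrable _ _
    have hTn : -(T n) ≤ T n := by linarith [hT0 n]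
    rw [lintegral_indicator measurableSet_Ioc]
    refine le_trans (le_of_eq ?_) (ENNReal.ofReal_le_ofReal (hK n))
    rw [intervalIntegral.integral_of_le hTn, ofReal_integral_eq_lintegral_ofReal
      ((intervalIntegrable_iff_integrableOn_Ioc_of_le hTn).1 h1)
      (ae_of_all _ fun t => by positivity)]
    refine lintegral_congr fun t => ?_
    rw [← ofReal_norm, ENNReal.ofReal_pow (norm_nonneg _)]
  have hlim : ∀ t, Tendsto (fun n => (Ioc (-(T n)) (T n)).indicator (fun t => ‖u n t‖ₑ ^ 2) t) atTop
      (𝓝 (‖v t‖ₑ ^ 2)) := by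
    intro t
    refine (ENNReal.Tendsto.pow (n := 2) (huv t).enorm).congr' ?_
    filter_upwards [hT.eventually_gt_atTop |t|] with n hn
    rw [indicator_of_mem (show t ∈ Ioc (-(T n)) (T n) from
      ⟨(abs_lt.1 hn).1, (abs_lt.1 hn).2.le⟩)]
  have hfatou : ∫⁻ t, ‖v t‖ₑ ^ 2 ≤ ENNReal.ofReal K := by
    have h1 : ∫⁻ t, liminf (fun n => (Ioc (-(T n)) (T n)).indicator (fun t => ‖u n t‖ₑ ^ 2) t) atTop ≤
        liminf (fun n => ∫⁻ t, (Ioc (-(T n)) (T n)).indicator (fun t => ‖u n t‖ₑ ^ 2) t) atTop :=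
      lintegral_liminf_le fun n =>
        ((hu n).enorm.measurable.pow_const 2).indicator measurableSet_Ioc
    simp_rw [fun t => (hlim t).liminf_eq] at h1
    refine h1.trans ?_
    refine (liminf_le_liminf (Eventually.of_forall hle)).trans ?_
    simp
  rw [← eLpNorm_two_sq] at hfatou
  refine ⟨⟨hmeas.aestronglyMeasurable, ?_⟩, hfatou⟩
  exact (ENNReal.pow_lt_top_iff (n := 2)).1 (hfatou.trans_lt ENNReal.ofReal_lt_top)
    |>.resolve_right (by norm_num)

theorem memLp_two_ofReal_iff {α : Type*} [MeasurableSpace α] {μ : Measure α} {g : α → ℝ} :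
    MemLp (fun x => (g x : ℂ)) 2 μ ↔ MemLp g 2 μ :=
  ⟨fun h => by simpa using h.re, fun h => h.ofReal⟩

theorem exists_extension_of_dense {𝓗 W : Type*} [NormedAddCommGroup 𝓗] [NormedSpace ℂ 𝓗]
    [NormedAddCommGroup W] [NormedSpace ℂ W] [CompleteSpace W] {D : Submodule ℂ 𝓗}
    (hD : Dense (D : Set 𝓗)) (S₀ : D →ₗ[ℂ] W) {C : ℝ} (hC : ∀ φ : D, ‖S₀ φ‖ ≤ C * ‖(φ : 𝓗)‖) :
    ∃ S : 𝓗 →L[ℂ] W, (∀ φ : D, S φ = S₀ φ) ∧ ∀ φ, ‖S φ‖ ≤ C * ‖φ‖ := by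
  have hdr : DenseRange (D.subtypeL : D → 𝓗) := by
    simpa [DenseRange] using hD
  have hui : IsUniformInducing (D.subtypeL : D → 𝓗) := isUniformInducing_val _
  let S := (S₀.mkContinuous C hC).extend D.subtypeL
  have hS : ∀ φ : D, S φ = S₀ φ := fun φ =>
    ContinuousLinearMap.extend_eq (S₀.mkContinuous C hC) hdr hui φ
  refine ⟨S, hS, fun φ => ?_⟩
  refine hdr.induction_on φ ?_ fun ψ => ?_
  · exact isClosed_le S.continuous.norm (continuous_const.mul continuous_norm)
  · change ‖S (ψ : 𝓗)‖ ≤ C * ‖(ψ : 𝓗)‖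
    rw [hS]
    exact hC ψ

theorem exists_extension_Lp_of_dense {𝓗 Z : Type*} [NormedAddCommGroup 𝓗] [NormedSpace ℂ 𝓗]
    [NormedAddCommGroup Z] [NormedSpace ℂ Z] [CompleteSpace Z] {D : Submodule ℂ 𝓗}
    (hD : Dense (D : Set 𝓗)) {v : 𝓗 → ℝ → Z} (hv : ∀ φ ∈ D, MemLp (v φ) 2 volume)
    (hadd : ∀ φ ∈ D, ∀ ψ ∈ D, v (φ + ψ) = v φ + v ψ) (hsmul : ∀ (c : ℂ), ∀ φ ∈ D, v (c • φ) = c • v φ)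
    {C : ℝ} (hC : ∀ φ ∈ D, eLpNorm (v φ) 2 volume ≤ ENNReal.ofReal (C * ‖φ‖)) (hC0 : 0 ≤ C) :
    ∃ S : 𝓗 →L[ℂ] Lp Z 2 (volume : Measure ℝ), (∀ φ ∈ D, S φ =ᵐ[volume] v φ) ∧
      ∀ φ, ‖S φ‖ ≤ C * ‖φ‖ := by
  let S₀ : D →ₗ[ℂ] Lp Z 2 (volume : Measure ℝ) :=
    { toFun := fun φ => (hv φ φ.2).toLp (v φ)
      map_add' := fun φ ψ => by
        rw [← MemLp.toLp_add]
        exact MemLp.toLp_congr _ _ (Eventually.of_forall fun t => by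
          rw [← hadd φ φ.2 ψ ψ.2]; rfl)
      map_smul' := fun c φ => by
        rw [RingHom.id_apply, ← MemLp.toLp_const_smul]
        exact MemLp.toLp_congr _ _ (Eventually.of_forall fun t => by
          rw [← hsmul c φ φ.2]; rfl) }
  obtain ⟨S, hS, hSC⟩ := exists_extension_of_dense hD S₀ (C := C) fun φ => by
    change ‖(hv φ φ.2).toLp (v φ)‖ ≤ _
    rw [Lp.norm_toLp]
    exact ENNReal.toReal_le_of_le_ofReal (by positivity) (hC φ φ.2)
  refine ⟨S, fun φ hφ => ?_, hSC⟩
  rw [hS ⟨φ, hφ⟩]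
  exact (hv φ hφ).coeFn_toLp

/-! ### Construction of the bounded extension -/

section
variable {𝓗 : Type*} [NormedAddCommGroup 𝓗] [InnerProductSpace ℂ 𝓗] [CompleteSpace 𝓗]
  {X : Type*} [NormedAddCommGroup X] [InnerProductSpace ℂ X] [CompleteSpace X]
  {ι : X →L[ℂ] 𝓗} {H : 𝓗 →ₗ.[ℂ] 𝓗} {J : Set ℝ} {N : Finset ℝ} {σ a : ℝ → ℝ}

/-- The vectors `φ` with `g ∈ L²(μ_φ)`, that is, the domain of `∫ g dE`. -/
noncomputable def PVM.integralDomain (E : PVM 𝓗) (g : ℝ → ℝ) (hg : Measurable g) :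
    Submodule ℂ 𝓗 where
  carrier := {φ | MemLp g 2 (E.scalarMeasure φ)}
  zero_mem' := by
    have : E.scalarMeasure (0 : 𝓗) = 0 := by
      rw [← zero_smul ℂ (0 : 𝓗), E.scalarMeasure_smul]
      simp
    change MemLp g 2 (E.scalarMeasure 0)
    rw [this]
    exact ⟨hg.aestronglyMeasurable, by simp⟩
  add_mem' := by
    intro φ ψ hφ hψ
    change MemLp g 2 _
    rw [← memLp_two_ofReal_iff]
    exact PVM.memLp_add_vec (memLp_two_ofReal_iff.2 hφ) (memLp_two_ofReal_iff.2 hψ)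
  smul_mem' := by
    intro c φ hφ
    change MemLp g 2 _
    rw [← memLp_two_ofReal_iff]
    exact PVM.memLp_smul_vec (memLp_two_ofReal_iff.2 hφ) c

/-- The cut-off vectors E(|g| ≤ n)φ lie in the domain and converge to φ. -/
theorem PVM.dense_integralDomain (E : PVM 𝓗) (g : ℝ → ℝ) (hg : Measurable g) :
    Dense (E.integralDomain g hg : Set 𝓗) := by
  intro φ
  let B : ℕ → Set ℝ := fun n => {x | ‖g x‖ ≤ n}
  have hB : ∀ n, MeasurableSet (B n) := fun n => measurableSet_le hg.norm measurable_const
  refine mem_closure_of_tendsto (f := fun n => E.proj (B n) φ) (b := atTop) ?_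
    (Eventually.of_forall fun n => ?_)
  · refine PVM.tendsto_of_hasIntegral (PVM.HasIntegral.one φ)
      (fun n => PVM.HasIntegral.indicator_one (hB n) φ) ?_
    refine tendsto_eLpNorm_two_sub (b := fun _ => 1)
      (fun n => (measurable_const.indicator (hB n)).aestronglyMeasurable)
      aestronglyMeasurable_const (memLp_const 1) (fun n => ae_of_all _ fun x => ?_)
      (ae_of_all _ fun x => ?_)
    · by_cases hx : x ∈ B n <;> simp [hx]
    · obtain ⟨K, hK⟩ := exists_nat_ge ‖g x‖
      refine tendsto_const_nhds.congr' ?_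
      filter_upwards [eventually_ge_atTop K] with n hn
      have : x ∈ B n := hK.trans (by exact_mod_cast hn)
      rw [indicator_of_mem this]
  · exact memLp_indicator_proj E hg (hB n) (C := n) (fun x hx => hx) φ

/-- The converse direction: a bound for σ² dμ_f by a' dx, where a has multiplicity at most m, yields
smoothing. The evolution is defined over all of J while the cells omit N, so N must be spectrally
null. -/
theorem smoothingEstimate_of_bound (h : IsAdmissiblePair J N σ a) (hJ : IsOpen J) {m : ℕ}
    (hm : ∀ η : ℝ, {x ∈ J \ N | a x = η}.encard ≤ m) {κ : ℝ} (hκ0 : 0 ≤ κ)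
    (hκ : ∀ (f : X) (G : Set ℝ), MeasurableSet G → G ⊆ J \ N →
      ∫⁻ x in G, ENNReal.ofReal (σ x ^ 2) ∂((spectralMeasure H).scalarMeasure (ι f)) ≤
        ENNReal.ofReal (κ * ‖f‖ ^ 2) * ∫⁻ x in G, ENNReal.ofReal (deriv a x))
    (hN : (spectralMeasure H).proj N = 0) {C : ℝ} (hC0 : 0 ≤ C)
    (hC : 2 * Real.pi * m * κ ≤ C ^ 2) : SmoothingEstimate ι H J σ a C := by
  set E := spectralMeasure H
  have hσ : Measurable (J.indicator σ) :=
    measurable_indicator_of_continuousOn hJ.measurableSet h.continuousOn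
  have hev : ∀ φ ∈ E.integralDomain (J.indicator σ) hσ, ∀ t : ℝ, E.HasIntegral
      (J.indicator fun x => (σ x : ℂ) * Complex.exp (Complex.I * t * a x)) φ
      (evolution H J σ a t φ) := fun φ hφ t => hasIntegral_evolution h hJ hφ t
  have key : ∀ φ ∈ E.integralDomain (J.indicator σ) hσ,
      MemLp (fun t => toAntiDual ι (evolution H J σ a t φ)) 2 volume ∧
      eLpNorm (fun t => toAntiDual ι (evolution H J σ a t φ)) 2 volume ^ 2 ≤
        ENNReal.ofReal (2 * Real.pi * m * κ * ‖φ‖ ^ 2) := by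
    intro φ hφ
    obtain ⟨u, hu, huv, hK⟩ := exists_tendsto_evolution h hJ hm hκ0 hκ hN hφ
    refine memLp_two_of_tendsto (u := fun n t => toAntiDual ι (u n t))
      (T := fun n : ℕ => Real.pi * ((n : ℝ) + 1))
      (fun n => (toAntiDual ι).continuous.comp (hu n))
      (fun t => ((toAntiDual ι).continuous.tendsto _).comp (huv t)) (fun n => by positivity) ?_
      (fun n => ?_)
    · exact (tendsto_atTop_add_const_right _ 1 tendsto_natCast_atTop_atTop).const_mul_atTop
        Real.pi_pos
    · simp_rw [norm_toAntiDual]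
      exact hK n
  refine exists_extension_Lp_of_dense (E.dense_integralDomain (J.indicator σ) hσ)
    (v := fun φ t => toAntiDual ι (evolution H J σ a t φ)) (fun φ hφ => (key φ hφ).1)
    (fun φ hφ ψ hψ => ?_) (fun c φ hφ => ?_) (fun φ hφ => ?_) hC0
  · ext1 t
    rw [Pi.add_apply, ← map_add]
    congr 1
    exact (hev _ (Submodule.add_mem _ hφ hψ) t).unique ((hev φ hφ t).add_vec (hev ψ hψ t))
  · ext1 t
    rw [Pi.smul_apply, ← map_smul]
    congr 1
    exact (hev _ (Submodule.smul_mem _ c hφ) t).unique ((hev φ hφ t).smul_vec c)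
  · have h1 := (key φ hφ).2
    refine (ENNReal.pow_le_pow_left_iff (n := 2) (by norm_num)).1 (h1.trans ?_)
    rw [← ENNReal.ofReal_pow (by positivity), mul_pow]
    exact ENNReal.ofReal_le_ofReal (mul_le_mul_of_nonneg_right hC (by positivity))

end

/-! ### Transfer of smoothing estimates -/

theorem continuousOn_of_locally_holder {Z : Type*} [NormedAddCommGroup Z] {A : ℝ → Z} {J : Set ℝ}
    (hJ : IsOpen J) {α : ℝ} (hα : 0 < α)
    (h : ∀ K ⊆ J, IsCompact K → ∃ c : ℝ, ∀ x ∈ K, ∀ y ∈ K, ‖A x - A y‖ ≤ c * |x - y| ^ α) :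
    ContinuousOn A J := by
  intro x hx
  refine ContinuousAt.continuousWithinAt ?_
  obtain ⟨δ, hδ, hb⟩ := Metric.nhds_basis_closedBall.mem_iff.1 (hJ.mem_nhds hx)
  obtain ⟨c, hc⟩ := h _ hb (isCompact_closedBall x δ)
  rw [ContinuousAt, tendsto_iff_norm_sub_tendsto_zero]
  have h1 : Tendsto (fun y => c * |y - x| ^ α) (𝓝 x) (𝓝 0) := by
    have h2 : Continuous fun y : ℝ => c * |y - x| ^ α :=
      continuous_const.mul ((continuous_id.sub continuous_const).abs.rpow_const
        fun _ => Or.inr hα.le)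
    have h3 := h2.tendsto x
    simpa [Real.zero_rpow hα.ne'] using h3
  refine squeeze_zero' (Eventually.of_forall fun _ => norm_nonneg _) ?_ h1
  filter_upwards [Metric.closedBall_mem_nhds x hδ] with y hy
  exact hc y hy x (Metric.mem_closedBall_self hδ.le)

section
variable {𝓗 : Type*} [NormedAddCommGroup 𝓗] [InnerProductSpace ℂ 𝓗] [CompleteSpace 𝓗]
  {X : Type*} [NormedAddCommGroup X] [InnerProductSpace ℂ X] {ι : X →L[ℂ] 𝓗}

theorem PVM.proj_eq_zero_of_dense {E : PVM 𝓗} (hι : DenseRange ι) {B : Set ℝ}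
    (hB : MeasurableSet B) (h : ∀ f, E.scalarMeasure (ι f) B = 0) : E.proj B = 0 := by
  ext1 φ
  refine hι.induction_on φ (isClosed_eq (E.proj B).continuous continuous_const) fun f => ?_
  have h1 := h f
  rw [E.scalarMeasure_apply' _ hB] at h1
  simpa using h1

/-- A bound for the spectral measure by a density, integrated against a weight. -/
theorem setLIntegral_le_of_measure_le {ρ : Measure ℝ} {J G : Set ℝ} {k g b : ℝ → ℝ≥0∞}
    (hk : Measurable k) (hG : MeasurableSet G) (hGJ : G ⊆ J)
    (hρ : ∀ B, MeasurableSet B → B ⊆ J → ρ B ≤ ∫⁻ x in B, k x)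
    (hb : ∀ᵐ x, x ∈ G → k x * g x ≤ b x) : ∫⁻ x in G, g x ∂ρ ≤ ∫⁻ x in G, b x := by
  have h1 : ρ.restrict G ≤ (volume.restrict G).withDensity k := by
    refine Measure.le_iff.2 fun s hs => ?_
    rw [Measure.restrict_apply hs, withDensity_apply _ hs, Measure.restrict_restrict hs]
    exact hρ _ (hs.inter hG) (inter_subset_right.trans hGJ)
  calc ∫⁻ x in G, g x ∂ρ ≤ ∫⁻ x, g x ∂((volume.restrict G).withDensity k) :=
        lintegral_mono' h1 le_rfl
    _ ≤ ∫⁻ x in G, (k * g) x := lintegral_withDensity_le_lintegral_mul _ hk _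
    _ ≤ ∫⁻ x in G, b x := setLIntegral_mono_ae' hG hb

end

theorem mainTheorem5
    {𝓗 : Type*} [NormedAddCommGroup 𝓗] [InnerProductSpace ℂ 𝓗] [CompleteSpace 𝓗]
    {X : Type*} [NormedAddCommGroup X] [InnerProductSpace ℂ X] [CompleteSpace X]
    {Y : Type*} [NormedAddCommGroup Y] [InnerProductSpace ℂ Y] [CompleteSpace Y]
    (ι : X →L[ℂ] 𝓗) (hι : Function.Injective ι) (hι_dense : DenseRange ι)
    (j : Y →L[ℂ] AntiDual X) (hj : Function.Injective j) (hj_dense : DenseRange j)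
    (J : Set ℝ) (hJ : IsOpen J)
    (H : 𝓗 →ₗ.[ℂ] 𝓗) (hH : IsSelfAdjoint H)
    (hA : HasHolderSpectralDensity ι H J)
    (hY : IsAdapted ι j H J)
    (V : Y →L[ℂ] X) (hV : IsShortRange ι j H V)
    (hinv : UniformlyInvertible ι j H V J) :
    IsSelfAdjoint (perturbed ι j H V) ∧
    ∀ m : ℕ, ∃ C : ℝ, 0 < C ∧
      ∀ (σ σ₁ a a₁ : ℝ → ℝ) (N N₁ : Finset ℝ),
        IsAdmissiblePair J N σ a → IsAdmissiblePair J N₁ σ₁ a₁ →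
        (∀ η : ℝ, {x ∈ J \ N₁ | a₁ x = η}.encard ≤ m) →
        (∀ x ∈ J \ (N ∪ N₁), σ₁ x ^ 2 / deriv a₁ x ≤ σ x ^ 2 / deriv a x) →
        ∀ C₀ : ℝ, 0 < C₀ → SmoothingEstimate ι H J σ a C₀ →
          SmoothingEstimate ι (perturbed ι j H V) J σ₁ a₁ (C * C₀) := by
  refine ⟨isSelfAdjoint_perturbed hι hι_dense hj hH hY hV, fun m => ?_⟩
  obtain ⟨hac, A, hAd, α, hα, -, hhol⟩ := hA
  obtain ⟨M, hM⟩ := hinv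
  have hc : ContinuousOn A J :=
    continuousOn_of_locally_holder (Z := X →L[ℂ] AntiDual X) hJ hα hhol
  -- The square of 16π|M|√m is 2πm·128πM², the constant required at the end once C₀² is split off.
  -- The added 1 keeps C positive when m or M is 0.
  refine ⟨16 * Real.pi * |M| * √m + 1, by positivity, ?_⟩
  intro σ σ₁ a a₁ N N₁ h h₁ hm hle C₀ hC₀ hS
  have hmeas : ∀ (f : X) (B : Set ℝ), MeasurableSet B → B ⊆ J →
      (spectralMeasure (perturbed ι j H V)).scalarMeasure (ι f) B ≤
        ∫⁻ x in B, ENNReal.ofReal (2 * Real.pi * M ^ 2 * ‖A x‖ * ‖f‖ ^ 2) := fun f B hB hBJ =>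
    scalarMeasure_perturbed_le hι hι_dense hj hH hac hJ hAd hc hα hhol hY hV hM f hB hBJ
  -- κ is the product of 2πM² from the domination of the perturbed spectral measures and 64C₀² from
  -- the density bound.
  refine smoothingEstimate_of_bound h₁ hJ hm (κ := 128 * Real.pi * M ^ 2 * C₀ ^ 2) (by positivity)
    (fun f G hG hGJ => ?_) ?_ (by positivity) ?_
  · rw [← lintegral_const_mul' _ _ ENNReal.ofReal_ne_top]
    have hn : ContinuousOn (fun x => ‖A x‖) J :=
      continuousOn_norm_comp (Z := X →L[ℂ] AntiDual X) hc
    have hk : Measurable (J.indicator fun x =>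
        ENNReal.ofReal (2 * Real.pi * M ^ 2 * ‖A x‖ * ‖f‖ ^ 2)) :=
      measurable_indicator_of_continuousOn hJ.measurableSet
        (ENNReal.continuous_ofReal.comp_continuousOn
          ((continuousOn_const.mul hn).mul continuousOn_const))
    refine setLIntegral_le_of_measure_le hk hG (hGJ.trans sdiff_subset) (fun B hB hBJ => ?_) ?_
    · refine (hmeas f B hB hBJ).trans (le_of_eq (setLIntegral_congr_fun hB fun x hx => ?_))
      rw [indicator_of_mem (hBJ hx)]
    · have hN0 : ∀ᵐ x : ℝ, x ∉ (N : Set ℝ) := by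
        rw [ae_iff]
        simp only [not_not]
        exact N.countable_toSet.measure_zero volume
      filter_upwards [hN0] with x hxN hxG
      have hx := hGJ hxG
      have hd := h.deriv_pos x ⟨hx.1, hxN⟩
      have hd₁ := h₁.deriv_pos x hx
      rw [indicator_of_mem hx.1, ← ENNReal.ofReal_mul (by positivity),
        ← ENNReal.ofReal_mul (by positivity)]
      refine ENNReal.ofReal_le_ofReal ?_
      have h1 := hle x ⟨hx.1, fun hxx => hxx.elim hxN hx.2⟩
      rw [div_le_div_iff₀ hd₁ hd] at h1
      have h2 := norm_density_le_of_smoothing h hac hJ hAd hc hS ⟨hx.1, hxN⟩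
      have h0 : 0 ≤ ‖A x‖ := ContinuousLinearMap.opNorm_nonneg _
      -- The density bound passes from (σ, a) to (σ₁, a₁) by cross-multiplying the comparison
      -- hypothesis; a' > 0 is then cancelled.
      have h3 : σ₁ x ^ 2 * ‖A x‖ ≤ 64 * C₀ ^ 2 * deriv a₁ x := by
        rw [← mul_le_mul_iff_of_pos_right hd]
        calc σ₁ x ^ 2 * ‖A x‖ * deriv a x = σ₁ x ^ 2 * deriv a x * ‖A x‖ := by ring
          _ ≤ σ x ^ 2 * deriv a₁ x * ‖A x‖ := mul_le_mul_of_nonneg_right h1 h0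
          _ = σ x ^ 2 * ‖A x‖ * deriv a₁ x := by ring
          _ ≤ 64 * C₀ ^ 2 * deriv a x * deriv a₁ x := mul_le_mul_of_nonneg_right h2 hd₁.le
          _ = _ := by ring
      calc 2 * Real.pi * M ^ 2 * ‖A x‖ * ‖f‖ ^ 2 * σ₁ x ^ 2
          = 2 * Real.pi * M ^ 2 * ‖f‖ ^ 2 * (σ₁ x ^ 2 * ‖A x‖) := by ring
        _ ≤ 2 * Real.pi * M ^ 2 * ‖f‖ ^ 2 * (64 * C₀ ^ 2 * deriv a₁ x) := by gcongr
        _ = _ := by ring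
  -- Over J the perturbed spectral measures of vectors from X are dominated by a density, so the
  -- finite set N₁ is null for them, and density of X extends this to 𝓗.
  · refine PVM.proj_eq_zero_of_dense hι_dense N₁.finite_toSet.measurableSet fun f => ?_
    have h1 := hmeas f N₁ N₁.finite_toSet.measurableSet h₁.subset
    rw [setLIntegral_measure_zero _ _ (N₁.countable_toSet.measure_zero volume)] at h1
    exact le_antisymm h1 (zero_le)
  · have h1 : 2 * Real.pi * m * (128 * Real.pi * M ^ 2 * C₀ ^ 2) =
        (16 * Real.pi * |M| * √m * C₀) ^ 2 := by
      rw [mul_pow, mul_pow, mul_pow, Real.sq_sqrt m.cast_nonneg, sq_abs]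
      ring
    rw [h1]
    refine pow_le_pow_left₀ (by positivity) ?_ 2
    refine mul_le_mul_of_nonneg_right ?_ hC₀.le
    linarith
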